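/- **Setting.** Fix $\theta_0\ge 1$, $0<\delta<1/\theta_0$ and functions $\chi_0,\chi_1:\mathbb R^2\to[0,1]$ of Gevrey class $\theta_0$ (i.e. smooth, and for every compact $K$ there is $C_K$ with $\sup_K|\partial^\alpha f|\le C_K^{|\alpha|+1}(\alpha!)^{\theta_0}$ for all $\alpha$), with $\operatorname{supp}\chi_0\subset\{|\xi|\le\frac43\}$, $\operatorname{supp}\chi_1\subset\{\frac34\le|\xi|\le\frac83\}$ and $\sum_{j\ge0}\chi_j\equiv1$, where $\chi_j(\xi)=\chi_1(2^{1-j}\xi)$ for $j\ge2$. Put $\mathbf Q_jf=\mathcal F^{-1}(\chi_j\widehat f)$ with $\widehat f(\eta)=\int f(x)e^{-2\pi i\eta\cdot x}dx$, $\langle x\rangle=(1+|x|^2)^{1/2}$ and $w_\mu(x)=e^{-\mu\langle x\rangle^\delta}$. Let $$\|f\|_{L^p_\mu}=\Big(\int_{\mathbb R^2}|f|^pw_\mu\,dx\Big)^{1/p},$$ and let $B^{s,\mu}_{p,q}$ be the completion of $C_c^\infty(\mathbb R^2)$ (realized as a space of distributions) under the norm $\|f\|_{B^{s,\mu}_{p,q}}=\big\|2^{sj}\|\mathbf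 Q_jf\|_{L^p_\mu}\big\|_{\ell^q_j(\mathbb Z_{\ge0})}$; the norm of a distribution outside this space is $+\infty$. **Solutions.** Let $k\ge3$ be an odd integer, $T>0$, let $Z^{(\ell)}(t)$, $0\le\ell\le k$, $0<t\le T$, be distributions on $\mathbb R^2$ with $Z^{(0)}=1$, and let $X_0$ be a distribution on $\mathbb R^2$. A solution on $[0,T]$ of $$\partial_tY+(1-\Delta)Y+\sum_{\ell=0}^kZ^{(\ell)}Y^{k-\ell}=0,\qquad Y|_{t=0}=X_0, \tag{1}$$ is a function $Y$ on $(0,T]\times\mathbb R^2$ such that: $Y(t)\in C^1(\mathbb R^2)$ for each $t\in(0,T]$, and for each $s\in(0,T]$ there are $a,M$ with $|Y(t,x)|+|\nabla Y(t,x)|\le Me^{a\langle x\rangle^\delta}$ for all $t\in[s,T]$, $x\in\mathbb R^2$; for each $\varphi\in C_c^\infty(\mathbb R^2)$ the functions $r\mapsto\langle Y(r),(\Delta-1)\varphi\rangle$ and $r\mapsto\langle Z^{(\ell)}(r)Y(r)^{k-\ell},\varphi\rangle$, $0\le\ell\le k$, are integrable on compact subintervals of $(0,T]$, and for $0<s\le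 t\le T$ $$\langle Y(t),\varphi\rangle-\langle Y(s),\varphi\rangle=\int_s^t\Big(\langle Y(r),(\Delta-1)\varphi\rangle-\sum_{\ell=0}^k\langle Z^{(\ell)}(r)Y(r)^{k-\ell},\varphi\rangle\Big)dr;$$ and $Y(t)\to X_0$ in the sense of distributions as $t\downarrow0$. Here, for all $r\in(0,T]$ and $0\le\ell\le k$, it is required that the product of the distribution $Z^{(\ell)}(r)$ with the $C^1$ function $Y(r)^{k-\ell}$ exists in the following sense: $\langle Z^{(\ell)}(r)Y(r)^{k-\ell},\varphi\rangle$ is the common limit of $\langle Z^{(\ell)}(r),\psi_n\rangle$ over all sequences $\psi_n\in C_c^\infty$ that are supported in a common compact set and converge to $Y(r)^{k-\ell}\varphi$ uniformly together with their first derivatives. **Proposition 3.1** (coming down from infinity in weighted Lebesgue spaces). Let $k\ge3$ be odd, $1\le p<\infty$ and $\mu>0$. Then there exist $\lambda>1$, $\varepsilon>0$ (which can be required to be as small as desired), $1\le p_0<\infty$ (which can be required to be as large as desired), $0<\mu_0<\mu$ and a finite constant $C$ such that, for every $T>0$, all $X_0$ and $Z^{(1)},\dots,Z^{(k)}$, and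 every solution $Y$ of (1) on $[0,T]$, $$\|Y(t)\|_{L^p_\mu}\le C\Big\{t^{-\frac1{(\lambda-1)p}}\vee\sup_{0<t'\le t}\sum_{\ell=0}^k\|Z^{(\ell)}(t')\|_{B^{-\varepsilon,\mu_0}_{p_0,p_0}}^{\frac{p_0}{\lambda p}}\Big\}\qquad\text{for all }0<t\le T.$$ In particular, $C$ is independent of the initial condition $X_0$ and of $T$. -/

import Mathlib

open MeasureTheory Filter Topology
open scoped ENNReal NNReal ContDiff Distributions FourierTransform Laplacian

noncomputable section

namespace ComingDown

/-- The plane `ℝ²` with its Euclidean norm. -/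
abbrev Plane : Type := EuclideanSpace ℝ (Fin 2)

/-- Real test functions on the plane: smooth with compact support. -/
abbrev TestFun : Type := 𝓓((⊤ : TopologicalSpace.Opens Plane), ℝ)

/-- Real distributions on the plane. -/
abbrev Distr : Type := 𝓓'((⊤ : TopologicalSpace.Opens Plane), ℝ)

/-- The bracket `⟨x⟩ = (1 + |x|²)^{1/2}`. -/
def bracket (x : Plane) : ℝ := Real.sqrt (1 + ‖x‖ ^ 2)

/-- The stretched exponential weight `w_μ(x) = exp(-μ ⟨x⟩^δ)`. -/
def weight (δ μ : ℝ) (x : Plane) : ℝ := Real.exp (-μ * bracket x ^ δ)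

/-- The norm of the weighted Lebesgue space `L^p_μ(ℝ²)`, with values in `[0, ∞]`. -/
def weightedLpNorm {F : Type*} [NormedAddCommGroup F] (δ p μ : ℝ) (f : Plane → F) : ℝ≥0∞ :=
  (∫⁻ x, ‖f x‖ₑ ^ p * ENNReal.ofReal (weight δ μ x)) ^ (1 / p)

/-- The Gevrey class of order `θ₀`. Since `α! ≤ |α|! ≤ 2^{|α|} α!` for multi-indices `α` on `ℝ²`
and `‖D^n f(x)‖` is comparable, up to a factor `2^n`, with the largest `|∂^α f(x)|`, `|α| = n`,
this is the same class as the one given by `|∂^α f| ≤ C^{|α|+1} (α!)^{θ₀}` on compact sets. -/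
def IsGevrey (θ₀ : ℝ) (f : Plane → ℝ) : Prop :=
  ContDiff ℝ ∞ f ∧
    ∀ K : Set Plane, IsCompact K → ∃ C : ℝ, 0 < C ∧ ∀ n : ℕ, ∀ x ∈ K,
      ‖iteratedFDeriv ℝ n f x‖ ≤ C ^ (n + 1) * (n.factorial : ℝ) ^ θ₀

/-- The multipliers `χ_j`: `χ_0`, `χ_1` are given and `χ_j(ξ) = χ_1(2^{1-j} ξ)` for `j ≥ 2`
(for `j = 1` this formula gives back `χ_1`). -/
def lpMultiplier (χ₀ χ₁ : Plane → ℝ) (j : ℕ) (ξ : Plane) : ℝ :=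
  if j = 0 then χ₀ ξ else χ₁ ((2 : ℝ) ^ (1 - (j : ℤ)) • ξ)

/-- `(χ₀, χ₁)` generates a dyadic partition of unity of Gevrey class `θ₀`. -/
structure IsLittlewoodPaleyPair (θ₀ : ℝ) (χ₀ χ₁ : Plane → ℝ) : Prop where
  gevrey_zero : IsGevrey θ₀ χ₀
  gevrey_one : IsGevrey θ₀ χ₁
  range_zero : ∀ ξ, χ₀ ξ ∈ Set.Icc (0 : ℝ) 1
  range_one : ∀ ξ, χ₁ ξ ∈ Set.Icc (0 : ℝ) 1
  supp_zero : tsupport χ₀ ⊆ {ξ | ‖ξ‖ ≤ 4 / 3}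
  supp_one : tsupport χ₁ ⊆ {ξ | 3 / 4 ≤ ‖ξ‖ ∧ ‖ξ‖ ≤ 8 / 3}
  sum_eq_one : ∀ ξ, HasSum (fun j : ℕ => lpMultiplier χ₀ χ₁ j ξ) 1

/-- The Littlewood-Paley block `Q_j φ = 𝓕⁻¹(χ_j 𝓕 φ)` of a test function, where
`𝓕 φ(η) = ∫ φ(x) e^{-2πi η·x} dx`. -/
def lpBlock (χ₀ χ₁ : Plane → ℝ) (j : ℕ) (φ : TestFun) : Plane → ℂ :=
  𝓕⁻ (fun ξ : Plane =>
    (lpMultiplier χ₀ χ₁ j ξ : ℂ) * 𝓕 (fun x : Plane => ((φ x : ℝ) : ℂ)) ξ)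

/-- The norm of `B^{s,μ}_{p,q}(ℝ²)`, for finite `p` and `q`, of a test function. -/
def besovTestNorm (χ₀ χ₁ : Plane → ℝ) (δ s μ p q : ℝ) (φ : TestFun) : ℝ≥0∞ :=
  (∑' j : ℕ, (ENNReal.ofReal ((2 : ℝ) ^ (s * j)) * weightedLpNorm δ p μ (lpBlock χ₀ χ₁ j φ)) ^ q)
    ^ (1 / q)

/-- The sequence of test functions `φ n` is Cauchy in the norm of `B^{s,μ}_{p,q}(ℝ²)` and
converges to `f` in the sense of distributions: it represents `f` as an element of the completion
of `C_c^∞(ℝ²)` under this norm. -/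
def IsBesovApprox (χ₀ χ₁ : Plane → ℝ) (δ s μ p q : ℝ) (f : Distr) (φ : ℕ → TestFun) : Prop :=
  (∀ η : ℝ≥0∞, 0 < η → ∃ N : ℕ, ∀ m n : ℕ, N ≤ m → N ≤ n →
      besovTestNorm χ₀ χ₁ δ s μ p q (φ m - φ n) ≤ η) ∧
    ∀ ψ : TestFun, Tendsto (fun n => ∫ x, φ n x * ψ x) atTop (𝓝 (f ψ))

/-- The norm of `B^{s,μ}_{p,q}(ℝ²)`, the completion of `C_c^∞(ℝ²)`, on distributions: the limit
of the norms along an approximating Cauchy sequence of test functions (it does not depend on the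
sequence, so the infimum is over equal numbers), and `∞` if `f` is not in the space. -/
def besovNorm (χ₀ χ₁ : Plane → ℝ) (δ s μ p q : ℝ) (f : Distr) : ℝ≥0∞ :=
  ⨅ (φ : ℕ → TestFun) (_ : IsBesovApprox χ₀ χ₁ δ s μ p q f φ),
    liminf (fun n => besovTestNorm χ₀ χ₁ δ s μ p q (φ n)) atTop

/-- The extension by continuity of the distribution `Z` to compactly supported `C¹` functions
takes the value `c` at `h`: `Z(ψ_n) → c` whenever the test functions `ψ_n`, supported in a common
compact set, converge to `h` uniformly together with their first derivatives. With `h = g φ`,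
this says that the product of `Z` with the `C¹` function `g` takes the value `c` at the test
function `φ`. -/
def HasC1Value (Z : Distr) (h : Plane → ℝ) (c : ℝ) : Prop :=
  ∀ ψ : ℕ → TestFun,
    (∃ K : Set Plane, IsCompact K ∧ ∀ n, tsupport (ψ n) ⊆ K) →
    TendstoUniformly (fun n x => ψ n x) h atTop →
    TendstoUniformly (fun n x => fderiv ℝ (ψ n) x) (fun x => fderiv ℝ h x) atTop →
    Tendsto (fun n => Z (ψ n)) atTop (𝓝 c)

/-- `Y` is a solution on `[0, T]` of
`∂_t Y + (1 - Δ) Y + ∑_{ℓ=0}^k Z^{(ℓ)} Y^{k-ℓ} = 0`, `Y|_{t=0} = X₀`, with `Z^{(0)} = 1`: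
for positive times, `Y` is of class `C¹` in space with stretched exponential growth, locally
uniformly in time; the equation holds in the weak (distributional) sense; and the initial
condition is attained in the sense of distributions. -/
structure IsSolution (δ : ℝ) (k : ℕ) (T : ℝ) (X₀ : Distr) (Z : ℕ → ℝ → Distr)
    (Y : ℝ → Plane → ℝ) : Prop where
  noise_zero : ∀ t, 0 < t → t ≤ T → ∀ φ : TestFun, Z 0 t φ = ∫ x, φ x
  contDiff : ∀ t, 0 < t → t ≤ T → ContDiff ℝ 1 (Y t)
  growth : ∀ s, 0 < s → s ≤ T → ∃ a M : ℝ, ∀ t, s ≤ t → t ≤ T → ∀ x,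
    |Y t x| + ‖fderiv ℝ (Y t) x‖ ≤ M * Real.exp (a * bracket x ^ δ)
  equation : ∃ N : ℕ → ℝ → TestFun → ℝ,
    -- `N ℓ t` is the product `Z^{(ℓ)}(t) Y(t)^{k-ℓ}`
    (∀ ℓ ≤ k, ∀ t, 0 < t → t ≤ T → ∀ φ : TestFun,
      HasC1Value (Z ℓ t) (fun x => Y t x ^ (k - ℓ) * φ x) (N ℓ t φ)) ∧
    ∀ φ : TestFun, ∀ s t, 0 < s → s ≤ t → t ≤ T →
      IntervalIntegrable (fun r => ∫ x, Y r x * (Δ (φ : Plane → ℝ) x - φ x)) volume s t ∧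
      (∀ ℓ ≤ k, IntervalIntegrable (fun r => N ℓ r φ) volume s t) ∧
      (∫ x, Y t x * φ x) - ∫ x, Y s x * φ x =
        ∫ r in s..t, ((∫ x, Y r x * (Δ (φ : Plane → ℝ) x - φ x))
          - ∑ ℓ ∈ Finset.range (k + 1), N ℓ r φ)
  initial : ∀ φ : TestFun, Tendsto (fun t => ∫ x, Y t x * φ x) (𝓝[>] 0) (𝓝 (X₀ φ))

end ComingDown

end

/-!
Coming down from infinity for a dissipative equation with odd nonlinearity and rough coefficients,
in weighted Lebesgue spaces on the plane.

The mechanism is an `L ^ {2r}` energy estimate in which the term `Y ^ k` produces a superlinear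
damping. Let `M = 2r + k - 1` and let `ρ` be the weight `w_μ`, localized to a ball of radius `R` by
the `M`-th power of a cutoff. Testing the equation with `Y ^ {2r - 1} ρ` gives the coercive terms
`∫ Y ^ M ρ` and `∫ |∇Y|² |Y| ^ {2r - 2} ρ`; together with `∫ w_μ` they form the energy `E`
(`energy`). Everything else is of lower order, by a power counting at a single point
(`exists_root_density`): with `t` the `2M`-th root of the energy density, `|Y|` counts as `t ^ 2`,
and each lower order term is at most `t ^ {2M - 1}`.

The noise terms `⟨Z, Y ^ m ρ⟩` with `2r - 1 ≤ m ≤ M - 1` are handled by duality with the Besov space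
of regularity `-ε` (`exists_duality_bound`). No Besov norm of `Y ^ m ρ` is needed: it suffices to
exhibit, for each frequency `2 ^ j`, a `C¹` function close to `Y ^ m ρ` whose gradient is under
control (`InterpolationBound`), and powers of a truncation of `Y` at a small power of `2 ^ j` do this
(`interpolationBound_pow`). The weighted `L ^ {p₀}` duality costs only the power
`E ^ {1 - 1 / p₀}`, so that Young's inequality absorbs it (`exists_energy_estimate`). The duality
rests on the stretched exponential decay of the Littlewood-Paley kernels, which follows from the
Gevrey regularity of the multipliers, and on the mean zero property of the blocks `j ≥ 1`. It is
first proved for test functions in place of `Z` and then passes to the completion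
(`abs_value_sub_le`), which is where the products in the definition of a solution are identified.

As the weight has finite mass, `E` controls `F ^ {M / (2r)}` with `F = ∫ Y ^ {2r} ρ`
(`rpow_mass_le_energy`), and so `F` satisfies `F' ≤ -c F ^ {M / (2r)} + K` with constants that do not
depend on `R`. The solution is not differentiable in time, and the inequality is established in
integrated form, for mollifications of `Y` and by convexity of `y ↦ y ^ {2r}`
(`RegularFlow.mass_sub_le`). The resulting bound on `F` (`le_of_integral_inequality`) does not see
the values of `F` at earlier times, so it can be used on `[t / 2, t]`, and `R → ∞` concludes
(`exists_apriori_bound`). The right-hand side of the claim has no additive constant: the noise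
`Z 0 = 1` has a positive Besov norm (`exists_le_besovNorm_one`), which absorbs it.
-/

namespace ComingDown

/-! ### The bracket and the stretched exponential weights -/

lemma one_le_bracket (x : Plane) : 1 ≤ bracket x := by
  unfold bracket
  rw [Real.one_le_sqrt]
  nlinarith [sq_nonneg ‖x‖]

lemma bracket_pos (x : Plane) : 0 < bracket x := zero_lt_one.trans_le (one_le_bracket x)

lemma norm_le_bracket (x : Plane) : ‖x‖ ≤ bracket x :=
  Real.le_sqrt_of_sq_le (by linarith)

lemma bracket_sq (x : Plane) : bracket x ^ 2 = 1 + ‖x‖ ^ 2 :=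
  Real.sq_sqrt (by positivity)

lemma bracket_le_add (x y : Plane) : bracket y ≤ bracket x + ‖y - x‖ := by
  refine Real.sqrt_le_iff.2 ⟨add_nonneg (bracket_pos x).le (norm_nonneg _), ?_⟩
  have h1 : ‖y‖ ≤ ‖x‖ + ‖y - x‖ := by
    simpa using norm_add_le x (y - x)
  nlinarith [bracket_sq x, norm_le_bracket x, norm_nonneg (y - x), norm_nonneg x, norm_nonneg y]

lemma contDiff_bracket : ContDiff ℝ ∞ bracket :=
  (contDiff_const.add (contDiff_norm_sq ℝ)).sqrt fun x => by positivity

lemma weight_pos (δ μ : ℝ) (x : Plane) : 0 < weight δ μ x := Real.exp_pos _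

lemma contDiff_weight (δ μ : ℝ) : ContDiff ℝ ∞ (weight δ μ) :=
  (contDiff_const.mul (contDiff_bracket.rpow_const_of_ne fun x => (bracket_pos x).ne')).exp

lemma continuous_weight (δ μ : ℝ) : Continuous (weight δ μ) := (contDiff_weight δ μ).continuous

lemma weight_rpow (δ μ a : ℝ) (x : Plane) : weight δ μ x ^ a = weight δ (a * μ) x := by
  rw [weight, weight, ← Real.exp_mul]; ring_nf

lemma weight_mul (δ μ ν : ℝ) (x : Plane) :
    weight δ μ x * weight δ ν x = weight δ (μ + ν) x := by
  rw [weight, weight, weight, ← Real.exp_add]; ring_nf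

/-- The growing weights are submultiplicative, because `r ↦ r ^ δ` is subadditive. -/
lemma weight_neg_le {δ ν : ℝ} (hδ : 0 < δ) (hδ1 : δ ≤ 1) (hν : 0 ≤ ν) (x y : Plane) {r : ℝ}
    (hr : ‖y - x‖ ≤ r) :
    weight δ (-ν) y ≤ weight δ (-ν) x * Real.exp (ν * r ^ δ) := by
  rw [weight, weight, ← Real.exp_add]
  refine Real.exp_le_exp.2 ?_
  have h0 : 0 ≤ r := (norm_nonneg _).trans hr
  have h1 : bracket y ^ δ ≤ bracket x ^ δ + r ^ δ :=
    (Real.rpow_le_rpow (bracket_pos y).le ((bracket_le_add x y).trans (by linarith)) hδ.le).trans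
      (Real.rpow_add_le_add_rpow (bracket_pos x).le h0 hδ.le hδ1)
  nlinarith

lemma exists_pow_mul_exp_le (N : ℕ) (a : ℝ) {c δ α : ℝ} (hc : 0 < c) (hδ : 0 < δ) (hδα : δ < α) :
    ∃ C : ℝ, 0 < C ∧ ∀ r : ℝ, 0 ≤ r →
      (1 + r) ^ N * Real.exp (a * r ^ δ) ≤ C * Real.exp (c * r ^ α) := by
  have hα : 0 < α := hδ.trans hδα
  have h1 : (fun r : ℝ => a * r ^ δ) =o[atTop] fun r => r ^ α := by
    refine Asymptotics.IsLittleO.const_mul_left ?_ a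
    refine (Asymptotics.isLittleO_iff_tendsto' ?_).2 ?_
    · filter_upwards [eventually_gt_atTop 0] with r hr h
      exact absurd h (Real.rpow_pos_of_pos hr _).ne'
    · refine (tendsto_rpow_neg_atTop (sub_pos.2 hδα)).congr' ?_
      filter_upwards [eventually_gt_atTop 0] with r hr
      rw [← Real.rpow_sub hr, neg_sub]
  have h2 : (fun r : ℝ => (1 + r) ^ N) =O[atTop] fun r => Real.exp (c / 2 * r ^ α) := by
    have h3 : (fun r : ℝ => (1 + r) ^ N) =O[atTop] fun r : ℝ => (r ^ α) ^ (N / α) := by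
      have h4 : (fun r : ℝ => (1 + r)) =O[atTop] fun r : ℝ => r := by
        refine Asymptotics.IsBigO.of_bound 2 ?_
        filter_upwards [eventually_ge_atTop 1] with r hr
        rw [Real.norm_of_nonneg (by linarith), Real.norm_of_nonneg (by linarith)]
        linarith
      refine (h4.pow N).congr' EventuallyEq.rfl ?_
      filter_upwards [eventually_ge_atTop 1] with r hr
      rw [← Real.rpow_mul (by linarith), mul_div_cancel₀ _ hα.ne', Real.rpow_natCast]
    refine h3.trans ?_
    exact ((isLittleO_rpow_exp_pos_mul_atTop (N / α) (half_pos hc)).comp_tendsto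
      (tendsto_rpow_atTop hα)).isBigO
  have h3 : (fun r : ℝ => Real.exp (a * r ^ δ)) =O[atTop] fun r => Real.exp (c / 2 * r ^ α) := by
    refine Asymptotics.IsBigO.of_bound 1 ?_
    filter_upwards [h1.bound (half_pos hc), eventually_ge_atTop 0] with r hr hr0
    rw [one_mul, Real.norm_of_nonneg (Real.exp_nonneg _), Real.norm_of_nonneg (Real.exp_nonneg _)]
    rw [Real.norm_of_nonneg (Real.rpow_nonneg hr0 _)] at hr
    exact Real.exp_le_exp.2 ((le_abs_self _).trans hr)
  have h4 : (fun r : ℝ => (1 + r) ^ N * Real.exp (a * r ^ δ))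
      =O[atTop] fun r => Real.exp (c * r ^ α) := by
    refine (h2.mul h3).congr_right fun r => ?_
    rw [← Real.exp_add]; ring_nf
  obtain ⟨C₁, hC₁⟩ := h4.bound
  obtain ⟨R, hR⟩ := eventually_atTop.1 hC₁
  have hcont : Continuous fun r : ℝ => (1 + r) ^ N * Real.exp (a * r ^ δ) :=
    ((continuous_const.add continuous_id).pow N).mul
      (Real.continuous_exp.comp (continuous_const.mul (Real.continuous_rpow_const hδ.le)))
  obtain ⟨C₂, hC₂⟩ := (isCompact_Icc (a := 0) (b := R)).exists_bound_of_continuousOn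
    hcont.continuousOn
  refine ⟨max (max C₁ C₂) 1, by positivity, fun r hr => ?_⟩
  have hE : 1 ≤ Real.exp (c * r ^ α) :=
    Real.one_le_exp_iff.2 (mul_nonneg hc.le (Real.rpow_nonneg hr _))
  rcases le_total R r with h | h
  · have := (le_abs_self _).trans (hR r h)
    rw [Real.norm_of_nonneg (Real.exp_nonneg _)] at this
    refine this.trans (mul_le_mul_of_nonneg_right ?_ (Real.exp_nonneg _))
    exact (le_max_left _ _).trans (le_max_left _ _)
  · have := (le_abs_self _).trans (hC₂ r ⟨hr, h⟩)
    have h5 : C₂ ≤ max (max C₁ C₂) 1 := (le_max_right _ _).trans (le_max_left _ _)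
    have h6 : (1 : ℝ) ≤ max (max C₁ C₂) 1 := le_max_right _ _
    nlinarith

lemma finrank_plane : Module.finrank ℝ Plane = 2 := by simp

lemma integrable_one_add_norm_rpow :
    Integrable (fun x : Plane => ((1 : ℝ) + ‖x‖) ^ (-3 : ℝ)) :=
  integrable_one_add_norm (by rw [finrank_plane]; norm_num)

/-- A stretched exponential beats any stretched exponential growth of lower order, with room for
an integrable power. -/
lemma integrable_exp_mul_exp (N : ℕ) (a : ℝ) {c δ α : ℝ} (hc : 0 < c) (hδ : 0 < δ) (hδα : δ < α) :
    Integrable (fun x : Plane =>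
      (1 + ‖x‖) ^ N * Real.exp (a * ‖x‖ ^ δ) * Real.exp (-c * ‖x‖ ^ α)) := by
  obtain ⟨C, hC, h⟩ := exists_pow_mul_exp_le (N + 3) a hc hδ hδα
  have hα : 0 < α := hδ.trans hδα
  refine (integrable_one_add_norm_rpow.const_mul C).mono' ?_ (ae_of_all _ fun x => ?_)
  · refine Continuous.aestronglyMeasurable ?_
    have h1 : Continuous fun x : Plane => ‖x‖ ^ δ :=
      (Real.continuous_rpow_const hδ.le).comp continuous_norm
    have h2 : Continuous fun x : Plane => ‖x‖ ^ α :=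
      (Real.continuous_rpow_const hα.le).comp continuous_norm
    fun_prop
  · have h1 : (0 : ℝ) < 1 + ‖x‖ := by positivity
    rw [Real.norm_of_nonneg (by positivity), Real.rpow_neg h1.le]
    have h2 := h ‖x‖ (norm_nonneg x)
    rw [pow_add] at h2
    have h3 : ((1 : ℝ) + ‖x‖) ^ (3 : ℝ) = (1 + ‖x‖) ^ 3 := by
      exact_mod_cast Real.rpow_natCast (1 + ‖x‖) 3
    rw [h3, neg_mul, Real.exp_neg, ← div_eq_mul_inv, ← div_eq_mul_inv,
      div_le_div_iff₀ (Real.exp_pos _) (by positivity)]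
    nlinarith

lemma integrable_weight {δ μ : ℝ} (hδ : 0 < δ) (hμ : 0 < μ) : Integrable (weight δ μ) := by
  refine (integrable_exp_mul_exp 0 0 hμ (half_pos hδ) (half_lt_self hδ)).mono'
    (continuous_weight δ μ).aestronglyMeasurable (ae_of_all _ fun x => ?_)
  rw [Real.norm_of_nonneg (weight_pos _ _ _).le, pow_zero, zero_mul, Real.exp_zero, one_mul, one_mul]
  refine Real.exp_le_exp.2 ?_
  have := Real.rpow_le_rpow (norm_nonneg x) (norm_le_bracket x) hδ.le
  nlinarith

/-- The logarithmic derivative of the weight is bounded since `δ ≤ 1`. -/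
lemma norm_fderiv_weight_le {δ μ : ℝ} (hδ : 0 < δ) (hδ1 : δ ≤ 1) (hμ : 0 < μ) (x : Plane) :
    ‖fderiv ℝ (weight δ μ) x‖ ≤ μ * weight δ μ x := by
  have hb : ∀ y, HasFDerivAt bracket (fderiv ℝ bracket y) y := fun y =>
    ((contDiff_bracket.differentiable (by simp)) y).hasFDerivAt
  have hb1 : ‖fderiv ℝ bracket x‖ ≤ 1 := by
    have : LipschitzWith 1 bracket := LipschitzWith.of_le_add fun y z => by
      rw [dist_eq_norm]; exact bracket_le_add z y
    simpa using norm_fderiv_le_of_lipschitz ℝ this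
  have h1 := ((hb x).rpow_const (p := δ) (Or.inl (bracket_pos x).ne')).const_mul (-μ)
  have h2 : HasFDerivAt (weight δ μ) _ x := h1.exp
  rw [h2.fderiv, norm_smul, norm_smul, norm_smul]
  change ‖weight δ μ x‖ * _ ≤ _
  rw [Real.norm_of_nonneg (weight_pos _ _ _).le, norm_neg, Real.norm_of_nonneg hμ.le, mul_comm]
  refine mul_le_mul_of_nonneg_right ?_ (weight_pos _ _ _).le
  have h3 : bracket x ^ (δ - 1) ≤ 1 :=
    Real.rpow_le_one_of_one_le_of_nonpos (one_le_bracket x) (by linarith)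
  have h4 : 0 ≤ bracket x ^ (δ - 1) := Real.rpow_nonneg (bracket_pos x).le _
  rw [Real.norm_of_nonneg (by positivity)]
  have h5 : δ * bracket x ^ (δ - 1) ≤ 1 := by nlinarith
  have h6 : δ * bracket x ^ (δ - 1) * ‖fderiv ℝ bracket x‖ ≤ 1 := by
    have : 0 ≤ δ * bracket x ^ (δ - 1) := by positivity
    nlinarith [norm_nonneg (fderiv ℝ bracket x)]
  nlinarith

/-! ### Fourier kernels of Gevrey multipliers -/

lemma one_add_le_two_pow (n : ℕ) : (n : ℝ) + 1 ≤ 2 ^ n := by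
  induction n with
  | zero => simp
  | succ n ih => push_cast; rw [pow_succ]; nlinarith [show (0 : ℝ) ≤ n from n.cast_nonneg]

/-- The moments of the Fourier transform of a compactly supported Gevrey function. -/
lemma exists_pow_mul_norm_fourier_le {θ : ℝ} (hθ : 0 ≤ θ) {m : Plane → ℝ} (hm : IsGevrey θ m)
    (hs : HasCompactSupport m) :
    ∃ B : ℝ, 0 < B ∧ ∀ (n : ℕ) (x : Plane),
      ‖x‖ ^ n * ‖𝓕 (fun ξ => (m ξ : ℂ)) x‖ ≤ B ^ (n + 1) * (n.factorial : ℝ) ^ θ := by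
  obtain ⟨hsm, hG⟩ := hm
  obtain ⟨C, hC, hCb⟩ := hG _ hs
  set f : Plane → ℂ := fun ξ => (m ξ : ℂ) with hf
  have hfs : ContDiff ℝ ∞ f := Complex.ofRealCLM.contDiff.comp hsm
  have hnorm : ∀ n x, ‖iteratedFDeriv ℝ n f x‖ = ‖iteratedFDeriv ℝ n m x‖ := fun n x =>
    Complex.ofRealLI.norm_iteratedFDeriv_comp_left (f := m) (n := ∞) hsm.contDiffAt
      (by exact_mod_cast le_top)
  have hcont : ∀ n, Continuous fun x => ‖iteratedFDeriv ℝ n m x‖ := fun n =>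
    (hsm.continuous_iteratedFDeriv (by exact_mod_cast le_top)).norm
  have hcs : ∀ n, HasCompactSupport fun x => ‖iteratedFDeriv ℝ n m x‖ := fun n =>
    (hs.iteratedFDeriv n).norm
  have hint : ∀ k n : ℕ, Integrable fun v : Plane => ‖v‖ ^ k * ‖iteratedFDeriv ℝ n f v‖ := by
    intro k n
    simp only [hnorm]
    exact ((continuous_norm.pow k).mul (hcont n)).integrable_of_hasCompactSupport
      ((hcs n).mul_left)
  set V : ℝ := volume.real (tsupport m)
  have hV : 0 ≤ V := measureReal_nonneg
  set A : ℝ := max C 1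
  have hA : 1 ≤ A := le_max_right _ _
  have hI : ∀ j n : ℕ, j ≤ n →
      ∫ v, ‖iteratedFDeriv ℝ j f v‖ ≤ V * (A ^ (n + 1) * (n.factorial : ℝ) ^ θ) := by
    intro j n hjn
    simp only [hnorm]
    have h1 : ∫ v, ‖iteratedFDeriv ℝ j m v‖ = ∫ v in tsupport m, ‖iteratedFDeriv ℝ j m v‖ := by
      refine (setIntegral_eq_integral_of_forall_compl_eq_zero fun x hx => ?_).symm
      have := support_iteratedFDeriv_subset (𝕜 := ℝ) (f := m) j
      rw [norm_eq_zero]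
      by_contra h
      exact hx (this h)
    rw [h1]
    have h2 := norm_setIntegral_le_of_norm_le_const (μ := volume) (s := tsupport m)
      (f := fun v => ‖iteratedFDeriv ℝ j m v‖) (C := A ^ (n + 1) * (n.factorial : ℝ) ^ θ)
      (hs.measure_lt_top) (fun x hx => by
        rw [norm_norm]
        refine (hCb j x hx).trans ?_
        gcongr ?_ * ?_
        · exact (pow_le_pow_left₀ hC.le (le_max_left _ _) _).trans
            (pow_le_pow_right₀ hA (by omega))
        · exact Real.rpow_le_rpow (by positivity)
            (by exact_mod_cast Nat.factorial_le hjn) hθ)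
    rw [mul_comm]
    exact (le_abs_self _).trans h2
  refine ⟨4 * A * (V + 1), by positivity, fun n x => ?_⟩
  have hmain := Real.pow_mul_norm_iteratedFDeriv_fourier_le (K := ⊤) (N := ⊤) (f := f)
    hfs (fun k n _ _ => hint k n) (k := 0) (n := n) le_top le_top x
  rw [norm_iteratedFDeriv_zero] at hmain
  refine hmain.trans ?_
  have hsum : ∑ p ∈ Finset.range (0 + 1) ×ˢ Finset.range (n + 1),
      ∫ v, ‖v‖ ^ p.1 * ‖iteratedFDeriv ℝ p.2 f v‖
      ≤ (n + 1) * (V * (A ^ (n + 1) * (n.factorial : ℝ) ^ θ)) := by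
    have : ∀ p ∈ Finset.range (0 + 1) ×ˢ Finset.range (n + 1),
        ∫ v, ‖v‖ ^ p.1 * ‖iteratedFDeriv ℝ p.2 f v‖
          ≤ V * (A ^ (n + 1) * (n.factorial : ℝ) ^ θ) := by
      intro p hp
      simp only [Finset.mem_product, Finset.mem_range] at hp
      have h0 : p.1 = 0 := by omega
      simp only [h0, pow_zero, one_mul]
      exact hI _ _ (by omega)
    refine (Finset.sum_le_card_nsmul _ _ _ this).trans ?_
    simp
  have hF : (0 : ℝ) ≤ (n.factorial : ℝ) ^ θ := by positivity
  calc (2 * Real.pi) ^ 0 * (2 * ((0 : ℕ) : ℝ) + 2) ^ n * _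
      ≤ (2 * Real.pi) ^ 0 * (2 * ((0 : ℕ) : ℝ) + 2) ^ n *
        ((n + 1) * (V * (A ^ (n + 1) * (n.factorial : ℝ) ^ θ))) := by
        gcongr
    _ = 2 ^ n * (n + 1) * V * A ^ (n + 1) * (n.factorial : ℝ) ^ θ := by simp; ring
    _ ≤ 4 ^ (n + 1) * (V + 1) ^ (n + 1) * A ^ (n + 1) * (n.factorial : ℝ) ^ θ := by
        have h1 : V ≤ (V + 1) ^ (n + 1) :=
          (by linarith : V ≤ V + 1).trans (le_self_pow₀ (by linarith) (by omega))
        have h2 : (2 : ℝ) ^ n * (n + 1) ≤ 4 ^ (n + 1) := by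
          have : (4 : ℝ) ^ (n + 1) = 2 ^ n * 2 ^ n * 4 := by
            rw [pow_succ, ← mul_pow]; norm_num
          rw [this]
          have h3 := one_add_le_two_pow n
          have h4 : (0 : ℝ) < 2 ^ n := by positivity
          nlinarith [mul_pos h4 h4]
        gcongr
    _ = (4 * A * (V + 1)) ^ (n + 1) * (n.factorial : ℝ) ^ θ := by
        rw [mul_pow, mul_pow]; ring

/-- The Fourier transform of a compactly supported function of Gevrey order `θ` decays like
`exp (-c |x| ^ (1 / θ))`: the moment bounds are summed against the exponential series. -/
lemma exists_norm_fourier_le_exp {θ : ℝ} (hθ : 1 ≤ θ) {m : Plane → ℝ} (hm : IsGevrey θ m)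
    (hs : HasCompactSupport m) :
    ∃ c C : ℝ, 0 < c ∧ 0 < C ∧ ∀ x : Plane,
      ‖𝓕 (fun ξ => (m ξ : ℂ)) x‖ ≤ C * Real.exp (-c * ‖x‖ ^ (1 / θ)) := by
  have hθ0 : 0 < θ := by linarith
  obtain ⟨B, hB, h⟩ := exists_pow_mul_norm_fourier_le hθ0.le hm hs
  set t : ℝ := 1 / θ with ht
  have ht0 : 0 < t := by positivity
  set b : ℝ := B ^ t with hb
  have hb0 : 0 < b := by positivity
  refine ⟨θ * (1 / (2 * b)), (2 * b) ^ θ, by positivity, by positivity, fun x => ?_⟩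
  set K : ℝ := ‖𝓕 (fun ξ => (m ξ : ℂ)) x‖ with hK
  have hK0 : 0 ≤ K := norm_nonneg _
  set X : ℝ := 1 / (2 * b) * ‖x‖ ^ t with hX
  have hterm : ∀ n : ℕ, X ^ n / n.factorial * K ^ t ≤ b * (1 / 2) ^ n := by
    intro n
    have h1 := Real.rpow_le_rpow (by positivity) (h n x) ht0.le
    rw [Real.mul_rpow (by positivity) hK0, Real.mul_rpow (by positivity) (by positivity),
      ← Real.rpow_mul (by positivity), mul_one_div_cancel hθ0.ne', Real.rpow_one,
      ← Real.rpow_natCast, ← Real.rpow_natCast, ← Real.rpow_mul (norm_nonneg _),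
      ← Real.rpow_mul hB.le, mul_comm (n : ℝ), mul_comm ((n + 1 : ℕ) : ℝ),
      Real.rpow_mul (norm_nonneg _), Real.rpow_mul hB.le, Real.rpow_natCast,
      Real.rpow_natCast] at h1
    have hn : (0 : ℝ) < n.factorial := by positivity
    rw [hX, mul_pow, div_mul_eq_mul_div, div_le_iff₀ hn, one_div, inv_pow, mul_pow, one_div,
      inv_pow]
    calc ((2 : ℝ) ^ n * b ^ n)⁻¹ * (‖x‖ ^ t) ^ n * K ^ t
        = ((2 : ℝ) ^ n * b ^ n)⁻¹ * ((‖x‖ ^ t) ^ n * K ^ t) := by ring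
      _ ≤ ((2 : ℝ) ^ n * b ^ n)⁻¹ * (b ^ (n + 1) * n.factorial) := by gcongr
      _ = b * (2 ^ n)⁻¹ * n.factorial := by field_simp; ring
  have hexp : HasSum (fun n : ℕ => X ^ n / n.factorial * K ^ t) (Real.exp X * K ^ t) := by
    rw [Real.exp_eq_exp_ℝ]
    exact (NormedSpace.expSeries_div_hasSum_exp X).mul_right _
  have hgeo : HasSum (fun n : ℕ => b * (1 / 2 : ℝ) ^ n) (b * 2) := by
    exact hasSum_geometric_two.mul_left b
  have hle : Real.exp X * K ^ t ≤ b * 2 := hasSum_le hterm hexp hgeo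
  have hle2 : K ^ t ≤ 2 * b * Real.exp (-X) := by
    rw [Real.exp_neg, ← div_eq_mul_inv, le_div_iff₀ (Real.exp_pos _)]
    linarith
  have h3 := Real.rpow_le_rpow (by positivity) hle2 hθ0.le
  rw [← Real.rpow_mul hK0, ht, one_div_mul_cancel hθ0.ne', Real.rpow_one,
    Real.mul_rpow (by positivity) (Real.exp_nonneg _), ← Real.exp_mul] at h3
  refine h3.trans (le_of_eq ?_)
  rw [hX]; ring_nf

/-- Moments of the kernel against the growing weights. -/
lemma integrable_fourier_mul_exp {θ δ : ℝ} (hθ : 1 ≤ θ) (hδ : 0 < δ) (hδθ : δ < 1 / θ)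
    {m : Plane → ℝ} (hm : IsGevrey θ m) (hs : HasCompactSupport m) (a : ℝ) :
    Integrable fun x : Plane =>
      ‖𝓕 (fun ξ => (m ξ : ℂ)) x‖ * ((1 + ‖x‖) * Real.exp (a * ‖x‖ ^ δ)) := by
  obtain ⟨c, C, hc, hC, h⟩ := exists_norm_fourier_le_exp hθ hm hs
  refine ((integrable_exp_mul_exp 1 a hc hδ hδθ).const_mul C).mono' ?_ (ae_of_all _ fun x => ?_)
  · have h1 : Continuous fun x : Plane => ‖x‖ ^ δ :=
      (Real.continuous_rpow_const hδ.le).comp continuous_norm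
    have hi : Integrable (fun ξ : Plane => (m ξ : ℂ)) :=
      (Complex.continuous_ofReal.comp hm.1.continuous).integrable_of_hasCompactSupport
        (hs.comp_left Complex.ofReal_zero)
    have h2 : Continuous (𝓕 (fun ξ : Plane => (m ξ : ℂ))) :=
      VectorFourier.fourierIntegral_continuous Real.continuous_fourierChar
        continuous_inner hi
    refine Continuous.aestronglyMeasurable ?_
    fun_prop
  · rw [Real.norm_of_nonneg (by positivity)]
    have := h x
    have h0 : 0 ≤ (1 + ‖x‖) * Real.exp (a * ‖x‖ ^ δ) := by positivity
    calc _ ≤ C * Real.exp (-c * ‖x‖ ^ (1 / θ)) * ((1 + ‖x‖) * Real.exp (a * ‖x‖ ^ δ)) :=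
          mul_le_mul_of_nonneg_right this h0
      _ = _ := by rw [pow_one]; ring

/-! ### Fourier multipliers as convolutions -/

lemma integral_fourier_mul_eq_flip {f g : Plane → ℂ} (hf : Integrable f) (hg : Integrable g) :
    ∫ x, 𝓕 f x * g x = ∫ x, f x * 𝓕 g x := by
  have := VectorFourier.integral_fourierIntegral_smul_eq_flip (L := innerₗ Plane)
    (μ := volume) (ν := volume) Real.continuous_fourierChar continuous_inner hf hg
  rw [flip_innerₗ] at this
  exact this

lemma integral_fourierInv_mul_eq_flip {f g : Plane → ℂ} (hf : Integrable f) (hg : Integrable g) :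
    ∫ x, 𝓕⁻ f x * g x = ∫ x, f x * 𝓕⁻ g x := by
  have h1 : ∫ x, 𝓕⁻ f x * g x = ∫ x, 𝓕 f x * g (-x) := by
    rw [← integral_neg_eq_self]
    simp [Real.fourierInv_eq_fourier_neg]
  rw [h1, integral_fourier_mul_eq_flip hf hg.comp_neg, Real.fourierInv_eq_fourier_comp_neg]

lemma continuous_fourierInv {f : Plane → ℂ} (hf : Integrable f) : Continuous (𝓕⁻ f) := by
  have : Continuous (𝓕 f) :=
    VectorFourier.fourierIntegral_continuous Real.continuous_fourierChar continuous_inner hf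
  have h : 𝓕⁻ f = fun x => 𝓕 f (-x) := by
    ext x; exact Real.fourierInv_eq_fourier_neg f x
  rw [h]
  exact this.comp continuous_neg

/-- The action of the Fourier multiplier `m` on the function `h`, as a convolution with the
kernel `𝓕 m` (which is the reflected inverse Fourier transform of `m`). -/
noncomputable def multConv (m : Plane → ℂ) (h : Plane → ℂ) (y : Plane) : ℂ := ∫ z, 𝓕 m z * h (y - z)

lemma fourier_schwartz (m : SchwartzMap Plane ℂ) : Integrable (𝓕 (m : Plane → ℂ)) := by
  rw [← SchwartzMap.fourier_coe]
  exact (𝓕 m).integrable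

lemma integrable_multConv (m : SchwartzMap Plane ℂ) {h : Plane → ℂ} (hh : Integrable h) :
    Integrable (multConv m h) :=
  (fourier_schwartz m).integrable_convolution (ContinuousLinearMap.mul ℂ ℂ) hh

lemma fourierInv_multConv (m : SchwartzMap Plane ℂ) {h : Plane → ℂ} (hh : Integrable h)
    (ξ : Plane) : 𝓕⁻ (multConv m h) ξ = m ξ * 𝓕⁻ h ξ := by
  have h1 : 𝓕 (multConv m h) (-ξ) = 𝓕 (𝓕 (m : Plane → ℂ)) (-ξ) * 𝓕 h (-ξ) :=
    Real.fourier_mul_convolution_eq (fourier_schwartz m) hh (-ξ)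
  rw [Real.fourierInv_eq_fourier_neg, h1, ← Real.fourierInv_eq_fourier_neg,
    ← Real.fourierInv_eq_fourier_neg,
    m.integrable.fourierInv_fourier_eq (fourier_schwartz m) m.continuous.continuousAt]

/-- Moving a Fourier multiplier from one factor of a pairing to the other. -/
lemma integral_fourierInv_mul_multConv (m : SchwartzMap Plane ℂ) {a h : Plane → ℂ}
    (ha : Integrable a) (hh : Integrable h) :
    ∫ x, 𝓕⁻ a x * multConv m h x = ∫ x, a x * m x * 𝓕⁻ h x := by
  rw [integral_fourierInv_mul_eq_flip ha (integrable_multConv m hh)]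
  simp_rw [fourierInv_multConv m hh, mul_assoc]

lemma integral_fourier_schwartz (m : SchwartzMap Plane ℂ) :
    ∫ z, 𝓕 (m : Plane → ℂ) z = m 0 := by
  have := m.integrable.fourierInv_fourier_eq (fourier_schwartz m) (v := 0)
    m.continuous.continuousAt
  rw [← this, Real.fourierInv_eq]
  simp

/-- Dilating a multiplier dilates its kernel. -/
lemma fourier_comp_inv_smul (m : Plane → ℂ) {s : ℝ} (hs : 0 < s) (z : Plane) :
    𝓕 (fun ξ => m (s⁻¹ • ξ)) z = (s ^ 2 : ℝ) * 𝓕 m (s • z) := by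
  rw [Real.fourier_eq, Real.fourier_eq]
  have := Measure.integral_comp_inv_smul (μ := (volume : Measure Plane))
    (fun η : Plane => Real.fourierChar (-inner ℝ η (s • z)) • m η) s
  rw [finrank_plane, abs_of_pos (by positivity)] at this
  rw [← Complex.real_smul, ← this]
  refine integral_congr_ae (ae_of_all _ fun ξ => ?_)
  simp only [inner_smul_left, inner_smul_right]
  congr 3
  simp
  field_simp

/-! ### Hölder estimates for kernels with stretched exponential decay -/

/-- The norm of `L^q` with the growing weight `exp (ν ⟨x⟩ ^ δ)` multiplying the function. It is
dual to the norm of `L^p_μ` when `1 / p + 1 / q = 1` and `μ = p ν`. -/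
noncomputable def dualNorm {F : Type*} [NormedAddCommGroup F] (δ q ν : ℝ) (h : Plane → F) : ℝ≥0∞ :=
  (∫⁻ x, (‖h x‖ₑ * ENNReal.ofReal (weight δ (-ν) x)) ^ q) ^ (1 / q)

lemma measurable_weight (δ μ : ℝ) : Measurable (weight δ μ) := (continuous_weight δ μ).measurable

/-- Hölder's inequality with a shift: the growing weight is submultiplicative. -/
lemma lintegral_mul_shift_le {F : Type*} [NormedAddCommGroup F] [MeasurableSpace F]
    [OpensMeasurableSpace F] {δ p q μ : ℝ} (hδ : 0 < δ) (hδ1 : δ ≤ 1)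
    (hμ : 0 ≤ μ) (hpq : p.HolderConjugate q) {f : Plane → ℂ} (hf : Measurable f)
    {h : Plane → F} (hh : Measurable h) (z : Plane) {r : ℝ} (hr : ‖z‖ ≤ r) :
    ∫⁻ y, ‖f y‖ₑ * ‖h (y - z)‖ₑ ≤
      ENNReal.ofReal (Real.exp (μ / p * r ^ δ)) *
        (weightedLpNorm δ p μ f * dualNorm δ q (μ / p) h) := by
  have hp := hpq.pos
  have hν : 0 ≤ μ / p := by positivity
  set E := ENNReal.ofReal (Real.exp (μ / p * r ^ δ))
  have hw : ∀ ν : ℝ, Measurable fun x : Plane => ENNReal.ofReal (weight δ ν x) := fun ν =>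
    (measurable_weight δ ν).ennreal_ofReal
  have hpt : ∀ y, ‖f y‖ₑ * ‖h (y - z)‖ₑ ≤
      E * ((‖f y‖ₑ * ENNReal.ofReal (weight δ (μ / p) y)) *
        (‖h (y - z)‖ₑ * ENNReal.ofReal (weight δ (-(μ / p)) (y - z)))) := by
    intro y
    have h1 : (1 : ℝ) ≤ Real.exp (μ / p * r ^ δ) * weight δ (μ / p) y *
        weight δ (-(μ / p)) (y - z) := by
      have h2 := weight_neg_le hδ hδ1 hν (y - z) y (r := r) (by simpa using hr)
      have h3 : weight δ (μ / p) y * weight δ (-(μ / p)) y = 1 := by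
        rw [weight_mul]; simp [weight]
      nlinarith [weight_pos δ (μ / p) y]
    calc ‖f y‖ₑ * ‖h (y - z)‖ₑ = ‖f y‖ₑ * ‖h (y - z)‖ₑ * 1 := (mul_one _).symm
      _ ≤ ‖f y‖ₑ * ‖h (y - z)‖ₑ * ENNReal.ofReal (Real.exp (μ / p * r ^ δ) * weight δ (μ / p) y *
        weight δ (-(μ / p)) (y - z)) := by
          gcongr
          rw [← ENNReal.ofReal_one]
          exact ENNReal.ofReal_le_ofReal h1
      _ = _ := by
          rw [ENNReal.ofReal_mul (by have := weight_pos δ (μ / p) y; positivity),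
            ENNReal.ofReal_mul (Real.exp_nonneg _)]
          ring
  refine (lintegral_mono hpt).trans ?_
  have hm1 : Measurable fun y => ‖f y‖ₑ * ENNReal.ofReal (weight δ (μ / p) y) :=
    hf.enorm.mul (hw _)
  have hm2 : Measurable fun y => ‖h y‖ₑ * ENNReal.ofReal (weight δ (-(μ / p)) y) :=
    hh.enorm.mul (hw _)
  have hm3 : Measurable fun y =>
      ‖h (y - z)‖ₑ * ENNReal.ofReal (weight δ (-(μ / p)) (y - z)) :=
    hm2.comp (measurable_sub_const z)
  have hm4 : Measurable fun y => (‖f y‖ₑ * ENNReal.ofReal (weight δ (μ / p) y)) *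
      (‖h (y - z)‖ₑ * ENNReal.ofReal (weight δ (-(μ / p)) (y - z))) := hm1.mul hm3
  rw [lintegral_const_mul _ hm4]
  gcongr
  refine (ENNReal.lintegral_mul_le_Lp_mul_Lq volume hpq hm1.aemeasurable
    hm3.aemeasurable).trans (le_of_eq ?_)
  congr 1
  · rw [weightedLpNorm]
    congr 2
    ext y
    rw [ENNReal.mul_rpow_of_nonneg _ _ hp.le,
      ENNReal.ofReal_rpow_of_nonneg (weight_pos _ _ _).le hp.le, weight_rpow,
      mul_div_cancel₀ _ hp.ne']
  · rw [dualNorm, lintegral_sub_right_eq_self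
      (fun y => (‖h y‖ₑ * ENNReal.ofReal (weight δ (-(μ / p)) y)) ^ q) z]

lemma multConv_estimate {δ p q μ : ℝ} (hδ : 0 < δ) (hδ1 : δ ≤ 1) (hμ : 0 ≤ μ)
    (hpq : p.HolderConjugate q) {m f h : Plane → ℂ} (hk : Measurable (𝓕 m)) (hf : Measurable f)
    (hh : Measurable h) :
    ∫⁻ y, ‖f y‖ₑ * ‖multConv m h y‖ₑ ≤
      (∫⁻ z, ‖𝓕 m z‖ₑ * ENNReal.ofReal (Real.exp (μ / p * ‖z‖ ^ δ))) *
        (weightedLpNorm δ p μ f * dualNorm δ q (μ / p) h) := by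
  have hE : Measurable fun z : Plane => ENNReal.ofReal (Real.exp (μ / p * ‖z‖ ^ δ)) := by
    refine Measurable.ennreal_ofReal (Real.measurable_exp.comp (measurable_const.mul ?_))
    exact measurable_norm.pow_const δ
  calc ∫⁻ y, ‖f y‖ₑ * ‖multConv m h y‖ₑ
      ≤ ∫⁻ y, ∫⁻ z, ‖𝓕 m z‖ₑ * (‖f y‖ₑ * ‖h (y - z)‖ₑ) := by
        refine lintegral_mono fun y => ?_
        have : ∀ z, ‖𝓕 m z‖ₑ * (‖f y‖ₑ * ‖h (y - z)‖ₑ) = ‖f y‖ₑ * (‖𝓕 m z * h (y - z)‖ₑ) := by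
          intro z; rw [enorm_mul]; ring
        simp_rw [this]
        have hm1 : Measurable fun z => ‖𝓕 m z * h (y - z)‖ₑ :=
          (hk.mul (hh.comp (measurable_const_sub y))).enorm
        rw [lintegral_const_mul _ hm1]
        gcongr
        exact enorm_integral_le_lintegral_enorm _
    _ = ∫⁻ z, ∫⁻ y, ‖𝓕 m z‖ₑ * (‖f y‖ₑ * ‖h (y - z)‖ₑ) := by
        refine lintegral_lintegral_swap (Measurable.aemeasurable ?_)
        exact (hk.comp measurable_snd).enorm.mul ((hf.comp measurable_fst).enorm.mul
          (hh.comp (measurable_fst.sub measurable_snd)).enorm)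
    _ ≤ ∫⁻ z, ‖𝓕 m z‖ₑ * (ENNReal.ofReal (Real.exp (μ / p * ‖z‖ ^ δ)) *
          (weightedLpNorm δ p μ f * dualNorm δ q (μ / p) h)) := by
        refine lintegral_mono fun z => ?_
        have hm1 : Measurable fun y => ‖f y‖ₑ * ‖h (y - z)‖ₑ :=
          hf.enorm.mul (hh.comp (measurable_sub_const z)).enorm
        rw [lintegral_const_mul _ hm1]
        gcongr
        exact lintegral_mul_shift_le hδ hδ1 hμ hpq hf hh z le_rfl
    _ = _ := by
        simp_rw [← mul_assoc]
        rw [lintegral_mul_const, lintegral_mul_const]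
        · exact hk.enorm.mul hE
        · exact (hk.enorm.mul hE).mul_const _

/-- If the kernel has zero mean, the convolution only sees increments, and these are controlled by
the gradient. -/
lemma multConv_estimate_fderiv {δ p q μ : ℝ} (hδ : 0 < δ) (hδ1 : δ ≤ 1) (hμ : 0 ≤ μ)
    (hpq : p.HolderConjugate q) (m : SchwartzMap Plane ℂ) (hm0 : m 0 = 0) {f : Plane → ℂ}
    (hf : Measurable f) {h : Plane → ℂ} (hh : ContDiff ℝ 1 h) (hs : HasCompactSupport h) :
    ∫⁻ y, ‖f y‖ₑ * ‖multConv m h y‖ₑ ≤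
      (∫⁻ z, ‖𝓕 (m : Plane → ℂ) z‖ₑ *
        ENNReal.ofReal (‖z‖ * Real.exp (μ / p * ‖z‖ ^ δ))) *
        (weightedLpNorm δ p μ f * dualNorm δ q (μ / p) (fderiv ℝ h)) := by
  have hp := hpq.pos
  have hki : Integrable (𝓕 (m : Plane → ℂ)) := fourier_schwartz m
  have hkc : Continuous (𝓕 (m : Plane → ℂ)) := by
    rw [← SchwartzMap.fourier_coe]; exact (𝓕 m).continuous
  have hD : Continuous (fderiv ℝ h) := hh.continuous_fderiv (by simp)
  have hDm : Measurable (fderiv ℝ h) := hD.measurable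
  have hE : Measurable fun z : Plane => ENNReal.ofReal (‖z‖ * Real.exp (μ / p * ‖z‖ ^ δ)) := by
    refine Measurable.ennreal_ofReal (measurable_norm.mul (Real.measurable_exp.comp
      (measurable_const.mul ?_)))
    exact measurable_norm.pow_const δ
  set N := weightedLpNorm δ p μ f * dualNorm δ q (μ / p) (fderiv ℝ h) with hN
  have hrep : ∀ y, multConv m h y = ∫ z, 𝓕 (m : Plane → ℂ) z * (h (y - z) - h y) := by
    intro y
    have h1 : Integrable fun z => 𝓕 (m : Plane → ℂ) z * h (y - z) := by
      obtain ⟨C, hC⟩ := hh.continuous.bounded_above_of_compact_support hs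
      refine hki.mul_bdd (c := C) ?_ (ae_of_all _ fun z => hC _)
      exact (hh.continuous.comp (continuous_const.sub continuous_id)).aestronglyMeasurable
    simp_rw [mul_sub]
    rw [integral_sub h1 (hki.mul_const _), integral_mul_const, integral_fourier_schwartz, hm0,
      zero_mul, sub_zero, multConv]
  have hinc : ∀ y z, ‖h (y - z) - h y‖ₑ ≤
      ∫⁻ t in Set.Icc (0 : ℝ) 1, ENNReal.ofReal ‖z‖ * ‖fderiv ℝ h (y - t • z)‖ₑ := by
    intro y z
    have hder : ∀ t : ℝ, HasDerivAt (fun t : ℝ => h (y - t • z))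
        (-(fderiv ℝ h (y - t • z) z)) t := by
      intro t
      have h1 : HasDerivAt (fun t : ℝ => y - t • z) (-z) t := by
        simpa using ((hasDerivAt_id t).smul_const z).const_sub y
      have h2 := ((hh.differentiable (by simp)) (y - t • z)).hasFDerivAt.comp_hasDerivAt t h1
      rw [map_neg] at h2
      exact h2
    have hci : Continuous fun t : ℝ => -(fderiv ℝ h (y - t • z) z) := by fun_prop
    have h1 := intervalIntegral.integral_eq_sub_of_hasDerivAt (a := 0) (b := 1)
      (fun t _ => hder t) (hci.intervalIntegrable _ _)
    simp only [one_smul, zero_smul, sub_zero] at h1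
    rw [← h1, intervalIntegral.integral_of_le zero_le_one, ← integral_Icc_eq_integral_Ioc]
    refine (enorm_integral_le_lintegral_enorm _).trans (lintegral_mono fun t => ?_)
    rw [enorm_neg, ofReal_norm, mul_comm]
    exact ContinuousLinearMap.le_opENorm _ _
  calc ∫⁻ y, ‖f y‖ₑ * ‖multConv m h y‖ₑ
      ≤ ∫⁻ y, ∫⁻ z, ‖f y‖ₑ * (‖𝓕 (m : Plane → ℂ) z‖ₑ * ‖h (y - z) - h y‖ₑ) := by
        refine lintegral_mono fun y => ?_
        have hm1 : Measurable fun z => ‖𝓕 (m : Plane → ℂ) z‖ₑ * ‖h (y - z) - h y‖ₑ :=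
          hkc.measurable.enorm.mul ((hh.continuous.measurable.comp
            (measurable_const_sub y)).sub_const _).enorm
        rw [lintegral_const_mul _ hm1]
        gcongr
        rw [hrep]
        refine (enorm_integral_le_lintegral_enorm _).trans (le_of_eq ?_)
        simp_rw [enorm_mul]
    _ ≤ ∫⁻ y, ∫⁻ z, ∫⁻ t in Set.Icc (0 : ℝ) 1, (‖𝓕 (m : Plane → ℂ) z‖ₑ * ENNReal.ofReal ‖z‖) *
          (‖f y‖ₑ * ‖fderiv ℝ h (y - t • z)‖ₑ) := by
        refine lintegral_mono fun y => lintegral_mono fun z => ?_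
        have hmt : Measurable fun t : ℝ => ‖fderiv ℝ h (y - t • z)‖ₑ := by fun_prop
        rw [lintegral_const_mul _ (hmt.const_mul _), lintegral_const_mul _ hmt]
        have := hinc y z
        rw [lintegral_const_mul _ hmt] at this
        calc _ ≤ ‖f y‖ₑ * (‖𝓕 (m : Plane → ℂ) z‖ₑ * (ENNReal.ofReal ‖z‖ *
              ∫⁻ t in Set.Icc (0 : ℝ) 1, ‖fderiv ℝ h (y - t • z)‖ₑ)) := by gcongr
          _ = _ := by ring
    _ = ∫⁻ z, ∫⁻ t in Set.Icc (0 : ℝ) 1, ∫⁻ y, (‖𝓕 (m : Plane → ℂ) z‖ₑ * ENNReal.ofReal ‖z‖) *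
          (‖f y‖ₑ * ‖fderiv ℝ h (y - t • z)‖ₑ) := by
        rw [lintegral_lintegral_swap]
        · refine lintegral_congr fun z => ?_
          rw [lintegral_lintegral_swap]
          refine Measurable.aemeasurable ?_
          refine Measurable.const_mul ?_ _
          refine (hf.comp measurable_fst).enorm.mul (hDm.comp ?_).enorm
          fun_prop
        · refine Measurable.aemeasurable ?_
          refine Measurable.lintegral_prod_right' (f := fun w : (Plane × Plane) × ℝ =>
            (‖𝓕 (m : Plane → ℂ) w.1.2‖ₑ * ENNReal.ofReal ‖w.1.2‖) *
              (‖f w.1.1‖ₑ * ‖fderiv ℝ h (w.1.1 - w.2 • w.1.2)‖ₑ)) ?_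
          have hkm := hkc.measurable
          have h1 : Measurable fun w : (Plane × Plane) × ℝ => w.1.1 - w.2 • w.1.2 :=
            Continuous.measurable (by fun_prop)
          exact ((hkm.comp (measurable_snd.comp measurable_fst)).enorm.mul
              (measurable_norm.comp (measurable_snd.comp measurable_fst)).ennreal_ofReal).mul
            ((hf.comp (measurable_fst.comp measurable_fst)).enorm.mul (hDm.comp h1).enorm)
    _ ≤ ∫⁻ z, ∫⁻ t in Set.Icc (0 : ℝ) 1, (‖𝓕 (m : Plane → ℂ) z‖ₑ *
          ENNReal.ofReal (‖z‖ * Real.exp (μ / p * ‖z‖ ^ δ))) * N := by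
        refine lintegral_mono fun z => setLIntegral_mono' measurableSet_Icc fun t ht => ?_
        have hm1 : Measurable fun y => ‖f y‖ₑ * ‖fderiv ℝ h (y - t • z)‖ₑ :=
          hf.enorm.mul (hDm.comp (measurable_sub_const _)).enorm
        rw [lintegral_const_mul _ hm1,
          ENNReal.ofReal_mul (norm_nonneg _), mul_assoc, mul_assoc, mul_assoc]
        gcongr
        refine lintegral_mul_shift_le hδ hδ1 hμ hpq hf hDm (t • z) ?_
        rw [norm_smul, Real.norm_of_nonneg ht.1]
        exact mul_le_of_le_one_left (norm_nonneg _) ht.2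
    _ = _ := by
        simp only [lintegral_const, MeasurableSet.univ, Measure.restrict_apply, Set.univ_inter,
          Real.volume_Icc, sub_zero, ENNReal.ofReal_one, mul_one]
        rw [lintegral_mul_const]
        exact hkc.measurable.enorm.mul hE

/-! ### Duality between Besov spaces of negative and positive regularity -/

lemma exists_schwartz_comp_smul {m : Plane → ℝ} (hm : ContDiff ℝ ∞ m) (hs : HasCompactSupport m)
    {s : ℝ} (hs0 : s ≠ 0) :
    ∃ S : SchwartzMap Plane ℂ, (S : Plane → ℂ) = fun ξ => (m (s⁻¹ • ξ) : ℂ) := by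
  have h1 : HasCompactSupport fun ξ : Plane => (m (s⁻¹ • ξ) : ℂ) :=
    (hs.comp_smul (inv_ne_zero hs0)).comp_left (g := fun r : ℝ => (r : ℂ)) Complex.ofReal_zero
  exact ⟨h1.toSchwartzMap
    (Complex.ofRealCLM.contDiff.comp (hm.comp (contDiff_const_smul s⁻¹))), rfl⟩

lemma dilated_kernel_le {θ δ : ℝ} (hθ : 1 ≤ θ) (hδ : 0 < δ) (hδ1 : δ ≤ 1) (hδθ : δ < 1 / θ)
    {m : Plane → ℝ} (hm : IsGevrey θ m) (hs : HasCompactSupport m) {ν : ℝ} (hν : 0 ≤ ν) {s : ℝ}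
    (hs0 : 1 / 2 ≤ s) (A : ℝ≥0∞)
    (hA : A = ENNReal.ofReal (∫ x : Plane,
      ‖𝓕 (fun ξ => (m ξ : ℂ)) x‖ * ((1 + ‖x‖) * Real.exp (2 * ν * ‖x‖ ^ δ)))) :
    (∫⁻ z, ‖𝓕 (fun ξ : Plane => (m (s⁻¹ • ξ) : ℂ)) z‖ₑ *
        ENNReal.ofReal (Real.exp (ν * ‖z‖ ^ δ))) ≤ A ∧
    (∫⁻ z, ‖𝓕 (fun ξ : Plane => (m (s⁻¹ • ξ) : ℂ)) z‖ₑ *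
        ENNReal.ofReal (‖z‖ * Real.exp (ν * ‖z‖ ^ δ))) ≤ ENNReal.ofReal s⁻¹ * A := by
  have hspos : 0 < s := by linarith
  set G : Plane → ℝ := fun x =>
    ‖𝓕 (fun ξ => (m ξ : ℂ)) x‖ * ((1 + ‖x‖) * Real.exp (2 * ν * ‖x‖ ^ δ)) with hG
  have hGi : Integrable G := integrable_fourier_mul_exp hθ hδ hδθ hm hs (2 * ν)
  have hG0 : ∀ x, 0 ≤ G x := fun x => by positivity
  have hA' : A = ∫⁻ z : Plane, ENNReal.ofReal (s ^ 2 * G (s • z)) := by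
    rw [hA, ← ofReal_integral_eq_lintegral_ofReal]
    · rw [integral_const_mul, Measure.integral_comp_smul, finrank_plane, smul_eq_mul,
        abs_of_pos (by positivity), ← mul_assoc, mul_inv_cancel₀ (by positivity), one_mul]
    · exact (hGi.comp_smul hspos.ne').const_mul _
    · exact ae_of_all _ fun z => mul_nonneg (by positivity) (hG0 _)
  have hnorm : ∀ z, ‖𝓕 (fun ξ : Plane => (m (s⁻¹ • ξ) : ℂ)) z‖ₑ =
      ENNReal.ofReal (s ^ 2 * ‖𝓕 (fun ξ => (m ξ : ℂ)) (s • z)‖) := by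
    intro z
    rw [fourier_comp_inv_smul (fun ξ => (m ξ : ℂ)) hspos z, ← ofReal_norm, norm_mul,
      Complex.norm_real, Real.norm_of_nonneg (by positivity)]
  have hexp : ∀ z : Plane, Real.exp (ν * ‖z‖ ^ δ) ≤ Real.exp (2 * ν * ‖s • z‖ ^ δ) := by
    intro z
    refine Real.exp_le_exp.2 ?_
    have h1 : ‖z‖ ≤ 2 * ‖s • z‖ := by
      rw [norm_smul, Real.norm_of_nonneg hspos.le]
      nlinarith [norm_nonneg z]
    have h2 := Real.rpow_le_rpow (norm_nonneg z) h1 hδ.le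
    rw [Real.mul_rpow (by norm_num) (norm_nonneg _)] at h2
    have h3 : (2 : ℝ) ^ δ ≤ 2 := by
      simpa using Real.rpow_le_rpow_of_exponent_le (one_le_two) hδ1
    have h4 : 0 ≤ ‖s • z‖ ^ δ := by positivity
    have h5 : ‖z‖ ^ δ ≤ 2 * ‖s • z‖ ^ δ := h2.trans (by gcongr)
    nlinarith
  constructor
  · rw [hA']
    refine lintegral_mono fun z => ?_
    rw [hnorm, ← ENNReal.ofReal_mul (by positivity)]
    refine ENNReal.ofReal_le_ofReal ?_
    rw [hG, mul_assoc]
    dsimp only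
    have := hexp z
    gcongr
    refine this.trans (le_mul_of_one_le_left (Real.exp_nonneg _) ?_)
    linarith [norm_nonneg (s • z)]
  · rw [hA', ← lintegral_const_mul' _ _ ENNReal.ofReal_ne_top]
    refine lintegral_mono fun z => ?_
    rw [hnorm, ← ENNReal.ofReal_mul (by positivity), ← ENNReal.ofReal_mul (by positivity)]
    refine ENNReal.ofReal_le_ofReal ?_
    have h1 : ‖z‖ = s⁻¹ * ‖s • z‖ := by
      rw [norm_smul, Real.norm_of_nonneg hspos.le]; field_simp
    rw [hG]
    dsimp only
    have := hexp z
    calc s ^ 2 * ‖𝓕 (fun ξ => (m ξ : ℂ)) (s • z)‖ * (‖z‖ * Real.exp (ν * ‖z‖ ^ δ))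
        ≤ s ^ 2 * ‖𝓕 (fun ξ => (m ξ : ℂ)) (s • z)‖ *
          ((s⁻¹ * (1 + ‖s • z‖)) * Real.exp (2 * ν * ‖s • z‖ ^ δ)) := by
          gcongr
          rw [h1]
          gcongr
          linarith
      _ = _ := by ring

/-- Pairing a block with a function through a dilated Gevrey multiplier; the second bound, for a
multiplier vanishing at the origin, gains the inverse of the frequency scale `s`. -/
lemma exists_pairing_bound {θ δ : ℝ} (hθ : 1 ≤ θ) (hδ : 0 < δ) (hδ1 : δ ≤ 1) (hδθ : δ < 1 / θ)
    {m : Plane → ℝ} (hm : IsGevrey θ m) (hs : HasCompactSupport m) {p q μ : ℝ} (hμ : 0 ≤ μ)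
    (hpq : p.HolderConjugate q) :
    ∃ A : ℝ≥0, ∀ (s : ℝ), 1 / 2 ≤ s → ∀ a : Plane → ℂ, Integrable a → ∀ h : Plane → ℂ,
      HasCompactSupport h →
      (Continuous h → ‖∫ ξ, a ξ * m (s⁻¹ • ξ) * 𝓕⁻ h ξ‖ₑ ≤
        A * (weightedLpNorm δ p μ (𝓕⁻ a) * dualNorm δ q (μ / p) h)) ∧
      (m 0 = 0 → ContDiff ℝ 1 h → ‖∫ ξ, a ξ * m (s⁻¹ • ξ) * 𝓕⁻ h ξ‖ₑ ≤
        ENNReal.ofReal s⁻¹ * A *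
          (weightedLpNorm δ p μ (𝓕⁻ a) * dualNorm δ q (μ / p) (fderiv ℝ h))) := by
  have hν : 0 ≤ μ / p := div_nonneg hμ hpq.pos.le
  refine ⟨Real.toNNReal (∫ x : Plane, ‖𝓕 (fun ξ => (m ξ : ℂ)) x‖ *
    ((1 + ‖x‖) * Real.exp (2 * (μ / p) * ‖x‖ ^ δ))), fun s hs0 a ha h hh => ?_⟩
  obtain ⟨K1, K2⟩ := dilated_kernel_le hθ hδ hδ1 hδθ hm hs hν hs0 _ rfl
  obtain ⟨S, hS⟩ := exists_schwartz_comp_smul hm.1 hs (s := s) (by linarith)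
  have hf : Measurable (𝓕⁻ a) := (continuous_fourierInv ha).measurable
  have hSk : Measurable (𝓕 (S : Plane → ℂ)) := by
    rw [← SchwartzMap.fourier_coe]; exact (𝓕 S).continuous.measurable
  have hflip : Integrable h → ‖∫ ξ, a ξ * m (s⁻¹ • ξ) * 𝓕⁻ h ξ‖ₑ ≤
      ∫⁻ y, ‖𝓕⁻ a y‖ₑ * ‖multConv S h y‖ₑ := by
    intro hi
    have := integral_fourierInv_mul_multConv S ha hi
    simp only [hS] at this ⊢
    rw [← this]
    refine (enorm_integral_le_lintegral_enorm _).trans (le_of_eq ?_)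
    simp_rw [enorm_mul]
  rw [← hS] at K1 K2
  refine ⟨fun hc => ?_, fun hm0 hc => ?_⟩
  · refine (hflip (hc.integrable_of_hasCompactSupport hh)).trans ?_
    refine (multConv_estimate hδ hδ1 hμ hpq hSk hf hc.measurable).trans ?_
    gcongr
    exact K1
  · refine (hflip (hc.continuous.integrable_of_hasCompactSupport hh)).trans ?_
    refine (multConv_estimate_fderiv hδ hδ1 hμ hpq S (by simp [hS, hm0]) hf hc hh).trans ?_
    gcongr
    exact K2

namespace IsLittlewoodPaleyPair

variable {θ₀ : ℝ} {χ₀ χ₁ : Plane → ℝ}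

lemma hasCompactSupport_zero (h : IsLittlewoodPaleyPair θ₀ χ₀ χ₁) : HasCompactSupport χ₀ := by
  refine HasCompactSupport.of_support_subset_isCompact (isCompact_closedBall (0 : Plane) (4 / 3))
    fun x hx => ?_
  simpa using h.supp_zero (subset_tsupport _ hx)

lemma hasCompactSupport_one (h : IsLittlewoodPaleyPair θ₀ χ₀ χ₁) : HasCompactSupport χ₁ := by
  refine HasCompactSupport.of_support_subset_isCompact (isCompact_closedBall (0 : Plane) (8 / 3))
    fun x hx => ?_
  simpa using (h.supp_one (subset_tsupport _ hx)).2

lemma zero_eq_zero (h : IsLittlewoodPaleyPair θ₀ χ₀ χ₁) {ξ : Plane} (hξ : 4 / 3 < ‖ξ‖) :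
    χ₀ ξ = 0 := by
  by_contra h0
  exact absurd (h.supp_zero (subset_tsupport _ h0)) (not_le.2 hξ)

lemma one_eq_zero (h : IsLittlewoodPaleyPair θ₀ χ₀ χ₁) {ξ : Plane}
    (hξ : ‖ξ‖ < 3 / 4 ∨ 8 / 3 < ‖ξ‖) : χ₁ ξ = 0 := by
  by_contra h0
  have := h.supp_one (subset_tsupport _ h0)
  rcases hξ with h1 | h1
  · exact absurd this.1 (not_le.2 h1)
  · exact absurd this.2 (not_le.2 h1)

lemma norm_two_zpow_smul_le {j i : ℕ} (hj : i ≤ j) (ξ : Plane) :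
    ‖(2 : ℝ) ^ (1 - (j : ℤ)) • ξ‖ ≤ (2 : ℝ) ^ (1 - (i : ℤ)) * ‖ξ‖ := by
  rw [norm_smul, norm_zpow, Real.norm_of_nonneg zero_le_two]
  gcongr
  · norm_num

/-- On the support of `χ₀` only `χ₀` and `χ₁` contribute to the partition of unity. -/
lemma zero_mul_eq (h : IsLittlewoodPaleyPair θ₀ χ₀ χ₁) (ξ : Plane) :
    χ₀ ξ * (χ₀ ξ + χ₁ ξ) = χ₀ ξ := by
  by_cases h0 : χ₀ ξ = 0
  · simp [h0]
  have hξ : ‖ξ‖ ≤ 4 / 3 := h.supp_zero (subset_tsupport _ h0)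
  have h1 : HasSum (fun j : ℕ => lpMultiplier χ₀ χ₁ j ξ)
      (∑ j ∈ Finset.range 2, lpMultiplier χ₀ χ₁ j ξ) := by
    refine hasSum_sum_of_ne_finset_zero fun j hj => ?_
    have hj2 : 2 ≤ j := by
      rw [Finset.mem_range] at hj; omega
    rw [lpMultiplier, if_neg (by omega)]
    refine h.one_eq_zero (Or.inl ((norm_two_zpow_smul_le hj2 ξ).trans_lt ?_))
    norm_num
    linarith
  have h2 := h1.unique (h.sum_eq_one ξ)
  simp [Finset.sum_range_succ, lpMultiplier] at h2
  rw [h2, mul_one]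

/-- On the support of `χ₁` only three neighbouring multipliers contribute to the partition of
unity. -/
lemma one_mul_eq (h : IsLittlewoodPaleyPair θ₀ χ₀ χ₁) (ξ : Plane) :
    χ₁ ξ * (χ₁ ((2 : ℝ) • ξ) + χ₁ ξ + χ₁ ((2 : ℝ)⁻¹ • ξ)) = χ₁ ξ := by
  by_cases h0 : χ₁ ξ = 0
  · simp [h0]
  have hξ := h.supp_one (subset_tsupport _ h0)
  have h1 : HasSum (fun j : ℕ => lpMultiplier χ₀ χ₁ j ((2 : ℝ) • ξ))
      (∑ j ∈ Finset.range 4, lpMultiplier χ₀ χ₁ j ((2 : ℝ) • ξ)) := by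
    refine hasSum_sum_of_ne_finset_zero fun j hj => ?_
    have hj2 : 4 ≤ j := by simpa using hj
    rw [lpMultiplier, if_neg (by omega)]
    refine h.one_eq_zero (Or.inl ((norm_two_zpow_smul_le hj2 _).trans_lt ?_))
    rw [norm_smul]
    norm_num
    linarith [hξ.2]
  have h2 := h1.unique (h.sum_eq_one _)
  have h3 : χ₀ ((2 : ℝ) • ξ) = 0 := h.zero_eq_zero (by
    rw [norm_smul]; norm_num; linarith [hξ.1])
  have e2 : (2 : ℝ) ^ (1 - 2 : ℤ) • (2 : ℝ) • ξ = ξ := by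
    rw [smul_smul]; norm_num
  have e3 : (2 : ℝ) ^ (1 - 3 : ℤ) • (2 : ℝ) • ξ = (2 : ℝ)⁻¹ • ξ := by
    rw [smul_smul]; norm_num
  simp only [Finset.sum_range_succ, Finset.range_zero, Finset.sum_empty, lpMultiplier, h3] at h2
  norm_num at h2
  rw [smul_smul, smul_smul] at h2
  norm_num at h2
  norm_num
  rw [h2, mul_one]

lemma lpMultiplier_nonneg (h : IsLittlewoodPaleyPair θ₀ χ₀ χ₁) (j : ℕ) (ξ : Plane) :
    0 ≤ lpMultiplier χ₀ χ₁ j ξ := by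
  unfold lpMultiplier
  split_ifs
  exacts [(h.range_zero _).1, (h.range_one _).1]

lemma continuous_lpMultiplier (h : IsLittlewoodPaleyPair θ₀ χ₀ χ₁) (j : ℕ) :
    Continuous (lpMultiplier χ₀ χ₁ j) := by
  have h0 := h.gevrey_zero.1.continuous
  have h1 := h.gevrey_one.1.continuous
  by_cases hj : j = 0
  · have : lpMultiplier χ₀ χ₁ j = χ₀ := by
      ext ξ; simp [lpMultiplier, hj]
    rw [this]; exact h0
  · have : lpMultiplier χ₀ χ₁ j = fun ξ => χ₁ ((2 : ℝ) ^ (1 - (j : ℤ)) • ξ) := by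
      ext ξ; simp [lpMultiplier, hj]
    rw [this]; fun_prop

lemma lpMultiplier_le_one (h : IsLittlewoodPaleyPair θ₀ χ₀ χ₁) (j : ℕ) (ξ : Plane) :
    lpMultiplier χ₀ χ₁ j ξ ≤ 1 := by
  unfold lpMultiplier
  split_ifs
  exacts [(h.range_zero _).2, (h.range_one _).2]

end IsLittlewoodPaleyPair

lemma exists_schwartz_testFun (φ : TestFun) :
    ∃ S : SchwartzMap Plane ℂ, (S : Plane → ℂ) = fun x => ((φ x : ℝ) : ℂ) :=
  ⟨(φ.hasCompactSupport.comp_left (g := fun r : ℝ => (r : ℂ)) Complex.ofReal_zero).toSchwartzMap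
    (Complex.ofRealCLM.contDiff.comp φ.contDiff), rfl⟩

section Blocks

variable {θ₀ : ℝ} {χ₀ χ₁ : Plane → ℝ}

lemma integrable_lpMultiplier_mul (hχ : IsLittlewoodPaleyPair θ₀ χ₀ χ₁) (j : ℕ) {a : Plane → ℂ}
    (ha : Integrable a) : Integrable fun ξ => (lpMultiplier χ₀ χ₁ j ξ : ℂ) * a ξ := by
  refine ha.bdd_mul (c := 1)
    (Complex.continuous_ofReal.comp (hχ.continuous_lpMultiplier j)).aestronglyMeasurable
    (ae_of_all _ fun ξ => ?_)
  rw [Complex.norm_real, Real.norm_of_nonneg (hχ.lpMultiplier_nonneg j ξ)]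
  exact hχ.lpMultiplier_le_one j ξ

lemma integrable_fourier_testFun (φ : TestFun) :
    Integrable (𝓕 (fun x : Plane => ((φ x : ℝ) : ℂ))) := by
  obtain ⟨S, hS⟩ := exists_schwartz_testFun φ
  rw [← hS]; exact fourier_schwartz S

lemma norm_fourierInv_le (h : Plane → ℂ) (ξ : Plane) : ‖𝓕⁻ h ξ‖ ≤ ∫ x, ‖h x‖ := by
  rw [Real.fourierInv_eq]
  refine (norm_integral_le_integral_norm _).trans (le_of_eq ?_)
  simp

/-- The pairing of a test function with an integrable function is the sum of the pairings of its
Littlewood-Paley blocks. -/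
lemma hasSum_integral_lpBlock (hχ : IsLittlewoodPaleyPair θ₀ χ₀ χ₁) (φ : TestFun) {h : Plane → ℂ}
    (hh : Integrable h) :
    HasSum (fun j => ∫ x, lpBlock χ₀ χ₁ j φ x * h x) (∫ x, ((φ x : ℝ) : ℂ) * h x) := by
  obtain ⟨S, hS⟩ := exists_schwartz_testFun φ
  set a : Plane → ℂ := 𝓕 (fun x : Plane => ((φ x : ℝ) : ℂ)) with ha
  have hai : Integrable a := integrable_fourier_testFun φ
  have h1 : ∀ j, ∫ x, lpBlock χ₀ χ₁ j φ x * h x =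
      ∫ ξ, (lpMultiplier χ₀ χ₁ j ξ : ℂ) * a ξ * 𝓕⁻ h ξ := fun j =>
    integral_fourierInv_mul_eq_flip (integrable_lpMultiplier_mul hχ j hai) hh
  have h2 : ∫ x, ((φ x : ℝ) : ℂ) * h x = ∫ ξ, a ξ * 𝓕⁻ h ξ := by
    rw [← integral_fourierInv_mul_eq_flip hai hh, ha, ← hS]
    rw [S.continuous.fourierInv_fourier_eq S.integrable (fourier_schwartz S), hS]
  simp_rw [h1]
  rw [h2]
  have hcF : Continuous (𝓕⁻ h) := continuous_fourierInv hh
  have hmul : Integrable fun ξ => a ξ * 𝓕⁻ h ξ :=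
    hai.mul_bdd (c := ∫ x, ‖h x‖) hcF.aestronglyMeasurable
      (ae_of_all _ fun ξ => norm_fourierInv_le h ξ)
  refine hasSum_integral_of_dominated_convergence
    (fun j ξ => lpMultiplier χ₀ χ₁ j ξ * ‖a ξ * 𝓕⁻ h ξ‖) (fun j => ?_) (fun j => ?_) ?_ ?_ ?_
  · exact (integrable_lpMultiplier_mul hχ j hai).aestronglyMeasurable.mul hcF.aestronglyMeasurable
  · refine ae_of_all _ fun ξ => le_of_eq ?_
    rw [mul_assoc, norm_mul, Complex.norm_real, Real.norm_of_nonneg (hχ.lpMultiplier_nonneg j ξ)]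
  · exact ae_of_all _ fun ξ => (hχ.sum_eq_one ξ).summable.mul_right _
  · refine hmul.norm.congr (ae_of_all _ fun ξ => ?_)
    dsimp only
    rw [((hχ.sum_eq_one ξ).mul_right _).tsum_eq, one_mul]
  · refine ae_of_all _ fun ξ => ?_
    have h3 : HasSum (fun j => (lpMultiplier χ₀ χ₁ j ξ : ℂ)) ((1 : ℝ) : ℂ) := by
      exact_mod_cast (hχ.sum_eq_one ξ)
    simpa [mul_assoc] using h3.mul_right (a ξ * 𝓕⁻ h ξ)

lemma lpMultiplier_eq_mul_three (hχ : IsLittlewoodPaleyPair θ₀ χ₀ χ₁) {j : ℕ} (hj : 1 ≤ j)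
    (ξ : Plane) :
    lpMultiplier χ₀ χ₁ j ξ = lpMultiplier χ₀ χ₁ j ξ *
      (χ₁ (((2 : ℝ) ^ ((j : ℤ) - 2))⁻¹ • ξ) + χ₁ (((2 : ℝ) ^ ((j : ℤ) - 1))⁻¹ • ξ) +
        χ₁ (((2 : ℝ) ^ (j : ℤ))⁻¹ • ξ)) := by
  have h2 : (2 : ℝ) ≠ 0 := two_ne_zero
  have e1 : ((2 : ℝ) ^ ((j : ℤ) - 2))⁻¹ • ξ = (2 : ℝ) • (2 : ℝ) ^ (1 - (j : ℤ)) • ξ := by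
    rw [smul_smul, ← zpow_neg]
    congr 1
    rw [← zpow_one_add₀ h2]; congr 1; ring
  have e2 : ((2 : ℝ) ^ ((j : ℤ) - 1))⁻¹ • ξ = (2 : ℝ) ^ (1 - (j : ℤ)) • ξ := by
    rw [← zpow_neg]; congr 2; ring
  have e3 : ((2 : ℝ) ^ (j : ℤ))⁻¹ • ξ = (2 : ℝ)⁻¹ • (2 : ℝ) ^ (1 - (j : ℤ)) • ξ := by
    rw [smul_smul, ← zpow_neg]
    congr 1
    rw [← zpow_neg_one, ← zpow_add₀ h2]; congr 1; ring
  rw [e1, e2, e3, lpMultiplier, if_neg (by omega), hχ.one_mul_eq]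

/-- The pairing of a block with a function is bounded by the dual weighted Lebesgue norm. -/
lemma exists_lpBlock_bound (hθ : 1 ≤ θ₀) (hχ : IsLittlewoodPaleyPair θ₀ χ₀ χ₁) {δ p q μ : ℝ}
    (hδ : 0 < δ) (hδ1 : δ ≤ 1) (hδθ : δ < 1 / θ₀) (hμ : 0 ≤ μ) (hpq : p.HolderConjugate q) :
    ∃ A : ℝ≥0, ∀ (φ : TestFun) (j : ℕ) (h : Plane → ℂ), HasCompactSupport h →
      (Continuous h → ‖∫ x, lpBlock χ₀ χ₁ j φ x * h x‖ₑ ≤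
        A * (weightedLpNorm δ p μ (lpBlock χ₀ χ₁ j φ) * dualNorm δ q (μ / p) h)) ∧
      (1 ≤ j → ContDiff ℝ 1 h → ‖∫ x, lpBlock χ₀ χ₁ j φ x * h x‖ₑ ≤
        A * ENNReal.ofReal ((2 : ℝ) ^ (-(j : ℝ))) *
          (weightedLpNorm δ p μ (lpBlock χ₀ χ₁ j φ) * dualNorm δ q (μ / p) (fderiv ℝ h))) := by
  obtain ⟨A₀, hA₀⟩ := exists_pairing_bound hθ hδ hδ1 hδθ hχ.gevrey_zero hχ.hasCompactSupport_zero
    hμ hpq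
  obtain ⟨A₁, hA₁⟩ := exists_pairing_bound hθ hδ hδ1 hδθ hχ.gevrey_one hχ.hasCompactSupport_one
    hμ hpq
  refine ⟨A₀ + 7 * A₁, fun φ j h hh => ?_⟩
  set b : Plane → ℂ := fun ξ => (lpMultiplier χ₀ χ₁ j ξ : ℂ) *
    𝓕 (fun x : Plane => ((φ x : ℝ) : ℂ)) ξ with hb
  have hbi : Integrable b := integrable_lpMultiplier_mul hχ j (integrable_fourier_testFun φ)
  have hblock : lpBlock χ₀ χ₁ j φ = 𝓕⁻ b := rfl
  have hflip : Integrable h → ∫ x, lpBlock χ₀ χ₁ j φ x * h x = ∫ ξ, b ξ * 𝓕⁻ h ξ := fun hi =>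
    integral_fourierInv_mul_eq_flip hbi hi
  have hint : ∀ (m : Plane → ℝ), Continuous m → (∀ ξ, m ξ ∈ Set.Icc (0 : ℝ) 1) → ∀ s : ℝ,
      Integrable h → Integrable fun ξ => b ξ * m (s⁻¹ • ξ) * 𝓕⁻ h ξ := by
    intro m hm hm1 s hi
    have h1 : Integrable fun ξ => b ξ * m (s⁻¹ • ξ) := by
      refine hbi.mul_bdd (c := 1) (Continuous.aestronglyMeasurable (by fun_prop))
        (ae_of_all _ fun ξ => ?_)
      rw [Complex.norm_real, Real.norm_of_nonneg (hm1 _).1]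
      exact (hm1 _).2
    exact h1.mul_bdd (c := ∫ x, ‖h x‖) (continuous_fourierInv hi).aestronglyMeasurable
      (ae_of_all _ fun ξ => norm_fourierInv_le h ξ)
  have hint0 := hint χ₀ hχ.gevrey_zero.1.continuous hχ.range_zero
  have hint1 := hint χ₁ hχ.gevrey_one.1.continuous hχ.range_one
  have hsplit : 1 ≤ j → Integrable h → ‖∫ x, lpBlock χ₀ χ₁ j φ x * h x‖ₑ ≤
      ‖∫ ξ, b ξ * χ₁ (((2 : ℝ) ^ ((j : ℤ) - 2))⁻¹ • ξ) * 𝓕⁻ h ξ‖ₑ +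
      ‖∫ ξ, b ξ * χ₁ (((2 : ℝ) ^ ((j : ℤ) - 1))⁻¹ • ξ) * 𝓕⁻ h ξ‖ₑ +
      ‖∫ ξ, b ξ * χ₁ (((2 : ℝ) ^ (j : ℤ))⁻¹ • ξ) * 𝓕⁻ h ξ‖ₑ := by
    intro hj hi
    have : ∫ ξ, b ξ * 𝓕⁻ h ξ =
        (∫ ξ, b ξ * χ₁ (((2 : ℝ) ^ ((j : ℤ) - 2))⁻¹ • ξ) * 𝓕⁻ h ξ) +
        (∫ ξ, b ξ * χ₁ (((2 : ℝ) ^ ((j : ℤ) - 1))⁻¹ • ξ) * 𝓕⁻ h ξ) +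
        (∫ ξ, b ξ * χ₁ (((2 : ℝ) ^ (j : ℤ))⁻¹ • ξ) * 𝓕⁻ h ξ) := by
      have hI : Integrable fun ξ => b ξ * χ₁ (((2 : ℝ) ^ ((j : ℤ) - 2))⁻¹ • ξ) * 𝓕⁻ h ξ +
          b ξ * χ₁ (((2 : ℝ) ^ ((j : ℤ) - 1))⁻¹ • ξ) * 𝓕⁻ h ξ := (hint1 _ hi).add (hint1 _ hi)
      rw [← integral_add (hint1 _ hi) (hint1 _ hi), ← integral_add hI (hint1 _ hi)]
      refine integral_congr_ae (ae_of_all _ fun ξ => ?_)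
      dsimp only
      rw [hb]
      dsimp only
      have h3 := lpMultiplier_eq_mul_three hχ hj ξ
      have h4 : (lpMultiplier χ₀ χ₁ j ξ : ℂ) = lpMultiplier χ₀ χ₁ j ξ *
          (χ₁ (((2 : ℝ) ^ ((j : ℤ) - 2))⁻¹ • ξ) + χ₁ (((2 : ℝ) ^ ((j : ℤ) - 1))⁻¹ • ξ) +
            χ₁ (((2 : ℝ) ^ (j : ℤ))⁻¹ • ξ)) := by exact_mod_cast h3
      linear_combination (𝓕 (fun x : Plane => ((φ x : ℝ) : ℂ)) ξ * 𝓕⁻ h ξ) * h4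
    rw [hflip hi, this]
    refine (enorm_add_le _ _).trans ?_
    gcongr
    exact enorm_add_le _ _
  have hscale : 1 ≤ j → 1 / 2 ≤ (2 : ℝ) ^ ((j : ℤ) - 2) ∧ 1 / 2 ≤ (2 : ℝ) ^ ((j : ℤ) - 1) ∧
      1 / 2 ≤ (2 : ℝ) ^ (j : ℤ) := by
    intro hj
    have : (1 / 2 : ℝ) = 2 ^ (-1 : ℤ) := by norm_num
    rw [this]
    refine ⟨?_, ?_, ?_⟩ <;> exact zpow_le_zpow_right₀ one_le_two (by omega)
  rw [hblock]
  rw [hblock] at hflip hsplit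
  refine ⟨fun hc => ?_, fun hj hc => ?_⟩
  · have hi : Integrable h := hc.integrable_of_hasCompactSupport hh
    set N := weightedLpNorm δ p μ (𝓕⁻ b) * dualNorm δ q (μ / p) h with hN
    rcases Nat.eq_zero_or_pos j with hj | hj
    · have : ∫ ξ, b ξ * 𝓕⁻ h ξ =
          (∫ ξ, b ξ * χ₀ ((1 : ℝ)⁻¹ • ξ) * 𝓕⁻ h ξ) + (∫ ξ, b ξ * χ₁ ((1 : ℝ)⁻¹ • ξ) * 𝓕⁻ h ξ) := by
        rw [← integral_add (hint0 _ hi) (hint1 _ hi)]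
        refine integral_congr_ae (ae_of_all _ fun ξ => ?_)
        dsimp only
        rw [hb]
        dsimp only
        have h3 : lpMultiplier χ₀ χ₁ j ξ = χ₀ ξ := by simp [lpMultiplier, hj]
        have h4 : (χ₀ ξ : ℂ) * (χ₀ ξ + χ₁ ξ) = χ₀ ξ := by exact_mod_cast hχ.zero_mul_eq ξ
        rw [h3, inv_one, one_smul]
        linear_combination -(𝓕 (fun x : Plane => ((φ x : ℝ) : ℂ)) ξ * 𝓕⁻ h ξ) * h4
      rw [hflip hi, this]
      refine (enorm_add_le _ _).trans ?_
      refine (add_le_add ((hA₀ 1 (by norm_num) b hbi h hh).1 hc)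
        ((hA₁ 1 (by norm_num) b hbi h hh).1 hc)).trans ?_
      rw [← hN, ← add_mul]
      push_cast
      gcongr
      exact le_mul_of_one_le_left' (by norm_num)
    · obtain ⟨s1, s2, s3⟩ := hscale hj
      refine (hsplit hj hi).trans ?_
      refine (add_le_add (add_le_add ((hA₁ _ s1 b hbi h hh).1 hc) ((hA₁ _ s2 b hbi h hh).1 hc))
        ((hA₁ _ s3 b hbi h hh).1 hc)).trans ?_
      rw [← hN, ← add_mul, ← add_mul]
      push_cast
      gcongr ?_ * _
      calc (A₁ : ℝ≥0∞) + A₁ + A₁ = 3 * A₁ := by ring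
        _ ≤ 7 * A₁ := by gcongr; norm_num
        _ ≤ _ := le_add_self
  · obtain ⟨s1, s2, s3⟩ := hscale hj
    have hi : Integrable h := hc.continuous.integrable_of_hasCompactSupport hh
    have h0 : χ₁ 0 = 0 := hχ.one_eq_zero (Or.inl (by rw [norm_zero]; norm_num))
    set N := weightedLpNorm δ p μ (𝓕⁻ b) * dualNorm δ q (μ / p) (fderiv ℝ h) with hN
    refine (hsplit hj hi).trans ?_
    refine (add_le_add (add_le_add ((hA₁ _ s1 b hbi h hh).2 h0 hc) ((hA₁ _ s2 b hbi h hh).2 h0 hc))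
      ((hA₁ _ s3 b hbi h hh).2 h0 hc)).trans ?_
    rw [← hN, ← add_mul, ← add_mul, ← add_mul, ← add_mul, ← ENNReal.ofReal_add (by positivity)
      (by positivity), ← ENNReal.ofReal_add (by positivity) (by positivity)]
    gcongr ?_ * _
    have h7 : ((2 : ℝ) ^ ((j : ℤ) - 2))⁻¹ + ((2 : ℝ) ^ ((j : ℤ) - 1))⁻¹ + ((2 : ℝ) ^ (j : ℤ))⁻¹ =
        7 * 2 ^ (-(j : ℝ)) := by
      rw [Real.rpow_neg zero_le_two, Real.rpow_natCast, zpow_sub₀ two_ne_zero,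
        zpow_sub₀ two_ne_zero, zpow_natCast]
      field_simp
      norm_num
    rw [h7, ENNReal.ofReal_mul (by norm_num)]
    push_cast
    rw [show ENNReal.ofReal 7 = 7 by norm_num]
    calc 7 * ENNReal.ofReal (2 ^ (-(j : ℝ))) * (A₁ : ℝ≥0∞)
        = 7 * A₁ * ENNReal.ofReal (2 ^ (-(j : ℝ))) := by ring
      _ ≤ _ := by gcongr; exact le_add_self

end Blocks

lemma dualNorm_ofReal_comp (δ q ν : ℝ) (h : Plane → ℝ) :
    dualNorm δ q ν (fun x => (h x : ℂ)) = dualNorm δ q ν h := by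
  unfold dualNorm
  simp [← ofReal_norm]

lemma dualNorm_fderiv_ofReal_comp (δ q ν : ℝ) {h : Plane → ℝ} (hh : ContDiff ℝ 1 h) :
    dualNorm δ q ν (fderiv ℝ fun x => (h x : ℂ)) = dualNorm δ q ν (fderiv ℝ h) := by
  unfold dualNorm
  have : ∀ x, ‖fderiv ℝ (fun x => (h x : ℂ)) x‖ₑ = ‖fderiv ℝ h x‖ₑ := by
    intro x
    have h1 : fderiv ℝ (fun x => (h x : ℂ)) x = Complex.ofRealCLM.comp (fderiv ℝ h x) :=
      (Complex.ofRealCLM.hasFDerivAt.comp x ((hh.differentiable (by simp)) x).hasFDerivAt).fderiv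
    rw [h1, ← ofReal_norm, ← ofReal_norm]
    congr 1
    exact Complex.ofRealLI.norm_toContinuousLinearMap_comp
  simp [this]

/-- `X` bounds the norm of `h` in the predual space of positive regularity `2 ε`, expressed by
real interpolation: at each frequency scale `2 ^ j`, the function `h` splits into a part that is
small in the dual weighted Lebesgue space and a part with a controlled gradient. -/
structure InterpolationBound (δ q ν ε : ℝ) (h : Plane → ℝ) (X : ℝ≥0∞) : Prop where
  continuous : Continuous h
  hasCompactSupport : HasCompactSupport h
  base : dualNorm δ q ν h ≤ X
  split : ∀ j : ℕ, 1 ≤ j → ∃ g : Plane → ℝ, ContDiff ℝ 1 g ∧ HasCompactSupport g ∧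
    dualNorm δ q ν (h - g) ≤ ENNReal.ofReal ((2 : ℝ) ^ (-(2 * ε * j))) * X ∧
    dualNorm δ q ν (fderiv ℝ g) ≤ ENNReal.ofReal ((2 : ℝ) ^ ((1 - 2 * ε) * j)) * X

/-- Duality between the weighted Besov space of regularity `-ε` and functions of regularity
`2 ε`. -/
theorem exists_duality_bound {θ₀ : ℝ} {χ₀ χ₁ : Plane → ℝ} (hθ : 1 ≤ θ₀)
    (hχ : IsLittlewoodPaleyPair θ₀ χ₀ χ₁) {δ p q μ ε : ℝ} (hδ : 0 < δ) (hδ1 : δ ≤ 1)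
    (hδθ : δ < 1 / θ₀) (hμ : 0 ≤ μ) (hpq : p.HolderConjugate q) (hε : 0 < ε) :
    ∃ A : ℝ≥0, ∀ (h : Plane → ℝ) (X : ℝ≥0∞), InterpolationBound δ q (μ / p) ε h X →
      ∀ φ : TestFun, ‖∫ x, φ x * h x‖ₑ ≤ A * besovTestNorm χ₀ χ₁ δ (-ε) μ p p φ * X := by
  obtain ⟨A, hA⟩ := exists_lpBlock_bound hθ hχ hδ hδ1 hδθ hμ hpq
  have hp := hpq.pos
  have hgeo : Summable fun j : ℕ => (2 : ℝ) ^ (-(ε * j)) := by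
    have : ∀ j : ℕ, (2 : ℝ) ^ (-(ε * j)) = ((2 : ℝ) ^ (-ε)) ^ j := by
      intro j
      rw [← Real.rpow_natCast, ← Real.rpow_mul zero_le_two]; ring_nf
    simp_rw [this]
    refine summable_geometric_of_lt_one (by positivity) ?_
    exact Real.rpow_lt_one_of_one_lt_of_neg one_lt_two (by linarith)
  set S : ℝ := ∑' j : ℕ, (2 : ℝ) ^ (-(ε * j)) with hS
  refine ⟨2 * A * S.toNNReal, fun h X hX φ => ?_⟩
  obtain ⟨hc, hcs, hbase, hsplit⟩ := hX
  set hC : Plane → ℂ := fun x => (h x : ℂ) with hhC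
  have hCc : Continuous hC := Complex.continuous_ofReal.comp hc
  have hCs : HasCompactSupport hC := hcs.comp_left (g := fun r : ℝ => (r : ℂ)) Complex.ofReal_zero
  have hsum := hasSum_integral_lpBlock hχ φ (hCc.integrable_of_hasCompactSupport hCs)
  set B := besovTestNorm χ₀ χ₁ δ (-ε) μ p p φ with hB
  have hblock : ∀ j : ℕ, weightedLpNorm δ p μ (lpBlock χ₀ χ₁ j φ) ≤
      ENNReal.ofReal ((2 : ℝ) ^ (ε * j)) * B := by
    intro j
    have h1 : ENNReal.ofReal ((2 : ℝ) ^ (-ε * j)) * weightedLpNorm δ p μ (lpBlock χ₀ χ₁ j φ)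
        ≤ B := by
      rw [hB, besovTestNorm]
      refine le_trans (le_of_eq ?_) (ENNReal.rpow_le_rpow (ENNReal.le_tsum j) (by positivity))
      rw [← ENNReal.rpow_mul, mul_one_div_cancel hp.ne', ENNReal.rpow_one]
    calc weightedLpNorm δ p μ (lpBlock χ₀ χ₁ j φ)
        = ENNReal.ofReal ((2 : ℝ) ^ (ε * j)) * (ENNReal.ofReal ((2 : ℝ) ^ (-ε * j)) *
            weightedLpNorm δ p μ (lpBlock χ₀ χ₁ j φ)) := by
          rw [← mul_assoc, ← ENNReal.ofReal_mul (by positivity), ← Real.rpow_add two_pos]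
          simp
      _ ≤ _ := by gcongr
  have hterm : ∀ j : ℕ, ‖∫ x, lpBlock χ₀ χ₁ j φ x * hC x‖ₑ ≤
      2 * A * B * X * ENNReal.ofReal ((2 : ℝ) ^ (-(ε * j))) := by
    intro j
    set N := weightedLpNorm δ p μ (lpBlock χ₀ χ₁ j φ) with hN
    have key : ‖∫ x, lpBlock χ₀ χ₁ j φ x * hC x‖ₑ ≤
        2 * A * X * ENNReal.ofReal ((2 : ℝ) ^ (-(2 * ε * j))) * N := by
      rcases Nat.eq_zero_or_pos j with hj | hj
      · refine ((hA φ j hC hCs).1 hCc).trans ?_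
        rw [dualNorm_ofReal_comp, ← hN]
        simp only [hj, CharP.cast_eq_zero, mul_zero, neg_zero, Real.rpow_zero, ENNReal.ofReal_one,
          mul_one]
        calc (A : ℝ≥0∞) * (N * dualNorm δ q (μ / p) h) ≤ A * (N * X) := by gcongr
          _ = 1 * A * X * N := by ring
          _ ≤ _ := by gcongr; norm_num
      · obtain ⟨g, hg1, hgs, hgd, hgf⟩ := hsplit j hj
        set gC : Plane → ℂ := fun x => (g x : ℂ) with hgC
        have hgCc : Continuous gC := Complex.continuous_ofReal.comp hg1.continuous
        have hgCs : HasCompactSupport gC :=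
          hgs.comp_left (g := fun r : ℝ => (r : ℂ)) Complex.ofReal_zero
        have hd : Continuous fun x => ((h - g) x : ℂ) :=
          Complex.continuous_ofReal.comp (hc.sub hg1.continuous)
        have hds : HasCompactSupport fun x => ((h - g) x : ℂ) :=
          (hcs.sub hgs).comp_left (g := fun r : ℝ => (r : ℂ)) Complex.ofReal_zero
        have hbl : Continuous (lpBlock χ₀ χ₁ j φ) :=
          continuous_fourierInv (integrable_lpMultiplier_mul hχ j (integrable_fourier_testFun φ))
        have h1 : ∫ x, lpBlock χ₀ χ₁ j φ x * hC x =
            (∫ x, lpBlock χ₀ χ₁ j φ x * ((h - g) x : ℂ)) + ∫ x, lpBlock χ₀ χ₁ j φ x * gC x := by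
          have I1 : Integrable fun x => lpBlock χ₀ χ₁ j φ x * ((h - g) x : ℂ) :=
            (hbl.mul hd).integrable_of_hasCompactSupport hds.mul_left
          have I2 : Integrable fun x => lpBlock χ₀ χ₁ j φ x * gC x :=
            (hbl.mul hgCc).integrable_of_hasCompactSupport hgCs.mul_left
          rw [← integral_add I1 I2]
          refine integral_congr_ae (ae_of_all _ fun x => ?_)
          simp only [hhC, hgC, Pi.sub_apply, Complex.ofReal_sub]
          ring
        rw [h1]
        refine (enorm_add_le _ _).trans ((add_le_add ((hA φ j _ hds).1 hd)
          ((hA φ j gC hgCs).2 hj (Complex.ofRealCLM.contDiff.comp hg1))).trans ?_)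
        rw [dualNorm_ofReal_comp δ q (μ / p) (h - g), dualNorm_fderiv_ofReal_comp _ _ _ hg1, ← hN]
        have e1 : ENNReal.ofReal ((2 : ℝ) ^ (-(j : ℝ))) *
            ENNReal.ofReal ((2 : ℝ) ^ ((1 - 2 * ε) * j)) =
            ENNReal.ofReal ((2 : ℝ) ^ (-(2 * ε * j))) := by
          rw [← ENNReal.ofReal_mul (by positivity), ← Real.rpow_add two_pos]
          ring_nf
        calc (A : ℝ≥0∞) * (N * dualNorm δ q (μ / p) (h - g)) +
              A * ENNReal.ofReal ((2 : ℝ) ^ (-(j : ℝ))) * (N * dualNorm δ q (μ / p) (fderiv ℝ g))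
            ≤ (A : ℝ≥0∞) * (N * (ENNReal.ofReal ((2 : ℝ) ^ (-(2 * ε * j))) * X)) +
              A * ENNReal.ofReal ((2 : ℝ) ^ (-(j : ℝ))) *
                (N * (ENNReal.ofReal ((2 : ℝ) ^ ((1 - 2 * ε) * j)) * X)) := by gcongr
          _ = (A : ℝ≥0∞) * (N * (ENNReal.ofReal ((2 : ℝ) ^ (-(2 * ε * j))) * X)) +
              A * (N * X) * (ENNReal.ofReal ((2 : ℝ) ^ (-(j : ℝ))) *
                ENNReal.ofReal ((2 : ℝ) ^ ((1 - 2 * ε) * j))) := by ring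
          _ = _ := by rw [e1]; ring
    refine key.trans ?_
    calc 2 * A * X * ENNReal.ofReal ((2 : ℝ) ^ (-(2 * ε * j))) * N
        ≤ 2 * A * X * ENNReal.ofReal ((2 : ℝ) ^ (-(2 * ε * j))) *
          (ENNReal.ofReal ((2 : ℝ) ^ (ε * j)) * B) := by gcongr; exact hblock j
      _ = 2 * A * B * X * (ENNReal.ofReal ((2 : ℝ) ^ (-(2 * ε * j))) *
          ENNReal.ofReal ((2 : ℝ) ^ (ε * j))) := by ring
      _ = _ := by
        rw [← ENNReal.ofReal_mul (by positivity), ← Real.rpow_add two_pos]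
        ring_nf
  have hreal : ‖∫ x, φ x * h x‖ₑ = ‖∫ x, ((φ x : ℝ) : ℂ) * hC x‖ₑ := by
    have : ∫ x, ((φ x : ℝ) : ℂ) * hC x = ((∫ x, φ x * h x : ℝ) : ℂ) := by
      rw [← integral_complex_ofReal]
      simp [hhC]
    rw [this, ← ofReal_norm, ← ofReal_norm, Complex.norm_real]
  rw [hreal, ← hsum.tsum_eq]
  refine enorm_tsum_le_tsum_enorm.trans ((ENNReal.tsum_le_tsum hterm).trans ?_)
  rw [ENNReal.tsum_mul_left, ← ENNReal.ofReal_tsum_of_nonneg (fun j => by positivity) hgeo, ← hS]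
  push_cast
  rw [ENNReal.ofReal]
  exact le_of_eq (by ring)

/-! ### Mollification -/

/-- A bump function on the plane supported in the ball of radius `1 / (n + 1)`. -/
noncomputable def molBump (n : ℕ) : ContDiffBump (0 : Plane) where
  rIn := 1 / (2 * ((n : ℝ) + 1))
  rOut := 1 / ((n : ℝ) + 1)
  rIn_pos := by positivity
  rIn_lt_rOut := by
    apply one_div_lt_one_div_of_lt <;> nlinarith [show (0 : ℝ) ≤ n from n.cast_nonneg]

/-- The mollifier at scale `1 / (n + 1)`: smooth, nonnegative, even, of integral one. -/
noncomputable def mol (n : ℕ) (z : Plane) : ℝ := (molBump n).normed volume z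

lemma mol_nonneg (n : ℕ) (z : Plane) : 0 ≤ mol n z := (molBump n).nonneg_normed z

lemma contDiff_mol (n : ℕ) : ContDiff ℝ ∞ (mol n) := (molBump n).contDiff_normed (n := ⊤)

lemma continuous_mol (n : ℕ) : Continuous (mol n) := (contDiff_mol n).continuous

lemma hasCompactSupport_mol (n : ℕ) : HasCompactSupport (mol n) :=
  (molBump n).hasCompactSupport_normed

lemma integral_mol (n : ℕ) : ∫ z, mol n z = 1 := (molBump n).integral_normed

lemma integrable_mol (n : ℕ) : Integrable (mol n) := (molBump n).integrable_normed

lemma mol_neg (n : ℕ) (z : Plane) : mol n (-z) = mol n z := (molBump n).normed_neg z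

lemma mol_sub_comm (n : ℕ) (x y : Plane) : mol n (x - y) = mol n (y - x) := by
  rw [← mol_neg, neg_sub]

lemma mol_eq_zero {n : ℕ} {z : Plane} (hz : 1 / ((n : ℝ) + 1) ≤ ‖z‖) : mol n z = 0 := by
  have h := (molBump n).support_normed_eq (μ := volume)
  by_contra h0
  have : z ∈ Metric.ball (0 : Plane) (molBump n).rOut := by rw [← h]; exact h0
  rw [mem_ball_zero_iff] at this
  exact absurd this (not_lt.2 hz)

lemma one_div_succ_le_one (n : ℕ) : 1 / ((n : ℝ) + 1) ≤ 1 := by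
  rw [div_le_one (by positivity)]
  linarith [show (0 : ℝ) ≤ n from n.cast_nonneg]

lemma norm_lt_of_mol_ne_zero {n : ℕ} {z : Plane} (hz : mol n z ≠ 0) :
    ‖z‖ < 1 / ((n : ℝ) + 1) := by
  by_contra h
  exact hz (mol_eq_zero (not_lt.1 h))

section Mollify

variable {F : Type*} [NormedAddCommGroup F] [NormedSpace ℝ F]

/-- The mollification of `f` at scale `1 / (n + 1)`. -/
noncomputable def mollify (n : ℕ) (f : Plane → F) (x : Plane) : F := ∫ z, mol n z • f (x - z)

lemma mollify_eq_swap (n : ℕ) (f : Plane → F) (x : Plane) :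
    mollify n f x = ∫ z, mol n (x - z) • f z := by
  rw [mollify, ← integral_sub_left_eq_self (fun z => mol n z • f (x - z)) volume x]
  simp

lemma integrable_mol_smul {f : Plane → F} (hf : Continuous f) (n : ℕ) (x : Plane) :
    Integrable fun z => mol n z • f (x - z) := by
  have := continuous_mol n
  exact Continuous.integrable_of_hasCompactSupport (by fun_prop)
    (hasCompactSupport_mol n).smul_right

lemma norm_mollify_sub_le [CompleteSpace F] {f : Plane → F} (hf : Continuous f)
    (n : ℕ) (x : Plane) (v : F) {b : ℝ} (hb : ∀ z, ‖z‖ < 1 / ((n : ℝ) + 1) → ‖f (x - z) - v‖ ≤ b) :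
    ‖mollify n f x - v‖ ≤ b := by
  have hv : ∫ z, mol n z • v = v := by
    rw [integral_smul_const, integral_mol, one_smul]
  have h1 : mollify n f x - v = ∫ z, mol n z • (f (x - z) - v) := by
    simp_rw [smul_sub]
    rw [integral_sub (integrable_mol_smul hf n x) ((integrable_mol n).smul_const v), hv, mollify]
  have h2 : ∫ z, mol n z * b = b := by rw [integral_mul_const, integral_mol, one_mul]
  rw [h1, ← h2]
  refine norm_integral_le_of_norm_le ((integrable_mol n).mul_const b) (ae_of_all _ fun z => ?_)
  rw [norm_smul, Real.norm_of_nonneg (mol_nonneg n z)]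
  by_cases hz : mol n z = 0
  · simp [hz]
  · exact mul_le_mul_of_nonneg_left (hb z (norm_lt_of_mol_ne_zero hz)) (mol_nonneg n z)

lemma norm_mollify_le [CompleteSpace F] {f : Plane → F} (hf : Continuous f)
    (n : ℕ) (x : Plane) {b : ℝ} (hb : ∀ z, ‖z‖ < 1 / ((n : ℝ) + 1) → ‖f (x - z)‖ ≤ b) :
    ‖mollify n f x‖ ≤ b := by
  simpa using norm_mollify_sub_le hf n x 0 (b := b) (by simpa using hb)

lemma mollify_sub {f g : Plane → F} (hf : Continuous f) (hg : Continuous g) (n : ℕ) (x : Plane) :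
    mollify n (fun y => f y - g y) x = mollify n f x - mollify n g x := by
  simp_rw [mollify, smul_sub]
  exact integral_sub (integrable_mol_smul hf n x) (integrable_mol_smul hg n x)

lemma mollify_eq_zero {f : Plane → F} {n : ℕ} {x : Plane}
    (h : ∀ z, ‖z‖ < 1 / ((n : ℝ) + 1) → f (x - z) = 0) : mollify n f x = 0 := by
  rw [mollify]
  refine integral_eq_zero_of_ae (ae_of_all _ fun z => ?_)
  by_cases hz : mol n z = 0
  · simp [hz]
  · simp [h z (norm_lt_of_mol_ne_zero hz)]

lemma tsupport_mollify_subset (n : ℕ) (f : Plane → F) :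
    tsupport (mollify n f) ⊆ Metric.cthickening 1 (tsupport f) := by
  refine closure_minimal (fun x hx => ?_) Metric.isClosed_cthickening
  by_contra hxs
  refine hx (mollify_eq_zero fun z hz => ?_)
  by_contra h0
  have h1 : x - z ∈ tsupport f := subset_tsupport _ h0
  refine hxs (Metric.mem_cthickening_of_dist_le x (x - z) 1 _ h1 ?_)
  rw [dist_eq_norm]
  simpa using hz.le.trans (one_div_succ_le_one n)

lemma hasCompactSupport_mollify (n : ℕ) {f : Plane → F} (hf : HasCompactSupport f) :
    HasCompactSupport (mollify n f) :=
  HasCompactSupport.of_support_subset_isCompact (hf.isCompact.cthickening (r := 1))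
    ((subset_tsupport _).trans (tsupport_mollify_subset n f))

lemma contDiff_mollify [CompleteSpace F] (n : ℕ) {f : Plane → F} (hf : Continuous f) :
    ContDiff ℝ ∞ (mollify n f) :=
  (hasCompactSupport_mol n).contDiff_convolution_left (ContinuousLinearMap.lsmul ℝ ℝ)
    (n := ⊤) (contDiff_mol n) hf.locallyIntegrable

lemma fderiv_mollify [CompleteSpace F] (n : ℕ) {f : Plane → F} (hf : ContDiff ℝ 1 f)
    (x : Plane) : fderiv ℝ (mollify n f) x = mollify n (fderiv ℝ f) x := by
  have hD : Continuous (fderiv ℝ f) := hf.continuous_fderiv (by simp)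
  obtain ⟨C, hC⟩ := (isCompact_closedBall x 2).exists_bound_of_continuousOn hD.continuousOn
  refine HasFDerivAt.fderiv ?_
  refine hasFDerivAt_integral_of_dominated_of_fderiv_le (s := Metric.ball x 1)
    (F := fun y z => mol n z • f (y - z)) (F' := fun y z => mol n z • fderiv ℝ f (y - z))
    (bound := fun z => mol n z * C)
    (Metric.ball_mem_nhds x one_pos) (Eventually.of_forall fun y =>
      (integrable_mol_smul hf.continuous n y).aestronglyMeasurable)
    (integrable_mol_smul hf.continuous n x) (integrable_mol_smul hD n x).aestronglyMeasurable
    (ae_of_all _ fun z y hy => ?_) ((integrable_mol n).mul_const C)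
    (ae_of_all _ fun z y hy => ?_)
  · rw [norm_smul, Real.norm_of_nonneg (mol_nonneg n z)]
    by_cases hz : mol n z = 0
    · simp [hz]
    · refine mul_le_mul_of_nonneg_left (hC _ ?_) (mol_nonneg n z)
      have h1 := norm_lt_of_mol_ne_zero hz
      have h2 := one_div_succ_le_one n
      rw [Metric.mem_ball, dist_eq_norm] at hy
      rw [Metric.mem_closedBall, dist_eq_norm]
      calc ‖y - z - x‖ = ‖(y - x) - z‖ := by congr 1; abel
        _ ≤ ‖y - x‖ + ‖z‖ := norm_sub_le _ _
        _ ≤ 2 := by linarith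
  · have h1 : HasFDerivAt (fun y => f (y - z)) (fderiv ℝ f (y - z)) y := by
      have := ((hf.differentiable (by simp)) (y - z)).hasFDerivAt.comp y
        ((hasFDerivAt_id y).sub_const z)
      simpa using! this
    exact h1.const_smul (mol n z)

/-- Mollifications converge uniformly near a compact set. -/
lemma mollify_sub_le_of_compact [CompleteSpace F] {f : Plane → F} (hf : Continuous f)
    {K : Set Plane} (hK : IsCompact K) {e : ℝ} (he : 0 < e) :
    ∀ᶠ n in atTop, ∀ x ∈ K, ‖mollify n f x - f x‖ ≤ e := by
  have hK1 : IsCompact (Metric.cthickening 1 K) := hK.cthickening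
  have huc := hK1.uniformContinuousOn_of_continuous hf.continuousOn
  rw [Metric.uniformContinuousOn_iff_le] at huc
  obtain ⟨d, hd, h⟩ := huc e he
  have h1 : Tendsto (fun n : ℕ => 1 / ((n : ℝ) + 1)) atTop (𝓝 0) :=
    tendsto_one_div_add_atTop_nhds_zero_nat
  filter_upwards [h1.eventually_lt_const hd] with n hn x hx
  refine norm_mollify_sub_le hf n x (f x) fun z hz => ?_
  rw [← dist_eq_norm]
  refine h _ ?_ x (Metric.self_subset_cthickening _ hx) ?_
  · refine Metric.mem_cthickening_of_dist_le _ x 1 _ hx ?_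
    rw [dist_eq_norm]
    simpa using hz.le.trans (one_div_succ_le_one n)
  · rw [dist_eq_norm]
    simpa using (hz.trans hn).le

lemma mollify_sub_le_of_hasCompactSupport [CompleteSpace F] {f : Plane → F} (hf : Continuous f)
    (hs : HasCompactSupport f) {e : ℝ} (he : 0 < e) :
    ∀ᶠ n in atTop, ∀ x, ‖mollify n f x - f x‖ ≤ e := by
  filter_upwards [mollify_sub_le_of_compact hf (hs.isCompact.cthickening (r := 1)) he]
    with n hn x
  by_cases hx : x ∈ Metric.cthickening 1 (tsupport f)
  · exact hn x hx
  · have h1 : mollify n f x = 0 := by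
      by_contra h0
      exact hx (tsupport_mollify_subset n f (subset_tsupport _ h0))
    have h2 : f x = 0 := by
      by_contra h0
      exact hx (Metric.self_subset_cthickening _ (subset_tsupport _ h0))
    simp [h1, h2, he.le]

end Mollify

/-! ### Values of distributions at functions of class `C¹` -/

/-- A smooth compactly supported function as a test function. -/
def toTestFun (f : Plane → ℝ) (hf : ContDiff ℝ ∞ f) (hs : HasCompactSupport f) : TestFun :=
  ⟨f, hf, hs, fun _ _ => trivial⟩

/-- The duality estimate between `B^{-ε,μ}_{p,p}` and functions of positive regularity, with
constant `A`. -/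
def DualityBound (χ₀ χ₁ : Plane → ℝ) (δ p q μ ε : ℝ) (A : ℝ≥0) : Prop :=
  ∀ (h : Plane → ℝ) (X : ℝ≥0∞), InterpolationBound δ q (μ / p) ε h X →
    ∀ φ : TestFun, ‖∫ x, φ x * h x‖ₑ ≤ A * besovTestNorm χ₀ χ₁ δ (-ε) μ p p φ * X

lemma dualNorm_le_of_bound {F : Type*} [NormedAddCommGroup F] {δ q ν : ℝ} (hq : 0 < q)
    {h : Plane → F} {K : Set Plane} (hK : MeasurableSet K) (hz : ∀ x ∉ K, h x = 0) {b : ℝ}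
    (hb : ∀ x, ‖h x‖ ≤ b) :
    dualNorm δ q ν h ≤
      (∫⁻ x in K, ENNReal.ofReal (weight δ (-ν) x) ^ q) ^ (1 / q) * ENNReal.ofReal b := by
  have h1 : ∫⁻ x, (‖h x‖ₑ * ENNReal.ofReal (weight δ (-ν) x)) ^ q ≤
      (∫⁻ x in K, ENNReal.ofReal (weight δ (-ν) x) ^ q) * ENNReal.ofReal b ^ q := by
    rw [← lintegral_mul_const' _ _ (by finiteness), ← lintegral_indicator hK]
    refine lintegral_mono fun x => ?_
    by_cases hx : x ∈ K
    · rw [Set.indicator_of_mem hx, ENNReal.mul_rpow_of_nonneg _ _ hq.le, mul_comm]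
      gcongr
      rw [← ofReal_norm]
      exact ENNReal.ofReal_le_ofReal (hb x)
    · simp [hz x hx, hq]
  refine (ENNReal.rpow_le_rpow h1 (by positivity)).trans (le_of_eq ?_)
  rw [ENNReal.mul_rpow_of_nonneg _ _ (by positivity), ← ENNReal.rpow_mul,
    mul_one_div_cancel hq.ne', ENNReal.rpow_one]

/-- Functions of class `C¹` with support in a fixed compact set have positive regularity. -/
lemma exists_interpolationBound_of_compact {δ q : ℝ} (hq : 0 < q) (ν : ℝ) {ε : ℝ}
    (hε2 : ε ≤ 1 / 2) {K : Set Plane} (hK : IsCompact K) :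
    ∃ A : ℝ≥0, ∀ (g : Plane → ℝ), ContDiff ℝ 1 g → tsupport g ⊆ K → ∀ b : ℝ, (∀ x, |g x| ≤ b) →
      (∀ x, ‖fderiv ℝ g x‖ ≤ b) → InterpolationBound δ q ν ε g (A * ENNReal.ofReal b) := by
  have hfin : (∫⁻ x in K, ENNReal.ofReal (weight δ (-ν) x) ^ q) ^ (1 / q) ≠ ⊤ := by
    refine (ENNReal.rpow_lt_top_of_nonneg (by positivity) (ne_of_lt ?_)).ne
    obtain ⟨C, hC⟩ := hK.exists_bound_of_continuousOn (continuous_weight δ (-ν)).continuousOn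
    calc ∫⁻ x in K, ENNReal.ofReal (weight δ (-ν) x) ^ q
        ≤ ∫⁻ x in K, ENNReal.ofReal C ^ q := by
          refine setLIntegral_mono' hK.measurableSet fun x hx => ?_
          gcongr
          exact (le_abs_self _).trans (hC x hx)
      _ = ENNReal.ofReal C ^ q * volume K := by rw [setLIntegral_const]
      _ < ⊤ := ENNReal.mul_lt_top (by finiteness) hK.measure_lt_top
  refine ⟨((∫⁻ x in K, ENNReal.ofReal (weight δ (-ν) x) ^ q) ^ (1 / q)).toNNReal,
    fun g hg hgs b hb hb' => ?_⟩
  · have hgc : HasCompactSupport g := HasCompactSupport.of_support_subset_isCompact hK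
      ((subset_tsupport _).trans hgs)
    have hz : ∀ x ∉ K, g x = 0 := fun x hx => by
      by_contra h0
      exact hx (hgs (subset_tsupport _ h0))
    have hz' : ∀ x ∉ K, fderiv ℝ g x = 0 := fun x hx => by
      by_contra h0
      exact hx (hgs (support_fderiv_subset ℝ h0))
    refine ⟨hg.continuous, hgc, ?_, fun j hj => ⟨g, hg, hgc, ?_, ?_⟩⟩
    · have := dualNorm_le_of_bound (δ := δ) (ν := ν) hq hK.measurableSet hz (b := b) hb
      rwa [← ENNReal.coe_toNNReal hfin] at this
    · have h0 : dualNorm δ q ν (g - g) = 0 := by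
        rw [sub_self, dualNorm]
        simp [hq]
      rw [h0]; exact zero_le
    · have := dualNorm_le_of_bound (δ := δ) (ν := ν) hq hK.measurableSet hz' (b := b) hb'
      rw [← ENNReal.coe_toNNReal hfin] at this
      refine this.trans (le_mul_of_one_le_left' ?_)
      rw [← ENNReal.ofReal_one]
      refine ENNReal.ofReal_le_ofReal (Real.one_le_rpow one_le_two ?_)
      exact mul_nonneg (by linarith) (Nat.cast_nonneg j)

/-- A `C¹` function with compact support is approximated in `C¹` by test functions with supports in
a common compact set. -/
lemma exists_testFun_approx {h : Plane → ℝ} (hh : ContDiff ℝ 1 h) (hs : HasCompactSupport h) :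
    ∃ ψ : ℕ → TestFun, (∀ n, tsupport (ψ n) ⊆ Metric.cthickening 1 (tsupport h)) ∧
      ∀ e : ℝ, 0 < e → ∀ᶠ n in atTop,
        ∀ x, |ψ n x - h x| ≤ e ∧ ‖fderiv ℝ (ψ n) x - fderiv ℝ h x‖ ≤ e := by
  refine ⟨fun n => toTestFun (mollify n h) (contDiff_mollify n hh.continuous)
    (hasCompactSupport_mollify n hs), fun n => tsupport_mollify_subset n h, fun e he => ?_⟩
  filter_upwards [mollify_sub_le_of_hasCompactSupport hh.continuous hs he,
    mollify_sub_le_of_hasCompactSupport (hh.continuous_fderiv (by simp)) (hs.fderiv ℝ) he]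
    with n h1 h2 x
  refine ⟨h1 x, ?_⟩
  have := h2 x
  rwa [← fderiv_mollify n hh] at this

lemma HasC1Value.exists_tendsto {Z : Distr} {h : Plane → ℝ} {c : ℝ} (hZ : HasC1Value Z h c)
    (hh : ContDiff ℝ 1 h) (hs : HasCompactSupport h) :
    ∃ ψ : ℕ → TestFun, (∀ n, tsupport (ψ n) ⊆ Metric.cthickening 1 (tsupport h)) ∧
      (∀ e : ℝ, 0 < e → ∀ᶠ n in atTop,
        ∀ x, |ψ n x - h x| ≤ e ∧ ‖fderiv ℝ (ψ n) x - fderiv ℝ h x‖ ≤ e) ∧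
      Tendsto (fun n => Z (ψ n)) atTop (𝓝 c) := by
  obtain ⟨ψ, hψs, hψ⟩ := exists_testFun_approx hh hs
  refine ⟨ψ, hψs, hψ, hZ ψ ⟨_, hs.isCompact.cthickening, hψs⟩ ?_ ?_⟩
  · rw [Metric.tendstoUniformly_iff]
    intro e he
    filter_upwards [hψ (e / 2) (half_pos he)] with n hn x
    rw [dist_comm, Real.dist_eq]
    linarith [(hn x).1]
  · rw [Metric.tendstoUniformly_iff]
    intro e he
    filter_upwards [hψ (e / 2) (half_pos he)] with n hn x
    rw [dist_comm, dist_eq_norm]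
    linarith [(hn x).2]

/-- Along a Besov approximation of `Z`, the pairings with a `C¹` function converge to the value of
the extension of `Z` at this function. -/
lemma tendsto_pairing {χ₀ χ₁ : Plane → ℝ} {δ p q μ ε : ℝ} {A : ℝ≥0}
    (hD : DualityBound χ₀ χ₁ δ p q μ ε A) (hq : 0 < q) (hε2 : ε ≤ 1 / 2) {Z : Distr}
    {φ : ℕ → TestFun} (hφ : IsBesovApprox χ₀ χ₁ δ (-ε) μ p p Z φ) {h : Plane → ℝ}
    (hh : ContDiff ℝ 1 h) (hs : HasCompactSupport h) {c : ℝ} (hZ : HasC1Value Z h c) :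
    Tendsto (fun n => ∫ x, φ n x * h x) atTop (𝓝 c) := by
  obtain ⟨ψ, hψs, hψ, hψZ⟩ := hZ.exists_tendsto hh hs
  have hKc : IsCompact (Metric.cthickening 1 (tsupport h)) := hs.isCompact.cthickening
  obtain ⟨B, hB⟩ := exists_interpolationBound_of_compact (δ := δ) hq (μ / p) hε2 hKc
  obtain ⟨N, hN⟩ := hφ.1 1 one_pos
  set I : ℝ := ∫ x, |φ N x| with hI
  have hI0 : 0 ≤ I := integral_nonneg fun x => abs_nonneg _
  have hint : ∀ (f : TestFun) (g : Plane → ℝ), Continuous g → Integrable fun x => f x * g x :=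
    fun f g hg => (f.continuous.mul hg).integrable_of_hasCompactSupport
      f.hasCompactSupport.mul_right
  rw [Metric.tendsto_atTop]
  intro e he
  set d : ℝ := e / (4 * (I + A * B + 1)) with hd
  have hden : 0 < 4 * (I + A * B + 1) := by positivity
  have hd0 : 0 < d := by positivity
  have hdle : (I + A * B) * d ≤ e / 4 := by
    rw [hd, mul_div_assoc', div_le_div_iff₀ hden (by norm_num)]
    nlinarith
  obtain ⟨m, hm1, hm2⟩ := ((hψ d hd0).and
    ((Metric.tendsto_nhds.1 hψZ) (e / 4) (by positivity))).exists
  have hlim := hφ.2 (ψ m)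
  obtain ⟨N', hN'⟩ := eventually_atTop.1 ((Metric.tendsto_nhds.1 hlim) (e / 4) (by positivity))
  refine ⟨max N N', fun n hn => ?_⟩
  have hn1 : N ≤ n := (le_max_left _ _).trans hn
  have hn2 := hN' n ((le_max_right _ _).trans hn)
  set g : Plane → ℝ := fun x => h x - ψ m x with hg
  have hψ1 : ContDiff ℝ 1 (ψ m) := (ψ m).contDiff.of_le (by exact_mod_cast le_top)
  have hgc : ContDiff ℝ 1 g := hh.sub hψ1
  have hgs : tsupport g ⊆ Metric.cthickening 1 (tsupport h) :=
    (tsupport_sub _ _).trans (Set.union_subset (Metric.self_subset_cthickening _) (hψs m))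
  have hgb : ∀ x, |g x| ≤ d := fun x => by rw [hg, abs_sub_comm]; exact (hm1 x).1
  have hgd : ∀ x, ‖fderiv ℝ g x‖ ≤ d := fun x => by
    have : fderiv ℝ g x = fderiv ℝ h x - fderiv ℝ (ψ m) x :=
      fderiv_fun_sub ((hh.differentiable (by simp)) x) ((hψ1.differentiable (by simp)) x)
    rw [this, norm_sub_rev]; exact (hm1 x).2
  have hpair := hD g _ (hB g hgc hgs d hgb hgd) (φ n - φ N)
  have hpair' : |∫ x, (φ n - φ N) x * g x| ≤ A * B * d := by
    have h1 : ‖∫ x, (φ n - φ N) x * g x‖ₑ ≤ ENNReal.ofReal (A * B * d) := by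
      refine hpair.trans ?_
      have h2 := hN n N hn1 le_rfl
      calc (A : ℝ≥0∞) * besovTestNorm χ₀ χ₁ δ (-ε) μ p p (φ n - φ N) * (B * ENNReal.ofReal d)
          ≤ A * (1 : ℝ≥0) * (B * ENNReal.ofReal d) := by gcongr; exact h2
        _ = ENNReal.ofReal (A * B * d) := by
          rw [ENNReal.ofReal_mul (by positivity), ENNReal.ofReal_mul (by positivity),
            ENNReal.ofReal_coe_nnreal, ENNReal.ofReal_coe_nnreal]
          push_cast; ring
    rw [← Real.norm_eq_abs]
    rwa [← ofReal_norm, ENNReal.ofReal_le_ofReal_iff (by positivity)] at h1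
  have hN0 : |∫ x, φ N x * g x| ≤ I * d := by
    rw [hI, ← integral_mul_const, ← Real.norm_eq_abs]
    refine norm_integral_le_of_norm_le
      ((((φ N).continuous.abs).integrable_of_hasCompactSupport
        ((φ N).hasCompactSupport.abs)).mul_const d) (ae_of_all _ fun x => ?_)
    rw [norm_mul, Real.norm_eq_abs, Real.norm_eq_abs]
    exact mul_le_mul_of_nonneg_left (hgb x) (abs_nonneg _)
  have hsplit : ∫ x, φ n x * h x =
      (∫ x, φ n x * ψ m x) + (∫ x, φ N x * g x) + ∫ x, (φ n - φ N) x * g x := by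
    have hI1 : Integrable fun x => φ n x * ψ m x + φ N x * g x :=
      (hint _ _ (ψ m).continuous).add (hint _ _ hgc.continuous)
    rw [← integral_add (hint _ _ (ψ m).continuous) (hint _ _ hgc.continuous),
      ← integral_add hI1 (hint _ _ hgc.continuous)]
    refine integral_congr_ae (ae_of_all _ fun x => ?_)
    simp only [hg, FunLike.coe_sub, Pi.sub_apply]
    ring
  rw [Real.dist_eq] at hn2 hm2 ⊢
  rw [hsplit]
  have e1 := abs_le.1 hn2.le
  have e2 := abs_le.1 hm2.le
  have e3 := abs_le.1 hpair'
  have e4 := abs_le.1 hN0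
  have e5 : I * d + A * B * d ≤ e / 4 := by linarith
  rw [abs_lt]
  constructor <;> linarith

/-- A bound on pairings with test functions in terms of their Besov norm passes to the completion. -/
lemma enorm_le_besovNorm_mul {χ₀ χ₁ : Plane → ℝ} {δ s μ p : ℝ} {Z : Distr} {h : Plane → ℝ} {c : ℝ}
    (hc : ∀ φ, IsBesovApprox χ₀ χ₁ δ s μ p p Z φ →
      Tendsto (fun n => ∫ x, φ n x * h x) atTop (𝓝 c)) {X : ℝ≥0∞} (hX0 : X ≠ 0) (hXt : X ≠ ⊤)
    (hX : ∀ φ : TestFun, ‖∫ x, φ x * h x‖ₑ ≤ besovTestNorm χ₀ χ₁ δ s μ p p φ * X) :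
    ‖c‖ₑ ≤ besovNorm χ₀ χ₁ δ s μ p p Z * X := by
  rw [← ENNReal.div_le_iff hX0 hXt]
  refine le_iInf₂ fun φ hφ => ?_
  have h1 : Tendsto (fun n => ‖∫ x, φ n x * h x‖ₑ / X) atTop (𝓝 (‖c‖ₑ / X)) :=
    ENNReal.Tendsto.div_const ((continuous_enorm.tendsto c).comp (hc φ hφ)) (Or.inr hX0)
  rw [← h1.liminf_eq]
  refine liminf_le_liminf (Eventually.of_forall fun n => ?_)
  rw [ENNReal.div_le_iff hX0 hXt]
  exact hX (φ n)

/-- Two values of the extension of `Z` to `C¹` functions are compared through the duality bound of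
the difference of the functions. -/
lemma abs_value_sub_le {χ₀ χ₁ : Plane → ℝ} {δ p q μ ε : ℝ} {A : ℝ≥0}
    (hD : DualityBound χ₀ χ₁ δ p q μ ε A) (hq : 0 < q) (hε2 : ε ≤ 1 / 2) {Z : Distr} {β : ℝ}
    (hβ : 0 ≤ β) (hZβ : besovNorm χ₀ χ₁ δ (-ε) μ p p Z ≤ ENNReal.ofReal β)
    {h h' : Plane → ℝ} (hh : ContDiff ℝ 1 h) (hs : HasCompactSupport h) (hh' : ContDiff ℝ 1 h')
    (hs' : HasCompactSupport h') {c c' : ℝ} (hc : HasC1Value Z h c) (hc' : HasC1Value Z h' c')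
    {X : ℝ} (hX0 : 0 < X)
    (hX : ∀ φ : TestFun, ‖∫ x, φ x * (h x - h' x)‖ₑ ≤
      besovTestNorm χ₀ χ₁ δ (-ε) μ p p φ * ENNReal.ofReal X) :
    |c - c'| ≤ β * X := by
  have h1 : ‖c - c'‖ₑ ≤ besovNorm χ₀ χ₁ δ (-ε) μ p p Z * ENNReal.ofReal X := by
    refine enorm_le_besovNorm_mul (h := fun x => h x - h' x) (fun φ hφ => ?_)
      (by simpa using hX0) ENNReal.ofReal_ne_top hX
    refine ((tendsto_pairing hD hq hε2 hφ hh hs hc).sub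
      (tendsto_pairing hD hq hε2 hφ hh' hs' hc')).congr fun n => ?_
    have hint : ∀ g : Plane → ℝ, Continuous g → Integrable fun x => φ n x * g x :=
      fun g hg => ((φ n).continuous.mul hg).integrable_of_hasCompactSupport
        (φ n).hasCompactSupport.mul_right
    rw [← integral_sub (hint _ hh.continuous) (hint _ hh'.continuous)]
    simp_rw [mul_sub]
  have h2 : ‖c - c'‖ₑ ≤ ENNReal.ofReal (β * X) := by
    rw [ENNReal.ofReal_mul hβ]
    exact h1.trans (by gcongr)
  rw [← ofReal_norm] at h2
  exact (ENNReal.ofReal_le_ofReal_iff (by positivity)).1 h2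

lemma abs_value_le {χ₀ χ₁ : Plane → ℝ} {δ p q μ ε : ℝ} {A : ℝ≥0}
    (hD : DualityBound χ₀ χ₁ δ p q μ ε A) (hq : 0 < q) (hε2 : ε ≤ 1 / 2) {Z : Distr} {β : ℝ}
    (hβ : 0 ≤ β) (hZβ : besovNorm χ₀ χ₁ δ (-ε) μ p p Z ≤ ENNReal.ofReal β)
    {h : Plane → ℝ} (hh : ContDiff ℝ 1 h) (hs : HasCompactSupport h) {c : ℝ}
    (hc : HasC1Value Z h c) {X : ℝ} (hX0 : 0 < X)
    (hX : ∀ φ : TestFun, ‖∫ x, φ x * h x‖ₑ ≤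
      besovTestNorm χ₀ χ₁ δ (-ε) μ p p φ * ENNReal.ofReal X) :
    |c| ≤ β * X := by
  have h1 : ‖c‖ₑ ≤ besovNorm χ₀ χ₁ δ (-ε) μ p p Z * ENNReal.ofReal X :=
    enorm_le_besovNorm_mul (fun φ hφ => tendsto_pairing hD hq hε2 hφ hh hs hc)
      (by simpa using hX0) ENNReal.ofReal_ne_top hX
  have h2 : ‖c‖ₑ ≤ ENNReal.ofReal (β * X) := by
    rw [ENNReal.ofReal_mul hβ]
    exact h1.trans (by gcongr)
  rw [← ofReal_norm] at h2
  exact (ENNReal.ofReal_le_ofReal_iff (by positivity)).1 h2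

/-- The Besov norm of the constant distribution `1` is bounded below. -/
lemma exists_le_besovNorm_one {χ₀ χ₁ : Plane → ℝ} {δ p q μ ε : ℝ} {A : ℝ≥0}
    (hD : DualityBound χ₀ χ₁ δ p q μ ε A) (hq : 0 < q) (hε2 : ε ≤ 1 / 2) :
    ∃ c : ℝ, 0 < c ∧ ∀ Z : Distr, (∀ φ : TestFun, Z φ = ∫ x, φ x) →
      ENNReal.ofReal c ≤ besovNorm χ₀ χ₁ δ (-ε) μ p p Z := by
  set ψ : TestFun := toTestFun (mol 0) (contDiff_mol 0) (hasCompactSupport_mol 0) with hψ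
  obtain ⟨B, hB⟩ := exists_interpolationBound_of_compact (δ := δ) hq (μ / p) hε2
    (hasCompactSupport_mol 0)
  have h1 : ContDiff ℝ 1 (mol 0) := (contDiff_mol 0).of_le (by exact_mod_cast le_top)
  obtain ⟨b₁, hb₁⟩ := (continuous_mol 0).bounded_above_of_compact_support (hasCompactSupport_mol 0)
  obtain ⟨b₂, hb₂⟩ := (h1.continuous_fderiv (by simp)).bounded_above_of_compact_support
    ((hasCompactSupport_mol 0).fderiv ℝ)
  set b : ℝ := max b₁ b₂
  have hX := hD (mol 0) _ (hB (mol 0) h1 subset_rfl b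
    (fun x => (hb₁ x).trans (le_max_left _ _)) (fun x => (hb₂ x).trans (le_max_right _ _)))
  set X : ℝ := A * B * |b| + 1 with hXdef
  have hX0 : 0 < X := by positivity
  refine ⟨1 / X, by positivity, fun Z hZ => ?_⟩
  have key : ‖(1 : ℝ)‖ₑ ≤ besovNorm χ₀ χ₁ δ (-ε) μ p p Z * ENNReal.ofReal X := by
    refine enorm_le_besovNorm_mul (h := mol 0) (fun φ hφ => ?_) (by simpa using hX0)
      ENNReal.ofReal_ne_top fun φ => (hX φ).trans ?_
    · have := hφ.2 ψ
      rw [hZ ψ] at this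
      have h2 : ∫ x, ψ x = 1 := integral_mol 0
      rwa [h2] at this
    · calc (A : ℝ≥0∞) * besovTestNorm χ₀ χ₁ δ (-ε) μ p p φ * (B * ENNReal.ofReal b)
          = besovTestNorm χ₀ χ₁ δ (-ε) μ p p φ * (A * B * ENNReal.ofReal b) := by ring
        _ ≤ _ := by
          gcongr
          calc (A : ℝ≥0∞) * B * ENNReal.ofReal b ≤ A * B * ENNReal.ofReal |b| := by
                gcongr; exact le_abs_self b
            _ = ENNReal.ofReal (A * B * |b|) := by
                rw [ENNReal.ofReal_mul (by positivity), ENNReal.ofReal_mul (by positivity),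
                  ENNReal.ofReal_coe_nnreal, ENNReal.ofReal_coe_nnreal]
            _ ≤ _ := ENNReal.ofReal_le_ofReal (by rw [hXdef]; linarith)
  rw [enorm_one] at key
  rw [ENNReal.ofReal_div_of_pos hX0, ENNReal.ofReal_one,
    ENNReal.div_le_iff (by simpa using hX0) ENNReal.ofReal_ne_top]
  exact key

/-! ### Localized weights -/

/-- A fixed bump function, equal to one on the unit ball and supported in the ball of radius 2. -/
noncomputable def cutBump : ContDiffBump (0 : Plane) where
  rIn := 1
  rOut := 2
  rIn_pos := one_pos
  rIn_lt_rOut := one_lt_two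

/-- The cutoff function at scale `R`. -/
noncomputable def cut (R : ℝ) (x : Plane) : ℝ := cutBump (R⁻¹ • x)

lemma cut_nonneg (R : ℝ) (x : Plane) : 0 ≤ cut R x := cutBump.nonneg

lemma cut_le_one (R : ℝ) (x : Plane) : cut R x ≤ 1 := cutBump.le_one

lemma contDiff_cut (R : ℝ) : ContDiff ℝ ∞ (cut R) :=
  (cutBump.contDiff (n := ⊤)).comp (contDiff_const_smul R⁻¹)

lemma continuous_cut (R : ℝ) : Continuous (cut R) := (contDiff_cut R).continuous

lemma hasCompactSupport_cut {R : ℝ} (hR : 1 ≤ R) : HasCompactSupport (cut R) :=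
  cutBump.hasCompactSupport.comp_smul (inv_ne_zero (by linarith))

lemma cut_eq_one {R : ℝ} (hR : 1 ≤ R) {x : Plane} (hx : ‖x‖ ≤ R) : cut R x = 1 := by
  refine cutBump.one_of_mem_closedBall ?_
  rw [mem_closedBall_zero_iff, norm_smul, norm_inv, Real.norm_of_nonneg (by linarith)]
  change R⁻¹ * ‖x‖ ≤ 1
  rw [inv_mul_le_iff₀ (by linarith)]
  linarith

lemma exists_norm_fderiv_cut_le :
    ∃ C : ℝ, 0 ≤ C ∧ ∀ R : ℝ, 1 ≤ R → ∀ x, ‖fderiv ℝ (cut R) x‖ ≤ C := by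
  have h1 : ContDiff ℝ 1 (cutBump : Plane → ℝ) := cutBump.contDiff (n := 1)
  obtain ⟨C, hC⟩ := (h1.continuous_fderiv (by simp)).bounded_above_of_compact_support
    (cutBump.hasCompactSupport.fderiv ℝ)
  refine ⟨C, (norm_nonneg _).trans (hC 0), fun R hR x => ?_⟩
  have h2 : HasFDerivAt (cut R) (R⁻¹ • fderiv ℝ (cutBump : Plane → ℝ) (R⁻¹ • x)) x := by
    have h3 : HasFDerivAt (fun y : Plane => R⁻¹ • y) (R⁻¹ • ContinuousLinearMap.id ℝ Plane) x :=
      (hasFDerivAt_id x).const_smul R⁻¹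
    have := ((h1.differentiable (by simp)) (R⁻¹ • x)).hasFDerivAt.comp x h3
    simpa using! this
  rw [h2.fderiv, norm_smul, norm_inv, Real.norm_of_nonneg (by linarith)]
  have h4 : R⁻¹ ≤ 1 := inv_le_one_of_one_le₀ hR
  calc R⁻¹ * _ ≤ 1 * C := mul_le_mul h4 (hC _) (norm_nonneg _) zero_le_one
    _ = C := one_mul C

/-- The localized weight `w_μ η_R ^ M`; the high power of the cutoff makes its gradient controlled
by a power of the weight itself. -/
noncomputable def locWeight (δ μ : ℝ) (M : ℕ) (R : ℝ) (x : Plane) : ℝ :=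
  weight δ μ x * cut R x ^ M

lemma locWeight_nonneg (δ μ : ℝ) (M : ℕ) (R : ℝ) (x : Plane) : 0 ≤ locWeight δ μ M R x :=
  mul_nonneg (weight_pos _ _ _).le (pow_nonneg (cut_nonneg _ _) _)

lemma contDiff_locWeight (δ μ : ℝ) (M : ℕ) (R : ℝ) : ContDiff ℝ ∞ (locWeight δ μ M R) :=
  (contDiff_weight δ μ).mul ((contDiff_cut R).pow M)

lemma continuous_locWeight (δ μ : ℝ) (M : ℕ) (R : ℝ) : Continuous (locWeight δ μ M R) :=
  (contDiff_locWeight δ μ M R).continuous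

lemma hasCompactSupport_locWeight (δ μ : ℝ) {M : ℕ} (hM : M ≠ 0) {R : ℝ} (hR : 1 ≤ R) :
    HasCompactSupport (locWeight δ μ M R) := by
  have : HasCompactSupport fun x => cut R x ^ M :=
    (hasCompactSupport_cut hR).comp_left (g := fun t : ℝ => t ^ M) (zero_pow hM)
  exact this.mul_left

lemma norm_fderiv_locWeight_le {δ μ : ℝ} (hδ : 0 < δ) (hδ1 : δ ≤ 1) (hμ : 0 < μ) {M : ℕ}
    {R C : ℝ} {x : Plane} (hM : 1 ≤ M) (hC : ‖fderiv ℝ (cut R) x‖ ≤ C) :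
    ‖fderiv ℝ (locWeight δ μ M R) x‖ ≤ (μ + M * C) * (weight δ μ x * cut R x ^ (M - 1)) := by
  have h1 := (((contDiff_weight δ μ).differentiable (by simp)) x).hasFDerivAt
  have h2 := ((((contDiff_cut R).differentiable (by simp)) x).hasFDerivAt).pow M
  have h3 : HasFDerivAt (locWeight δ μ M R) _ x := h1.mul h2
  rw [h3.fderiv]
  have hη0 := cut_nonneg R x
  have hη1 := cut_le_one R x
  have hw := weight_pos δ μ x
  have hp : 0 ≤ cut R x ^ (M - 1) := pow_nonneg hη0 _
  have hp' : cut R x ^ M ≤ cut R x ^ (M - 1) := pow_le_pow_of_le_one hη0 hη1 (by omega)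
  refine (norm_add_le _ _).trans ?_
  rw [norm_smul (weight δ μ x), norm_smul (cut R x ^ M), norm_smul, Real.norm_of_nonneg hw.le,
    Real.norm_of_nonneg (pow_nonneg hη0 _)]
  have h4 : ‖(M • (cut R x ^ (M - 1) : ℝ))‖ = M * cut R x ^ (M - 1) := by
    rw [nsmul_eq_mul, Real.norm_of_nonneg (by positivity)]
  rw [h4]
  have h5 := norm_fderiv_weight_le hδ hδ1 hμ x
  have h6 : cut R x ^ M * ‖fderiv ℝ (weight δ μ) x‖ ≤ cut R x ^ (M - 1) * (μ * weight δ μ x) :=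
    mul_le_mul hp' h5 (norm_nonneg _) hp
  have h7 : weight δ μ x * (M * cut R x ^ (M - 1) * ‖fderiv ℝ (cut R) x‖) ≤
      weight δ μ x * (M * cut R x ^ (M - 1) * C) := by gcongr
  linarith

/-! ### The energy density -/

/-- The energy density `1 + (|Y| η) ^ M + |∇Y|² |Y| ^ (2r - 2) η ^ M` at level `R`; against the
weight, its integral collects the coercive terms of the `L ^ {2r}` energy estimate. -/
noncomputable def density (r M : ℕ) (R : ℝ) (Y : Plane → ℝ) (x : Plane) : ℝ :=
  1 + (|Y x| * cut R x) ^ M + ‖fderiv ℝ Y x‖ ^ 2 * |Y x| ^ (2 * r - 2) * cut R x ^ M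

/-- The total energy at level `R`. -/
noncomputable def energy (δ μ : ℝ) (r M : ℕ) (R : ℝ) (Y : Plane → ℝ) : ℝ :=
  ∫ x, density r M R Y x * weight δ μ x

lemma one_le_density (r M : ℕ) (R : ℝ) (Y : Plane → ℝ) (x : Plane) : 1 ≤ density r M R Y x := by
  have := cut_nonneg R x
  have h1 : 0 ≤ (|Y x| * cut R x) ^ M := by positivity
  have h2 : 0 ≤ ‖fderiv ℝ Y x‖ ^ 2 * |Y x| ^ (2 * r - 2) * cut R x ^ M := by positivity
  unfold density
  linarith

lemma continuous_density (r M : ℕ) (R : ℝ) {Y : Plane → ℝ} (hY : ContDiff ℝ 1 Y) :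
    Continuous (density r M R Y) := by
  have h1 := hY.continuous
  have h2 : Continuous (fderiv ℝ Y) := hY.continuous_fderiv (by simp)
  have h3 := continuous_cut R
  unfold density
  fun_prop

lemma integrable_density_mul {δ μ : ℝ} (hδ : 0 < δ) (hμ : 0 < μ) (r : ℕ) {M : ℕ} (hM : M ≠ 0)
    {R : ℝ} (hR : 1 ≤ R) {Y : Plane → ℝ} (hY : ContDiff ℝ 1 Y) :
    Integrable fun x => density r M R Y x * weight δ μ x := by
  have hc : HasCompactSupport fun x => density r M R Y x - 1 := by
    have : ∀ x, density r M R Y x - 1 = (|Y x| ^ M +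
        ‖fderiv ℝ Y x‖ ^ 2 * |Y x| ^ (2 * r - 2)) * cut R x ^ M := by
      intro x; unfold density; rw [mul_pow]; ring
    simp_rw [this]
    refine HasCompactSupport.mul_left ?_
    exact (hasCompactSupport_cut hR).comp_left (g := fun t : ℝ => t ^ M) (zero_pow hM)
  have h1 : Integrable fun x => (density r M R Y x - 1) * weight δ μ x :=
    ((((continuous_density r M R hY).sub continuous_const).mul
      (continuous_weight δ μ))).integrable_of_hasCompactSupport hc.mul_right
  refine (h1.add (integrable_weight hδ hμ)).congr (ae_of_all _ fun x => ?_)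
  simp only [Pi.add_apply]
  ring

/-- The `2M`-th root `t` of the energy density: sizes are controlled by powers of `t`, and the
number `2M - 1` is the exponent at which all lower order terms sit. -/
lemma exists_root_density {r M L : ℕ} (hM : M = 2 * L) (hr : 1 ≤ r) (hL : 1 ≤ L) (R : ℝ)
    (Y : Plane → ℝ) (x : Plane) :
    ∃ t : ℝ, 1 ≤ t ∧ t ^ (2 * M) = density r M R Y x ∧ |Y x| * cut R x ≤ t ^ 2 ∧
      ‖fderiv ℝ Y x‖ * |Y x| ^ (r - 1) * cut R x ^ L ≤ t ^ M ∧
      density r M R Y x ^ (1 - 1 / (2 * M : ℝ)) = t ^ (2 * M - 1) := by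
  set s := density r M R Y x with hs
  have hs1 : 1 ≤ s := one_le_density _ _ _ _ _
  have hs0 : 0 < s := by linarith
  have hM1 : 2 ≤ M := by omega
  have hMr : (0 : ℝ) < 2 * M := by
    have : (2 : ℝ) ≤ M := by exact_mod_cast hM1
    linarith
  have hη := cut_nonneg R x
  have hu0 : 0 ≤ |Y x| * cut R x := by positivity
  have hv0 : 0 ≤ ‖fderiv ℝ Y x‖ * |Y x| ^ (r - 1) * cut R x ^ L := by positivity
  refine ⟨s ^ (1 / (2 * M : ℝ)), Real.one_le_rpow hs1 (by positivity), ?_, ?_, ?_, ?_⟩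
  · rw [← Real.rpow_natCast, ← Real.rpow_mul hs0.le]
    push_cast
    rw [one_div_mul_cancel hMr.ne', Real.rpow_one]
  · have h1 : (|Y x| * cut R x) ^ M ≤ s := by
      have h2 : 0 ≤ ‖fderiv ℝ Y x‖ ^ 2 * |Y x| ^ (2 * r - 2) * cut R x ^ M := by positivity
      rw [hs, density]; linarith
    refine le_of_pow_le_pow_left₀ (n := M) (by omega) (by positivity) (h1.trans (le_of_eq ?_))
    rw [← pow_mul, ← Real.rpow_natCast, ← Real.rpow_mul hs0.le]
    push_cast
    rw [one_div_mul_cancel hMr.ne', Real.rpow_one]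
  · have h1 : (‖fderiv ℝ Y x‖ * |Y x| ^ (r - 1) * cut R x ^ L) ^ 2 ≤ s := by
      have h2 : 0 ≤ (|Y x| * cut R x) ^ M := by positivity
      have h3 : (‖fderiv ℝ Y x‖ * |Y x| ^ (r - 1) * cut R x ^ L) ^ 2 =
          ‖fderiv ℝ Y x‖ ^ 2 * |Y x| ^ (2 * r - 2) * cut R x ^ M := by
        have e1 : (r - 1) * 2 = 2 * r - 2 := by omega
        rw [mul_pow, mul_pow, ← pow_mul, ← pow_mul, e1, mul_comm L 2, ← hM]
      rw [h3, hs, density]; linarith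
    refine le_of_pow_le_pow_left₀ (n := 2) (by omega) (by positivity) (h1.trans (le_of_eq ?_))
    rw [← pow_mul, ← Real.rpow_natCast, ← Real.rpow_mul hs0.le]
    push_cast
    rw [mul_comm (M : ℝ) 2, one_div_mul_cancel hMr.ne', Real.rpow_one]
  · rw [← Real.rpow_natCast, ← Real.rpow_mul hs0.le]
    congr 1
    rw [Nat.cast_sub (by omega)]
    push_cast
    field_simp

/-- Functions bounded by the lower order power of the energy density have a dual norm bounded by
the energy. The exponents are chosen so that `(4M)' (1 - 1 / (4M)) = 1`. -/
lemma dualNorm_le_energy {F : Type*} [NormedAddCommGroup F] {δ μ ν q : ℝ} (hδ : 0 < δ)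
    (hμ : 0 < μ) {r M : ℕ} (hM : 1 ≤ M) (hq : q = 4 * M / (4 * M - 1)) (hν : ν ≤ μ / (4 * M))
    {R : ℝ} (hR : 1 ≤ R) {Y : Plane → ℝ} (hY : ContDiff ℝ 1 Y) {H : Plane → F} {b : ℝ}
    (hb : 0 ≤ b)
    (hH : ∀ x, ‖H x‖ ≤ b * (density r M R Y x ^ (1 - 1 / (2 * M : ℝ)) * weight δ μ x)) :
    dualNorm δ q ν H ≤ ENNReal.ofReal (b * energy δ μ r M R Y ^ (1 / q)) := by
  have hMr : (1 : ℝ) ≤ M := by exact_mod_cast hM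
  have hq0 : 0 < q := by rw [hq]; apply div_pos <;> linarith
  have hE0 : 0 ≤ energy δ μ r M R Y := integral_nonneg fun x =>
    mul_nonneg (zero_le_one.trans (one_le_density _ _ _ _ _)) (weight_pos _ _ _).le
  have key : ∫⁻ x, (‖H x‖ₑ * ENNReal.ofReal (weight δ (-ν) x)) ^ q ≤
      ENNReal.ofReal (b ^ q * energy δ μ r M R Y) := by
    rw [energy, ENNReal.ofReal_mul (by positivity), ofReal_integral_eq_lintegral_ofReal
      (integrable_density_mul hδ hμ r (by omega) hR hY)
      (ae_of_all _ fun x => mul_nonneg (zero_le_one.trans (one_le_density _ _ _ _ _))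
        (weight_pos _ _ _).le), ← lintegral_const_mul' _ _ ENNReal.ofReal_ne_top]
    refine lintegral_mono fun x => ?_
    have hw := weight_pos δ μ x
    have hwν := weight_pos δ (-ν) x
    have hs := one_le_density r M R Y x
    rw [← ofReal_norm, ← ENNReal.ofReal_mul (norm_nonneg _),
      ENNReal.ofReal_rpow_of_nonneg (by positivity) hq0.le, ← ENNReal.ofReal_mul (by positivity)]
    refine ENNReal.ofReal_le_ofReal ?_
    have h1 : weight δ μ x * weight δ (-ν) x ≤ weight δ μ x ^ (1 / q) := by
      rw [weight_mul, weight_rpow]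
      refine Real.exp_le_exp.2 ?_
      have h2 : 0 ≤ bracket x ^ δ := Real.rpow_nonneg (bracket_pos x).le _
      refine mul_le_mul_of_nonneg_right ?_ h2
      have h3 : 1 / q * μ = μ - μ / (4 * M) := by
        rw [hq]; field_simp
      rw [h3]; linarith
    have h2 : density r M R Y x ^ ((1 - 1 / (2 * M : ℝ)) * q) ≤ density r M R Y x := by
      conv_rhs => rw [← Real.rpow_one (density r M R Y x)]
      refine Real.rpow_le_rpow_of_exponent_le hs ?_
      have h4 : (0 : ℝ) < 4 * M - 1 := by linarith
      rw [hq, mul_div_assoc', div_le_one h4]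
      field_simp
      linarith
    calc (‖H x‖ * weight δ (-ν) x) ^ q
        ≤ (b * (density r M R Y x ^ (1 - 1 / (2 * M : ℝ)) * weight δ μ x) * weight δ (-ν) x) ^ q :=
          Real.rpow_le_rpow (by positivity) (by gcongr; exact hH x) hq0.le
      _ ≤ (b * density r M R Y x ^ (1 - 1 / (2 * M : ℝ)) * weight δ μ x ^ (1 / q)) ^ q := by
          refine Real.rpow_le_rpow (by positivity) ?_ hq0.le
          rw [mul_assoc, mul_assoc, mul_assoc]
          gcongr
      _ = b ^ q * (density r M R Y x ^ ((1 - 1 / (2 * M : ℝ)) * q) * weight δ μ x) := by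
          rw [Real.mul_rpow (by positivity) (by positivity),
            Real.mul_rpow (by positivity) (by positivity), ← Real.rpow_mul (by linarith),
            ← Real.rpow_mul hw.le, one_div_mul_cancel hq0.ne', Real.rpow_one, mul_assoc]
      _ ≤ _ := by gcongr
  refine (ENNReal.rpow_le_rpow key (by positivity)).trans (le_of_eq ?_)
  rw [ENNReal.ofReal_rpow_of_nonneg (by positivity) (by positivity),
    Real.mul_rpow (by positivity) hE0, ← Real.rpow_mul hb, mul_one_div_cancel hq0.ne',
    Real.rpow_one]

/-! ### Truncation and fractional regularity of powers -/

/-- A smooth truncation of the identity at level `Λ`. -/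
noncomputable def trunc (Λ y : ℝ) : ℝ := y / (1 + (y / Λ) ^ 2)

lemma abs_trunc_le_abs (Λ y : ℝ) : |trunc Λ y| ≤ |y| := by
  rw [trunc, abs_div, abs_of_pos (by positivity : (0 : ℝ) < 1 + (y / Λ) ^ 2)]
  exact div_le_self (abs_nonneg _) (by nlinarith [sq_nonneg (y / Λ)])

lemma abs_trunc_le {Λ : ℝ} (hΛ : 0 < Λ) (y : ℝ) : |trunc Λ y| ≤ Λ := by
  rw [trunc, abs_div, abs_of_pos (by positivity : (0 : ℝ) < 1 + (y / Λ) ^ 2),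
    div_le_iff₀ (by positivity)]
  have h1 : |y| = Λ * |y / Λ| := by
    rw [abs_div, abs_of_pos hΛ]; field_simp
  rw [h1]
  refine mul_le_mul_of_nonneg_left ?_ hΛ.le
  nlinarith [sq_abs (y / Λ), sq_nonneg (|y / Λ| - 1)]

lemma abs_sub_trunc_le {Λ : ℝ} (hΛ : 0 < Λ) (y : ℝ) :
    |y - trunc Λ y| ≤ |y| * (√|y| * √Λ⁻¹) := by
  set a := |y / Λ| with ha
  have ha0 : 0 ≤ a := abs_nonneg _
  have h1 : y - trunc Λ y = y * (a ^ 2 / (1 + a ^ 2)) := by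
    rw [trunc, ha, sq_abs]; field_simp; ring
  have h2 : √|y| * √Λ⁻¹ = √a := by
    rw [← Real.sqrt_mul (abs_nonneg _), ha, abs_div, abs_of_pos hΛ, div_eq_mul_inv]
  rw [h1, h2, abs_mul, abs_of_nonneg (by positivity : 0 ≤ a ^ 2 / (1 + a ^ 2))]
  refine mul_le_mul_of_nonneg_left ?_ (abs_nonneg _)
  have hd : (0 : ℝ) < 1 + a ^ 2 := by positivity
  rcases le_total a 1 with h | h
  · refine (div_le_self (sq_nonneg a) (by nlinarith)).trans (Real.le_sqrt_of_sq_le ?_)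
    have : a ^ 2 ≤ 1 := by nlinarith
    have h3 : a ^ 2 ≤ a := by nlinarith
    nlinarith
  · have h3 : 1 ≤ √a := Real.one_le_sqrt.2 h
    refine le_trans ?_ h3
    rw [div_le_one hd]; linarith

lemma hasDerivAt_trunc {Λ : ℝ} (y : ℝ) :
    HasDerivAt (trunc Λ) ((1 - (y / Λ) ^ 2) / (1 + (y / Λ) ^ 2) ^ 2) y := by
  have hd : (1 + (y / Λ) ^ 2) ≠ 0 := by positivity
  have h1 : HasDerivAt (fun y : ℝ => 1 + (y / Λ) ^ 2) (2 * (y / Λ) * (1 / Λ)) y := by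
    have := (((hasDerivAt_id y).div_const Λ).pow 2).const_add 1
    simpa using! this
  have h2 : HasDerivAt (trunc Λ) _ y := (hasDerivAt_id y).div h1 hd
  convert h2 using 2
  simp only [id]
  ring

lemma contDiff_trunc (Λ : ℝ) : ContDiff ℝ ∞ (trunc Λ) := by
  unfold trunc
  refine contDiff_id.div (contDiff_const.add ((contDiff_id.div_const Λ).pow 2)) fun y => ?_
  positivity

lemma abs_deriv_trunc_le (a : ℝ) : |(1 - a ^ 2) / (1 + a ^ 2) ^ 2| ≤ 1 := by
  rw [abs_div, abs_of_pos (by positivity : (0 : ℝ) < (1 + a ^ 2) ^ 2), div_le_one (by positivity),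
    abs_le]
  constructor <;> nlinarith [sq_nonneg a, sq_nonneg (a ^ 2)]

lemma abs_pow_sub_pow_le (a b : ℝ) (h : |b| ≤ |a|) (m : ℕ) :
    |a ^ m - b ^ m| ≤ m * |a| ^ (m - 1) * |a - b| := by
  rw [← mul_comm |a - b|, ← Commute.mul_geom_sum₂ (Commute.all a b) m, abs_mul]
  refine mul_le_mul_of_nonneg_left ?_ (abs_nonneg _)
  refine (Finset.abs_sum_le_sum_abs _ _).trans ?_
  refine (Finset.sum_le_card_nsmul _ _ (|a| ^ (m - 1)) fun i hi => ?_).trans (by simp)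
  rw [Finset.mem_range] at hi
  rw [abs_mul, abs_pow, abs_pow]
  calc |a| ^ i * |b| ^ (m - 1 - i) ≤ |a| ^ i * |a| ^ (m - 1 - i) := by gcongr
    _ = |a| ^ (m - 1) := by rw [← pow_add]; congr 1; omega

lemma abs_pow_mul_cut_le {m j : ℕ} {R t : ℝ} {Y : Plane → ℝ} {x : Plane} (ht : 1 ≤ t)
    (hY : |Y x| * cut R x ≤ t ^ 2) (hmj : m ≤ j) : |Y x| ^ m * cut R x ^ j ≤ t ^ (2 * m) := by
  have h0 := cut_nonneg R x
  have h1 := cut_le_one R x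
  calc |Y x| ^ m * cut R x ^ j = (|Y x| * cut R x) ^ m * cut R x ^ (j - m) := by
        rw [mul_pow, mul_assoc, ← pow_add]; congr 2; omega
    _ ≤ (t ^ 2) ^ m * 1 := by
        gcongr
        exact pow_le_one₀ h0 h1
    _ = t ^ (2 * m) := by rw [mul_one, ← pow_mul]

/-- The powers `Y ^ m` of order below the coercive one, localized by the weight, have the
fractional regularity needed for the duality estimate, with a bound by a power less than one of the
energy. The comparison functions at frequency `2 ^ j` are powers of truncations of `Y`: powers of
the truncation level pay for the gradient, which enters the energy only with a power of `Y` of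
limited order. -/
theorem interpolationBound_pow {δ μ ν q ε : ℝ} (hδ : 0 < δ) (hδ1 : δ ≤ 1) (hμ : 0 < μ)
    {r k M L m : ℕ} (hr : 1 ≤ r) (hk : 3 ≤ k) (hMk : M + 1 = 2 * r + k) (hML : M = 2 * L)
    (hq : q = 4 * M / (4 * M - 1)) (hν : ν ≤ μ / (4 * M)) (hε : 0 ≤ ε)
    (hεk : ε * (4 * k + 2) ≤ 1) {R C : ℝ} (hR : 1 ≤ R) (hC0 : 0 ≤ C)
    (hC : ∀ x, ‖fderiv ℝ (cut R) x‖ ≤ C) {Y : Plane → ℝ} (hY : ContDiff ℝ 1 Y)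
    (hm1 : r ≤ m) (hm2 : m + 1 ≤ M) :
    InterpolationBound δ q ν ε (fun x => Y x ^ m * locWeight δ μ M R x)
      (ENNReal.ofReal ((M + μ + M * C) * energy δ μ r M R Y ^ (1 / q))) := by
  have hρ1 : ContDiff ℝ 1 (locWeight δ μ M R) :=
    (contDiff_locWeight δ μ M R).of_le (by exact_mod_cast le_top)
  have hρs := hasCompactSupport_locWeight δ μ (M := M) (by omega) hR
  have hMr : (1 : ℝ) ≤ M := by exact_mod_cast (by omega : 1 ≤ M)
  have hmM : (m : ℝ) ≤ M := by exact_mod_cast (by omega : m ≤ M)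
  have hMC : 0 ≤ M * C := by positivity
  have hCb : 1 ≤ M + μ + M * C := by linarith
  refine ⟨hY.continuous.pow m |>.mul hρ1.continuous, hρs.mul_left, ?_, fun j hj => ?_⟩
  · refine dualNorm_le_energy hδ hμ (by omega) hq hν hR hY (by positivity) fun x => ?_
    obtain ⟨t, ht1, -, htY, -, ht⟩ := exists_root_density hML hr (by omega) R Y x
    have hw := weight_pos δ μ x
    rw [ht, norm_mul, norm_pow, Real.norm_eq_abs, Real.norm_of_nonneg (locWeight_nonneg _ _ _ _ _),
      locWeight]
    have h1 := abs_pow_mul_cut_le ht1 htY (by omega : m ≤ M)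
    have h2 : t ^ (2 * m) ≤ t ^ (2 * M - 1) := pow_le_pow_right₀ ht1 (by omega)
    calc |Y x| ^ m * (weight δ μ x * cut R x ^ M) = (|Y x| ^ m * cut R x ^ M) * weight δ μ x := by
          ring
      _ ≤ t ^ (2 * M - 1) * weight δ μ x := by gcongr; exact h1.trans h2
      _ ≤ _ := le_mul_of_one_le_left (by positivity) hCb
  · set Λ : ℝ := 2 ^ (4 * ε * j) with hΛ
    have hΛ0 : 0 < Λ := by positivity
    have hΛ1 : 1 ≤ Λ := Real.one_le_rpow one_le_two (by positivity)
    have hΛs : √Λ⁻¹ = 2 ^ (-(2 * ε * j)) := by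
      rw [Real.sqrt_eq_rpow, hΛ, ← Real.rpow_neg zero_le_two, ← Real.rpow_mul zero_le_two]
      congr 1; ring
    have hΛk : Λ ^ k ≤ 2 ^ ((1 - 2 * ε) * j) := by
      rw [hΛ, ← Real.rpow_natCast, ← Real.rpow_mul zero_le_two]
      refine Real.rpow_le_rpow_of_exponent_le one_le_two ?_
      have hj0 : (0 : ℝ) ≤ j := j.cast_nonneg
      nlinarith
    have hS : ContDiff ℝ 1 fun x => trunc Λ (Y x) :=
      ((contDiff_trunc Λ).of_le (by exact_mod_cast le_top)).comp hY
    refine ⟨fun x => trunc Λ (Y x) ^ m * locWeight δ μ M R x, (hS.pow m).mul hρ1, hρs.mul_left,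
      ?_, ?_⟩
    · rw [← ENNReal.ofReal_mul (by positivity), ← mul_assoc]
      refine dualNorm_le_energy hδ hμ (by omega) hq hν hR hY (by positivity) fun x => ?_
      obtain ⟨t, ht1, -, htY, -, ht⟩ := exists_root_density hML hr (by omega) R Y x
      have hw := weight_pos δ μ x
      have hη0 := cut_nonneg R x
      have hη1 := cut_le_one R x
      have h0 : (fun x => Y x ^ m * locWeight δ μ M R x) x -
          (fun x => trunc Λ (Y x) ^ m * locWeight δ μ M R x) x =
          (Y x ^ m - trunc Λ (Y x) ^ m) * locWeight δ μ M R x := by ring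
      rw [ht, Pi.sub_apply, h0, norm_mul, Real.norm_eq_abs,
        Real.norm_of_nonneg (locWeight_nonneg _ _ _ _ _), locWeight]
      have h1 := (abs_pow_sub_pow_le (Y x) (trunc Λ (Y x)) (abs_trunc_le_abs _ _) m).trans
        (mul_le_mul_of_nonneg_left (abs_sub_trunc_le hΛ0 (Y x)) (by positivity))
      have h2 := abs_pow_mul_cut_le (m := m) ht1 htY (by omega : m ≤ M - 1)
      have h3 : √|Y x| * cut R x ≤ t := by
        refine le_of_pow_le_pow_left₀ (n := 2) (by omega) (by linarith) ?_
        rw [mul_pow, Real.sq_sqrt (abs_nonneg _)]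
        refine le_trans ?_ htY
        gcongr
        nlinarith
      rw [← hΛs]
      have hm0 : (m : ℝ) * |Y x| ^ (m - 1) * (|Y x| * (√|Y x| * √Λ⁻¹)) =
          m * √Λ⁻¹ * (|Y x| ^ m * √|Y x|) := by
        have : |Y x| ^ m = |Y x| ^ (m - 1) * |Y x| := by
          rw [← pow_succ]; congr 1; omega
        rw [this]; ring
      rw [hm0] at h1
      have hcM : cut R x ^ M = cut R x ^ (M - 1) * cut R x := by
        rw [← pow_succ]; congr 1; omega
      have h4 : t ^ (2 * m) * t ≤ t ^ (2 * M - 1) := by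
        rw [← pow_succ]; exact pow_le_pow_right₀ ht1 (by omega)
      calc |Y x ^ m - trunc Λ (Y x) ^ m| * (weight δ μ x * cut R x ^ M)
          ≤ (m * √Λ⁻¹ * (|Y x| ^ m * √|Y x|)) * (weight δ μ x * cut R x ^ M) := by gcongr
        _ = √Λ⁻¹ * m * ((|Y x| ^ m * cut R x ^ (M - 1)) * (√|Y x| * cut R x) * weight δ μ x) := by
            rw [hcM]; ring
        _ ≤ √Λ⁻¹ * m * (t ^ (2 * m) * t * weight δ μ x) := by gcongr
        _ ≤ √Λ⁻¹ * (M + μ + M * C) * (t ^ (2 * M - 1) * weight δ μ x) := by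
            gcongr
            linarith
    · rw [← ENNReal.ofReal_mul (by positivity), ← mul_assoc]
      refine dualNorm_le_energy hδ hμ (by omega) hq hν hR hY (by positivity) fun x => ?_
      obtain ⟨t, ht1, -, htY, htD, ht⟩ := exists_root_density hML hr (by omega) R Y x
      have hw := weight_pos δ μ x
      have hη0 := cut_nonneg R x
      have hη1 := cut_le_one R x
      rw [ht]
      have hY' := ((hY.differentiable (by simp)) x).hasFDerivAt
      have hS' := (((hasDerivAt_trunc (Λ := Λ) (Y x)).comp_hasFDerivAt x hY').pow m)
      have hρ' := ((hρ1.differentiable (by simp)) x).hasFDerivAt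
      have hg : HasFDerivAt (fun x => trunc Λ (Y x) ^ m * locWeight δ μ M R x) _ x :=
        hS'.mul hρ'
      rw [hg.fderiv]
      set S := trunc Λ (Y x) with hSd
      have hSY : |S| ≤ |Y x| := abs_trunc_le_abs _ _
      have hSΛ : |S| ≤ Λ := abs_trunc_le hΛ0 _
      have hρle := norm_fderiv_locWeight_le hδ hδ1 hμ (by omega : 1 ≤ M) (hC x)
      -- the gradient of the weight
      have e1 : ‖S ^ m • fderiv ℝ (locWeight δ μ M R) x‖ ≤
          (μ + M * C) * (t ^ (2 * M - 1) * weight δ μ x) := by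
        rw [norm_smul, norm_pow, Real.norm_eq_abs]
        have h2 := abs_pow_mul_cut_le (m := m) ht1 htY
          (by omega : m ≤ M - 1)
        have h4 : t ^ (2 * m) ≤ t ^ (2 * M - 1) := pow_le_pow_right₀ ht1 (by omega)
        calc |S| ^ m * ‖fderiv ℝ (locWeight δ μ M R) x‖
            ≤ |Y x| ^ m * ((μ + M * C) * (weight δ μ x * cut R x ^ (M - 1))) := by gcongr
          _ = (μ + M * C) * ((|Y x| ^ m * cut R x ^ (M - 1)) * weight δ μ x) := by ring
          _ ≤ _ := by gcongr; exact h2.trans h4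
      -- the gradient of the power
      obtain ⟨b, d, hbd, hbr, hdk⟩ : ∃ b d : ℕ, m - 1 = (r - 1) + b + d ∧ b + 1 ≤ L ∧ d ≤ k := by
        refine ⟨min (m - r) r, (m - r) - min (m - r) r, ?_, ?_, ?_⟩ <;> omega
      have hSm : |S| ^ (m - 1) ≤ |Y x| ^ (r - 1) * |Y x| ^ b * Λ ^ k := by
        rw [hbd, pow_add, pow_add]
        gcongr
        calc |S| ^ d ≤ Λ ^ d := by gcongr
          _ ≤ Λ ^ k := pow_le_pow_right₀ hΛ1 hdk
      have h5 := abs_pow_mul_cut_le (m := b) (j := L) ht1 htY (by omega)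
      have h6 : t ^ (2 * b) * t ^ M ≤ t ^ (2 * M - 1) := by
        rw [← pow_add]; exact pow_le_pow_right₀ ht1 (by omega)
      have hcL : cut R x ^ M = cut R x ^ L * cut R x ^ L := by rw [← pow_add, hML, two_mul]
      refine (norm_add_le _ _).trans ?_
      rw [norm_smul (locWeight δ μ M R x), Real.norm_of_nonneg (locWeight_nonneg _ _ _ _ _)]
      have e2 : locWeight δ μ M R x * ‖(m • ((trunc Λ ∘ Y) x ^ (m - 1) : ℝ)) •
          (((1 - (Y x / Λ) ^ 2) / (1 + (Y x / Λ) ^ 2) ^ 2) • fderiv ℝ Y x)‖ ≤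
          Λ ^ k * m * (t ^ (2 * M - 1) * weight δ μ x) := by
        have h7 := abs_deriv_trunc_le (Y x / Λ)
        rw [nsmul_eq_mul, norm_smul, norm_smul, norm_mul, Real.norm_natCast, norm_pow,
          Real.norm_eq_abs, Real.norm_eq_abs, Function.comp_apply, ← hSd, locWeight]
        calc weight δ μ x * cut R x ^ M * (m * |S| ^ (m - 1) *
              (|(1 - (Y x / Λ) ^ 2) / (1 + (Y x / Λ) ^ 2) ^ 2| * ‖fderiv ℝ Y x‖))
            ≤ weight δ μ x * cut R x ^ M * (m * (|Y x| ^ (r - 1) * |Y x| ^ b * Λ ^ k) *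
              (1 * ‖fderiv ℝ Y x‖)) := by gcongr
          _ = Λ ^ k * m * (((|Y x| ^ b * cut R x ^ L) *
              (‖fderiv ℝ Y x‖ * |Y x| ^ (r - 1) * cut R x ^ L)) * weight δ μ x) := by
              rw [hcL]; ring
          _ ≤ Λ ^ k * m * ((t ^ (2 * b) * t ^ M) * weight δ μ x) := by gcongr
          _ ≤ _ := by gcongr
      have hX : 0 ≤ t ^ (2 * M - 1) * weight δ μ x := by positivity
      calc _ ≤ (μ + M * C) * (t ^ (2 * M - 1) * weight δ μ x) +
            Λ ^ k * m * (t ^ (2 * M - 1) * weight δ μ x) := add_le_add e1 e2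
        _ ≤ Λ ^ k * (μ + M * C) * (t ^ (2 * M - 1) * weight δ μ x) +
            Λ ^ k * M * (t ^ (2 * M - 1) * weight δ μ x) := by
            gcongr
            exact le_mul_of_one_le_left (by positivity) (one_le_pow₀ hΛ1)
        _ = Λ ^ k * (M + μ + M * C) * (t ^ (2 * M - 1) * weight δ μ x) := by ring
        _ ≤ _ := by gcongr

/-! ### The energy estimate at a fixed time -/

/-- The inner product of two covectors of the plane. -/
noncomputable def dualInner (A B : Plane →L[ℝ] ℝ) : ℝ :=
  inner ℝ ((InnerProductSpace.toDual ℝ Plane).symm A) ((InnerProductSpace.toDual ℝ Plane).symm B)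

lemma dualInner_add_right (A B C : Plane →L[ℝ] ℝ) :
    dualInner A (B + C) = dualInner A B + dualInner A C := by
  simp only [dualInner, map_add, inner_add_right]

lemma dualInner_sub_right (A B C : Plane →L[ℝ] ℝ) :
    dualInner A (B - C) = dualInner A B - dualInner A C := by
  simp only [dualInner, map_sub, inner_sub_right]

lemma dualInner_smul_right (A B : Plane →L[ℝ] ℝ) (c : ℝ) :
    dualInner A (c • B) = c * dualInner A B := by
  simp [dualInner, inner_smul_right]

lemma dualInner_self (A : Plane →L[ℝ] ℝ) : dualInner A A = ‖A‖ ^ 2 := by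
  simp [dualInner]

lemma abs_dualInner_le (A B : Plane →L[ℝ] ℝ) : |dualInner A B| ≤ ‖A‖ * ‖B‖ := by
  have := abs_real_inner_le_norm ((InnerProductSpace.toDual ℝ Plane).symm A)
    ((InnerProductSpace.toDual ℝ Plane).symm B)
  simpa [dualInner] using this

lemma dualInner_eq_sum (A B : Plane →L[ℝ] ℝ) :
    dualInner A B = ∑ i : Fin 2, A (EuclideanSpace.basisFun (Fin 2) ℝ i) *
      B (EuclideanSpace.basisFun (Fin 2) ℝ i) := by
  rw [dualInner, ← (EuclideanSpace.basisFun (Fin 2) ℝ).sum_inner_mul_inner]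
  refine Finset.sum_congr rfl fun i _ => ?_
  rw [InnerProductSpace.toDual_symm_apply, real_inner_comm, InnerProductSpace.toDual_symm_apply]

lemma continuous_dualInner {f g : Plane → Plane →L[ℝ] ℝ} (hf : Continuous f) (hg : Continuous g) :
    Continuous fun x => dualInner (f x) (g x) := by
  unfold dualInner
  fun_prop

/-- Lower order powers are absorbed in the top order power. -/
lemma mul_pow_pred_le {B t : ℝ} (hB : 0 ≤ B) (ht : 0 ≤ t) {n : ℕ} (hn : 1 ≤ n) :
    B * t ^ (n - 1) ≤ t ^ n / 4 + B * (4 * B) ^ (n - 1) := by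
  obtain ⟨n, rfl⟩ : ∃ j, n = j + 1 := ⟨n - 1, by omega⟩
  simp only [Nat.add_sub_cancel]
  rcases le_total (4 * B) t with h | h
  · have h1 : B * t ^ n ≤ (t / 4) * t ^ n := by gcongr; linarith
    have h2 : 0 ≤ B * (4 * B) ^ n := by positivity
    rw [pow_succ]; linarith
  · have h1 : B * t ^ n ≤ B * (4 * B) ^ n := by gcongr
    have h2 : 0 ≤ t ^ (n + 1) := by positivity
    linarith

/-- Young's inequality in the form used to absorb the contribution of the noise. -/
lemma mul_rpow_le_of_conj {a E p q : ℝ} (ha : 0 ≤ a) (hE : 0 ≤ E) (hpq : p.HolderConjugate q) :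
    a * E ^ (1 / q) ≤ E / 4 + (4 * a) ^ p := by
  have hp := hpq.pos
  have hq := hpq.symm.pos
  have hsum : 1 / p + 1 / q = 1 := by simpa using hpq.one_div_add_one_div
  rcases le_total ((4 * a) ^ p) E with h | h
  · have h1 : 4 * a ≤ E ^ (1 / p) := by
      calc 4 * a = ((4 * a) ^ p) ^ (1 / p) := by
            rw [← Real.rpow_mul (by positivity), mul_one_div_cancel hp.ne', Real.rpow_one]
        _ ≤ E ^ (1 / p) := by gcongr
    have h2 : E ^ (1 / p) * E ^ (1 / q) = E := by
      rw [← Real.rpow_add_of_nonneg hE (by positivity) (by positivity), hsum, Real.rpow_one]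
    have h3 : 0 ≤ (4 * a) ^ p := by positivity
    have h4 : 4 * a * E ^ (1 / q) ≤ E ^ (1 / p) * E ^ (1 / q) := by gcongr
    linarith
  · have h1 : E ^ (1 / q) ≤ ((4 * a) ^ p) ^ (1 / q) := by gcongr
    have h2 : 4 * a * ((4 * a) ^ p) ^ (1 / q) = (4 * a) ^ p := by
      rw [← Real.rpow_mul (by positivity)]
      have : p * (1 / q) = p - 1 := by
        have h5 : 1 / q = 1 - 1 / p := by linarith
        rw [h5, mul_sub, mul_one_div_cancel hp.ne', mul_one]
      rw [this]
      rcases (by positivity : 0 ≤ 4 * a).eq_or_lt with h0 | h0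
      · rw [← h0, zero_mul, Real.zero_rpow hp.ne']
      · rw [Real.rpow_sub_one h0.ne', mul_div_cancel₀ _ h0.ne']
    have h3 : 0 ≤ a * ((4 * a) ^ p) ^ (1 / q) := by positivity
    have h4 : a * E ^ (1 / q) ≤ a * ((4 * a) ^ p) ^ (1 / q) := by gcongr
    have h5 : 0 ≤ E / 4 := by positivity
    linarith

/-- The `L ^ {2r}` quantity at level `R`. -/
noncomputable def mass (δ μ : ℝ) (r M : ℕ) (R : ℝ) (Y : Plane → ℝ) : ℝ :=
  ∫ x, Y x ^ (2 * r) * locWeight δ μ M R x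

lemma mass_nonneg (δ μ : ℝ) (r M : ℕ) (R : ℝ) (Y : Plane → ℝ) : 0 ≤ mass δ μ r M R Y :=
  integral_nonneg fun x => mul_nonneg (by rw [pow_mul]; positivity) (locWeight_nonneg _ _ _ _ _)

lemma integrable_mul_locWeight {f : Plane → ℝ} (hf : Continuous f) (δ μ : ℝ) {M : ℕ} (hM : M ≠ 0)
    {R : ℝ} (hR : 1 ≤ R) : Integrable fun x => f x * locWeight δ μ M R x :=
  (hf.mul (continuous_locWeight δ μ M R)).integrable_of_hasCompactSupport
    (hasCompactSupport_locWeight δ μ hM hR).mul_left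

/-- The coercive term of order `M` controls a superlinear power of the `L ^ {2r}` quantity, since
the weight has finite mass. -/
lemma rpow_mass_le_energy {δ μ : ℝ} (hδ : 0 < δ) (hμ : 0 < μ) {r M : ℕ} (hr : 1 ≤ r)
    (hM : 2 * r ≤ M) {R : ℝ} (hR : 1 ≤ R) {Y : Plane → ℝ} (hY : ContDiff ℝ 1 Y) {W : ℝ}
    (hW : W = ∫ x, weight δ μ x) (hW0 : 0 < W) :
    W * (mass δ μ r M R Y / (2 * W)) ^ ((M : ℝ) / (2 * r)) ≤ energy δ μ r M R Y := by
  set F := mass δ μ r M R Y with hF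
  have hF0 : 0 ≤ F := mass_nonneg _ _ _ _ _ _
  have hr0 : (0 : ℝ) < r := by exact_mod_cast hr
  have hM0 : (0 : ℝ) < M := by exact_mod_cast (by omega : 0 < M)
  have hE0 : 0 ≤ energy δ μ r M R Y := integral_nonneg fun x =>
    mul_nonneg (zero_le_one.trans (one_le_density _ _ _ _ _)) (weight_pos _ _ _).le
  rcases hF0.eq_or_lt with h0 | h0
  · rw [← h0, zero_div, Real.zero_rpow (by positivity), mul_zero]; exact hE0
  set A : ℝ := (F / (2 * W)) ^ (1 / (2 * r : ℝ)) with hA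
  have hA0 : 0 < A := by positivity
  have hAr : A ^ (2 * r) = F / (2 * W) := by
    rw [hA, ← Real.rpow_natCast, ← Real.rpow_mul (by positivity)]
    push_cast
    rw [one_div_mul_cancel (by positivity), Real.rpow_one]
  have hAM : A ^ M = (F / (2 * W)) ^ ((M : ℝ) / (2 * r)) := by
    rw [hA, ← Real.rpow_natCast, ← Real.rpow_mul (by positivity)]
    congr 1; field_simp
  have hpt : ∀ x, Y x ^ (2 * r) * locWeight δ μ M R x ≤
      A ^ (2 * r) * weight δ μ x + A ^ (2 * r) / A ^ M * (density r M R Y x * weight δ μ x) := by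
    intro x
    have hw := weight_pos δ μ x
    have hη0 := cut_nonneg R x
    have hη1 := cut_le_one R x
    have hu0 := abs_nonneg (Y x)
    have h1 : (|Y x| * cut R x) ^ M ≤ density r M R Y x := by
      have h2 : 0 ≤ ‖fderiv ℝ Y x‖ ^ 2 * |Y x| ^ (2 * r - 2) * cut R x ^ M := by positivity
      rw [density]; linarith
    have h2 : Y x ^ (2 * r) = |Y x| ^ (2 * r) := by rw [Even.pow_abs ⟨r, by ring⟩]
    rw [h2, locWeight]
    have hηM : cut R x ^ M ≤ 1 := pow_le_one₀ hη0 hη1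
    have hηM0 : 0 ≤ cut R x ^ M := by positivity
    have hd : 0 ≤ density r M R Y x := zero_le_one.trans (one_le_density _ _ _ _ _)
    rcases le_total |Y x| A with h | h
    · calc |Y x| ^ (2 * r) * (weight δ μ x * cut R x ^ M)
          ≤ A ^ (2 * r) * (weight δ μ x * 1) := by gcongr
        _ ≤ _ := by
          rw [mul_one]
          exact le_add_of_nonneg_right (by positivity)
    · have h3 : |Y x| ^ (2 * r) ≤ A ^ (2 * r) / A ^ M * |Y x| ^ M := by
        rw [div_mul_eq_mul_div, le_div_iff₀ (by positivity)]
        have e : M = 2 * r + (M - 2 * r) := by omega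
        have e' : ∀ b : ℝ, b ^ M = b ^ (2 * r) * b ^ (M - 2 * r) := fun b => by
          rw [← pow_add, ← e]
        rw [e', e']
        calc |Y x| ^ (2 * r) * (A ^ (2 * r) * A ^ (M - 2 * r))
            ≤ |Y x| ^ (2 * r) * (A ^ (2 * r) * |Y x| ^ (M - 2 * r)) := by gcongr
          _ = _ := by ring
      calc |Y x| ^ (2 * r) * (weight δ μ x * cut R x ^ M)
          ≤ A ^ (2 * r) / A ^ M * |Y x| ^ M * (weight δ μ x * cut R x ^ M) := by gcongr
        _ = A ^ (2 * r) / A ^ M * ((|Y x| * cut R x) ^ M * weight δ μ x) := by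
          rw [mul_pow]; ring
        _ ≤ A ^ (2 * r) / A ^ M * (density r M R Y x * weight δ μ x) := by gcongr
        _ ≤ _ := le_add_of_nonneg_left (by positivity)
  have hint := integral_mono (integrable_mul_locWeight (hY.continuous.pow (2 * r)) δ μ
    (by omega) hR) (((integrable_weight hδ hμ).const_mul _).add
      ((integrable_density_mul hδ hμ r (by omega) hR hY).const_mul _)) hpt
  rw [integral_add' ((integrable_weight hδ hμ).const_mul _)
      ((integrable_density_mul hδ hμ r (by omega) hR hY).const_mul _), integral_const_mul,
    integral_const_mul, ← hW] at hint
  change F ≤ A ^ (2 * r) * W + A ^ (2 * r) / A ^ M * energy δ μ r M R Y at hint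
  rw [hAr] at hint
  have h5 : F / (2 * W) * W = F / 2 := by field_simp
  rw [h5] at hint
  have h6 : F / 2 ≤ F / (2 * W) / A ^ M * energy δ μ r M R Y := by linarith
  rw [← hAM]
  have hAM0 : 0 < A ^ M := by positivity
  have h7 : F / (2 * W) / A ^ M * energy δ μ r M R Y =
      (F / 2) * (energy δ μ r M R Y / (W * A ^ M)) := by field_simp
  rw [h7] at h6
  have h8 : 1 ≤ energy δ μ r M R Y / (W * A ^ M) := by
    by_contra h
    push Not at h
    nlinarith
  rwa [one_le_div (by positivity)] at h8

/-- The test function `Y ^ {2r - 1} ρ` of the energy estimate. -/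
noncomputable def energyTest (δ μ : ℝ) (r M : ℕ) (R : ℝ) (Y : Plane → ℝ) (x : Plane) : ℝ :=
  Y x ^ (2 * r - 1) * locWeight δ μ M R x

lemma contDiff_energyTest (δ μ : ℝ) (r M : ℕ) (R : ℝ) {n : WithTop ℕ∞} (hn : n ≤ (⊤ : ℕ∞))
    {Y : Plane → ℝ} (hY : ContDiff ℝ n Y) : ContDiff ℝ n (energyTest δ μ r M R Y) :=
  (hY.pow _).mul ((contDiff_locWeight δ μ M R).of_le hn)

lemma hasCompactSupport_energyTest (δ μ : ℝ) (r : ℕ) {M : ℕ} (hM : M ≠ 0) {R : ℝ} (hR : 1 ≤ R)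
    (Y : Plane → ℝ) : HasCompactSupport (energyTest δ μ r M R Y) :=
  (hasCompactSupport_locWeight δ μ hM hR).mul_left

lemma tsupport_energyTest_subset (δ μ : ℝ) (r M : ℕ) (R : ℝ) (Y : Plane → ℝ) :
    tsupport (energyTest δ μ r M R Y) ⊆ tsupport (locWeight δ μ M R) :=
  tsupport_mul_subset_right

/-- Testing the equation with `Y ^ {2r - 1} ρ` produces the energy, up to lower order terms. -/
lemma energy_le_dissipation {δ μ : ℝ} (hδ : 0 < δ) (hδ1 : δ ≤ 1) (hμ : 0 < μ)
    {r k M L : ℕ} (hr : 1 ≤ r) (hk : 3 ≤ k) (hMk : M + 1 = 2 * r + k) (hML : M = 2 * L)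
    {R C : ℝ} (hR : 1 ≤ R) (hC0 : 0 ≤ C) (hC : ∀ x, ‖fderiv ℝ (cut R) x‖ ≤ C)
    {Y : Plane → ℝ} (hY : ContDiff ℝ 1 Y) {B : ℝ} (hB : B = μ + M * C) :
    3 / 4 * energy δ μ r M R Y - (1 + B * (4 * B) ^ (2 * M - 1)) * ∫ x, weight δ μ x ≤
      (∫ x, dualInner (fderiv ℝ Y x) (fderiv ℝ (energyTest δ μ r M R Y) x)) +
      (∫ x, Y x * energyTest δ μ r M R Y x) + ∫ x, Y x ^ k * energyTest δ μ r M R Y x := by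
  have hB0 : 0 ≤ B := by rw [hB]; positivity
  have hΦ : ContDiff ℝ 1 (energyTest δ μ r M R Y) :=
    contDiff_energyTest δ μ r M R (by exact_mod_cast (le_top : (1 : ℕ∞) ≤ ⊤)) hY
  have hΦs := hasCompactSupport_energyTest δ μ r (M := M) (by omega) hR Y
  have hDY : Continuous (fderiv ℝ Y) := hY.continuous_fderiv (by simp)
  have hi1 : Integrable fun x => dualInner (fderiv ℝ Y x)
      (fderiv ℝ (energyTest δ μ r M R Y) x) := by
    refine (continuous_dualInner hDY (hΦ.continuous_fderiv (by simp)))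
      |>.integrable_of_hasCompactSupport ?_
    refine (hΦs.fderiv ℝ).mono fun x hx h0 => hx ?_
    have h0' : fderiv ℝ (energyTest δ μ r M R Y) x = 0 := h0
    change dualInner _ _ = 0
    rw [h0']; simp [dualInner]
  have hi2 : Integrable fun x => Y x * energyTest δ μ r M R Y x :=
    (hY.continuous.mul hΦ.continuous).integrable_of_hasCompactSupport hΦs.mul_left
  have hi3 : Integrable fun x => Y x ^ k * energyTest δ μ r M R Y x :=
    ((hY.continuous.pow k).mul hΦ.continuous).integrable_of_hasCompactSupport hΦs.mul_left
  have hi12 : Integrable fun x => dualInner (fderiv ℝ Y x)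
      (fderiv ℝ (energyTest δ μ r M R Y) x) + Y x * energyTest δ μ r M R Y x := hi1.add hi2
  have hid := integrable_density_mul hδ hμ r (M := M) (by omega) hR hY
  rw [energy, ← integral_const_mul, ← integral_const_mul, ← integral_sub (hid.const_mul _)
    ((integrable_weight hδ hμ).const_mul _), ← integral_add hi1 hi2, ← integral_add hi12 hi3]
  refine integral_mono ((hid.const_mul _).sub ((integrable_weight hδ hμ).const_mul _))
    (hi12.add hi3) fun x => ?_
  obtain ⟨t, ht1, ht2M, htY, htD, -⟩ := exists_root_density hML hr (by omega) R Y x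
  have hw := weight_pos δ μ x
  have hη0 := cut_nonneg R x
  have hρ0 := locWeight_nonneg δ μ M R x
  have hDρ := norm_fderiv_locWeight_le hδ hδ1 hμ (by omega : 1 ≤ M) (hC x)
  have hY' := ((hY.differentiable (by simp)) x).hasFDerivAt
  have hρ' := (((contDiff_locWeight δ μ M R).differentiable (by simp)) x).hasFDerivAt
  have hΦ' : HasFDerivAt (energyTest δ μ r M R Y) _ x := (hY'.pow (2 * r - 1)).mul hρ'
  have hev : Y x ^ (2 * r - 2) = |Y x| ^ (2 * r - 2) := by
    rw [Even.pow_abs ⟨r - 1, by omega⟩]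
  have hevM : Y x ^ M = |Y x| ^ M := by rw [Even.pow_abs ⟨L, by omega⟩]
  have hd : density r M R Y x * weight δ μ x = weight δ μ x + |Y x| ^ M * locWeight δ μ M R x +
      ‖fderiv ℝ Y x‖ ^ 2 * |Y x| ^ (2 * r - 2) * locWeight δ μ M R x := by
    rw [density, locWeight, mul_pow]; ring
  -- the gradient term
  have hgrad : dualInner (fderiv ℝ Y x) (fderiv ℝ (energyTest δ μ r M R Y) x) ≥
      ‖fderiv ℝ Y x‖ ^ 2 * |Y x| ^ (2 * r - 2) * locWeight δ μ M R x -
      B * t ^ (2 * M - 1) * weight δ μ x := by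
    have e1 : 2 * r - 1 - 1 = 2 * r - 2 := by omega
    rw [hΦ'.fderiv, dualInner_add_right, dualInner_smul_right, dualInner_smul_right,
      ← Nat.cast_smul_eq_nsmul ℝ, smul_eq_mul, dualInner_smul_right, dualInner_self, e1, hev]
    have h1 := abs_dualInner_le (fderiv ℝ Y x) (fderiv ℝ (locWeight δ μ M R) x)
    have h2 : |Y x ^ (2 * r - 1) * dualInner (fderiv ℝ Y x) (fderiv ℝ (locWeight δ μ M R) x)| ≤
        B * t ^ (2 * M - 1) * weight δ μ x := by
      rw [abs_mul, abs_pow]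
      have h3 := abs_pow_mul_cut_le (m := r) (j := L - 1) ht1 htY (by omega)
      have h4 : t ^ (2 * r) * t ^ M ≤ t ^ (2 * M - 1) := by
        rw [← pow_add]; exact pow_le_pow_right₀ ht1 (by omega)
      have e2 : |Y x| ^ (2 * r - 1) = |Y x| ^ r * |Y x| ^ (r - 1) := by
        rw [← pow_add]; congr 1; omega
      have e3 : cut R x ^ (M - 1) = cut R x ^ (L - 1) * cut R x ^ L := by
        rw [← pow_add]; congr 1; omega
      calc |Y x| ^ (2 * r - 1) * |dualInner (fderiv ℝ Y x) (fderiv ℝ (locWeight δ μ M R) x)|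
          ≤ |Y x| ^ (2 * r - 1) * (‖fderiv ℝ Y x‖ *
            ((μ + M * C) * (weight δ μ x * cut R x ^ (M - 1)))) := by
            gcongr
            exact h1.trans (by gcongr)
        _ = B * ((|Y x| ^ r * cut R x ^ (L - 1)) *
            (‖fderiv ℝ Y x‖ * |Y x| ^ (r - 1) * cut R x ^ L)) * weight δ μ x := by
            rw [← hB, e2, e3]; ring
        _ ≤ B * (t ^ (2 * r) * t ^ M) * weight δ μ x := by gcongr
        _ ≤ _ := by gcongr
    have h5 := (abs_le.1 h2).1
    have h6 : (1 : ℝ) ≤ ((2 * r - 1 : ℕ) : ℝ) := by exact_mod_cast (by omega : 1 ≤ 2 * r - 1)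
    have h7 : 0 ≤ ‖fderiv ℝ Y x‖ ^ 2 * |Y x| ^ (2 * r - 2) * locWeight δ μ M R x := by positivity
    have h8 : locWeight δ μ M R x * (((2 * r - 1 : ℕ) : ℝ) * |Y x| ^ (2 * r - 2) *
        ‖fderiv ℝ Y x‖ ^ 2) = ((2 * r - 1 : ℕ) : ℝ) *
        (‖fderiv ℝ Y x‖ ^ 2 * |Y x| ^ (2 * r - 2) * locWeight δ μ M R x) := by ring
    nlinarith
  have hyoung := mul_pow_pred_le hB0 (by linarith : 0 ≤ t) (by omega : 1 ≤ 2 * M)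
  have hmid : 0 ≤ Y x * energyTest δ μ r M R Y x := by
    have : Y x * energyTest δ μ r M R Y x = (Y x ^ r) ^ 2 * locWeight δ μ M R x := by
      rw [energyTest, ← mul_assoc, ← pow_succ', ← pow_mul]
      congr 2; omega
    rw [this]; positivity
  have htop : Y x ^ k * energyTest δ μ r M R Y x = |Y x| ^ M * locWeight δ μ M R x := by
    rw [energyTest, ← mul_assoc, ← pow_add, ← hevM]
    congr 2; omega
  rw [htop]
  rw [ht2M] at hyoung
  have hy2 : B * t ^ (2 * M - 1) * weight δ μ x ≤ density r M R Y x * weight δ μ x / 4 +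
      B * (4 * B) ^ (2 * M - 1) * weight δ μ x := by
    have := mul_le_mul_of_nonneg_right hyoung hw.le
    linarith
  change 3 / 4 * (density r M R Y x * weight δ μ x) -
    (1 + B * (4 * B) ^ (2 * M - 1)) * weight δ μ x ≤ _
  linarith

/-- The energy estimate at a fixed time: the last term on the left bounds the contribution of a
noise of size `β`, and `c`, `K` depend neither on the level `R` nor on the noise. -/
theorem exists_energy_estimate {δ μ : ℝ} (hδ : 0 < δ) (hδ1 : δ ≤ 1) (hμ : 0 < μ)
    {r k M L : ℕ} (hr : 1 ≤ r) (hk : 3 ≤ k) (hMk : M + 1 = 2 * r + k) (hML : M = 2 * L)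
    {p q : ℝ} (hpq : p.HolderConjugate q) {C a : ℝ} (hC0 : 0 ≤ C) (ha : 0 ≤ a) :
    ∃ c K : ℝ, 0 < c ∧ 0 < K ∧ ∀ R : ℝ, 1 ≤ R → (∀ x, ‖fderiv ℝ (cut R) x‖ ≤ C) →
      ∀ Y : Plane → ℝ, ContDiff ℝ 1 Y → ∀ β : ℝ, 0 ≤ β →
      -(∫ x, dualInner (fderiv ℝ Y x) (fderiv ℝ (energyTest δ μ r M R Y) x)) -
        (∫ x, Y x * energyTest δ μ r M R Y x) - (∫ x, Y x ^ k * energyTest δ μ r M R Y x) +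
        β * (a * energy δ μ r M R Y ^ (1 / q)) ≤
      -(c * mass δ μ r M R Y ^ ((M : ℝ) / (2 * r))) + K * (1 + β ^ p) := by
  set W : ℝ := ∫ x, weight δ μ x with hW
  have hW0 : 0 < W := by
    rw [hW, integral_pos_iff_support_of_nonneg (fun x => (weight_pos δ μ x).le)
      (integrable_weight hδ hμ)]
    have : Function.support (weight δ μ) = Set.univ :=
      Set.eq_univ_of_forall fun x => (weight_pos δ μ x).ne'
    rw [this]
    exact (isOpen_univ.measure_pos volume Set.univ_nonempty)
  set B : ℝ := μ + M * C with hB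
  have hB0 : 0 < B := by positivity
  have hp := hpq.pos
  refine ⟨1 / 2 * (W * (1 / (2 * W)) ^ ((M : ℝ) / (2 * r))),
    (1 + B * (4 * B) ^ (2 * M - 1)) * W + (4 * a) ^ p, by positivity, by positivity,
    fun R hR hC Y hY β hβ => ?_⟩
  have h1 := energy_le_dissipation hδ hδ1 hμ hr hk hMk hML hR hC0 hC hY hB
  have h2 := rpow_mass_le_energy hδ hμ hr (by omega : 2 * r ≤ M) hR hY hW hW0
  have hE0 : 0 ≤ energy δ μ r M R Y := integral_nonneg fun x =>
    mul_nonneg (zero_le_one.trans (one_le_density _ _ _ _ _)) (weight_pos _ _ _).le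
  have h3 := mul_rpow_le_of_conj (mul_nonneg hβ ha) hE0 hpq
  have h4 : mass δ μ r M R Y / (2 * W) = 1 / (2 * W) * mass δ μ r M R Y := by ring
  rw [h4, Real.mul_rpow (by positivity) (mass_nonneg _ _ _ _ _ _)] at h2
  have h5 : (4 * (β * a)) ^ p = (4 * a) ^ p * β ^ p := by
    rw [← Real.mul_rpow (by positivity) hβ]; congr 1; ring
  rw [h5] at h3
  have h6 : 0 ≤ β ^ p := by positivity
  have h7 : 0 ≤ (1 + B * (4 * B) ^ (2 * M - 1)) * W := by positivity
  have h8 : 0 ≤ (4 * a) ^ p := by positivity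
  have h9 : 0 ≤ (1 + B * (4 * B) ^ (2 * M - 1)) * W * β ^ p := by positivity
  linarith

/-! ### The equation as a flow of functionals -/

lemma integral_mul_laplacian {Y : Plane → ℝ} (hY : ContDiff ℝ 1 Y) (φ : TestFun) :
    ∫ x, Y x * Δ (φ : Plane → ℝ) x = -∫ x, dualInner (fderiv ℝ Y x) (fderiv ℝ φ x) := by
  have hφ : ContDiff ℝ 2 φ := φ.contDiff.of_le
    (WithTop.coe_le_coe.2 (le_top : (2 : ℕ∞) ≤ ⊤))
  have hDφ : ContDiff ℝ 1 (fderiv ℝ φ) := hφ.fderiv_right (by norm_num)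
  have hDY : Continuous (fderiv ℝ Y) := hY.continuous_fderiv (by simp)
  have hs : HasCompactSupport (fderiv ℝ φ) := φ.hasCompactSupport.fderiv ℝ
  set e : Fin 2 → Plane := fun i => EuclideanSpace.basisFun (Fin 2) ℝ i with he
  have hgi : ∀ i, ContDiff ℝ 1 fun x => fderiv ℝ φ x (e i) := fun i =>
    hDφ.clm_apply contDiff_const
  have hgs : ∀ i, HasCompactSupport fun x => fderiv ℝ φ x (e i) := fun i =>
    hs.comp_left (g := fun A : Plane →L[ℝ] ℝ => A (e i)) (by simp)
  have hg' : ∀ i, Continuous fun x => fderiv ℝ (fun y => fderiv ℝ φ y (e i)) x (e i) := fun i =>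
    ((hgi i).continuous_fderiv (by simp)).clm_apply continuous_const
  have hgs' : ∀ i, HasCompactSupport fun x => fderiv ℝ (fun y => fderiv ℝ φ y (e i)) x (e i) :=
    fun i => ((hgs i).fderiv ℝ).comp_left (g := fun A : Plane →L[ℝ] ℝ => A (e i)) (by simp)
  have hlap : ∀ x, Δ (φ : Plane → ℝ) x =
      ∑ i, fderiv ℝ (fun y => fderiv ℝ φ y (e i)) x (e i) := by
    intro x
    rw [InnerProductSpace.laplacian_eq_iteratedFDeriv_orthonormalBasis _
      (EuclideanSpace.basisFun (Fin 2) ℝ)]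
    refine Finset.sum_congr rfl fun i _ => ?_
    rw [iteratedFDeriv_two_apply]
    have h1 := ((hDφ.differentiable (by simp)) x).hasFDerivAt.clm_apply
      (hasFDerivAt_const (e i) x)
    have h2 : HasFDerivAt (fun y => fderiv ℝ φ y (e i)) _ x := h1
    rw [h2.fderiv]
    simp [he]
  have hi1 : ∀ i, Integrable fun x => Y x * fderiv ℝ (fun y => fderiv ℝ φ y (e i)) x (e i) :=
    fun i => (hY.continuous.mul (hg' i)).integrable_of_hasCompactSupport (hgs' i).mul_left
  have hi2 : ∀ i, Integrable fun x => fderiv ℝ Y x (e i) * fderiv ℝ φ x (e i) := fun i =>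
    ((hDY.clm_apply continuous_const).mul (hgi i).continuous).integrable_of_hasCompactSupport
      (hgs i).mul_left
  have hi3 : ∀ i, Integrable fun x => Y x * fderiv ℝ φ x (e i) := fun i =>
    (hY.continuous.mul (hgi i).continuous).integrable_of_hasCompactSupport (hgs i).mul_left
  simp_rw [hlap, Finset.mul_sum, dualInner_eq_sum]
  rw [integral_finsetSum _ fun i _ => hi1 i, integral_finsetSum _ fun i _ => hi2 i,
    ← Finset.sum_neg_distrib]
  refine Finset.sum_congr rfl fun i _ => ?_
  exact integral_mul_fderiv_eq_neg_fderiv_mul_of_integrable (hi2 i) (hi1 i) (hi3 i)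
    (fun x _ => (hY.differentiable (by simp)) x)
    (fun x _ => ((hgi i).differentiable (by simp)) x)

/-- `f` and `g` are `e`-close in `C¹`. -/
def C1Close (f g : Plane → ℝ) (e : ℝ) : Prop :=
  ∀ x, |f x - g x| ≤ e ∧ ‖fderiv ℝ f x - fderiv ℝ g x‖ ≤ e

/-- A weak evolution `d/dτ ∫ Y φ = G(φ)` on `[s, t]` with locally bounded `C¹` data, where the
functionals `G τ` are Lipschitz in the `C¹` norm on test functions supported in a given compact
set, uniformly in time. -/
structure RegularFlow (s t : ℝ) (Y : ℝ → Plane → ℝ) (G : ℝ → TestFun → ℝ) : Prop where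
  contDiff : ∀ τ ∈ Set.Icc s t, ContDiff ℝ 1 (Y τ)
  bounded : ∀ K : Set Plane, IsCompact K → ∃ D : ℝ, 1 ≤ D ∧ ∀ τ ∈ Set.Icc s t, ∀ x ∈ K,
    |Y τ x| ≤ D ∧ ‖fderiv ℝ (Y τ) x‖ ≤ D
  equation : ∀ φ : TestFun, ∀ a b, s ≤ a → a ≤ b → b ≤ t →
    IntervalIntegrable (fun τ => G τ φ) volume a b ∧
      (∫ x, Y b x * φ x) - ∫ x, Y a x * φ x = ∫ τ in a..b, G τ φ
  lipschitz : ∀ K : Set Plane, IsCompact K → ∃ C : ℝ, 0 ≤ C ∧ ∀ τ ∈ Set.Icc s t,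
    ∀ φ φ' : TestFun, tsupport φ ⊆ K → tsupport φ' ⊆ K → ∀ e : ℝ, 0 < e → C1Close φ φ' e →
      |G τ φ - G τ φ'| ≤ C * e

/-- The right-hand side of the equation, tested with `φ`: `Y` is the solution at the given time and
`N ℓ φ` stands for the product of `Y ^ (k - ℓ)` with the noise. -/
noncomputable def flowFunctional (k : ℕ) (Y : Plane → ℝ) (N : ℕ → TestFun → ℝ) (φ : TestFun) : ℝ :=
  -(∫ x, dualInner (fderiv ℝ Y x) (fderiv ℝ φ x)) - (∫ x, Y x * φ x) -
    ∑ ℓ ∈ Finset.range (k + 1), N ℓ φ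

lemma integral_mul_laplacian_sub {Y : Plane → ℝ} (hY : ContDiff ℝ 1 Y) (φ : TestFun) :
    ∫ x, Y x * (Δ (φ : Plane → ℝ) x - φ x) =
      -(∫ x, dualInner (fderiv ℝ Y x) (fderiv ℝ φ x)) - ∫ x, Y x * φ x := by
  have hi : Integrable fun x => Y x * φ x :=
    (hY.continuous.mul φ.continuous).integrable_of_hasCompactSupport φ.hasCompactSupport.mul_left
  have hΔ : Integrable fun x => Y x * Δ (φ : Plane → ℝ) x := by
    have hφ : ContDiff ℝ ∞ φ := φ.contDiff
    have h2 : Continuous fun x => iteratedFDeriv ℝ 2 φ x :=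
      hφ.continuous_iteratedFDeriv (WithTop.coe_le_coe.2 (le_top : (2 : ℕ∞) ≤ ⊤))
    have h3 : HasCompactSupport (iteratedFDeriv ℝ 2 φ) := φ.hasCompactSupport.iteratedFDeriv 2
    have h4 : (Δ (φ : Plane → ℝ)) = fun x => ∑ i, iteratedFDeriv ℝ 2 φ x
        ![EuclideanSpace.basisFun (Fin 2) ℝ i, EuclideanSpace.basisFun (Fin 2) ℝ i] :=
      InnerProductSpace.laplacian_eq_iteratedFDeriv_orthonormalBasis _
        (EuclideanSpace.basisFun (Fin 2) ℝ)
    have h5 : Continuous (Δ (φ : Plane → ℝ)) := by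
      rw [h4]
      fun_prop
    refine (hY.continuous.mul h5).integrable_of_hasCompactSupport (HasCompactSupport.mul_left ?_)
    refine h3.mono fun x hx h0 => hx ?_
    have h0' : iteratedFDeriv ℝ 2 φ x = 0 := h0
    rw [h4]
    simp [h0']
  simp_rw [mul_sub]
  rw [integral_sub hΔ hi, integral_mul_laplacian hY]

lemma abs_integral_le_of_compact {f : Plane → ℝ} {K : Set Plane} (hK : IsCompact K) {b : ℝ}
    (hb : ∀ x ∈ K, |f x| ≤ b) (hz : ∀ x ∉ K, f x = 0) :
    |∫ x, f x| ≤ b * (volume K).toReal := by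
  rw [← setIntegral_eq_integral_of_forall_compl_eq_zero hz]
  exact norm_setIntegral_le_of_norm_le_const (f := f) hK.measure_lt_top hb

lemma norm_fderiv_pow_mul_le {Y g : Plane → ℝ} {x : Plane} (hY : DifferentiableAt ℝ Y x)
    (hg : DifferentiableAt ℝ g x) {D e : ℝ} (hD : 1 ≤ D) (he : 0 ≤ e) (hY0 : |Y x| ≤ D)
    (hY1 : ‖fderiv ℝ Y x‖ ≤ D) (hg0 : |g x| ≤ e) (hg1 : ‖fderiv ℝ g x‖ ≤ e) {j k : ℕ}
    (hj : j ≤ k) :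
    |Y x ^ j * g x| ≤ (k + 1) * D ^ k * e ∧
      ‖fderiv ℝ (fun y => Y y ^ j * g y) x‖ ≤ (k + 1) * D ^ k * e := by
  have hk0 : (0 : ℝ) ≤ k := k.cast_nonneg
  have hjk : (j : ℝ) ≤ k := by exact_mod_cast hj
  have hDk : 0 < D ^ k := by positivity
  have hYj : |Y x| ^ j ≤ D ^ k := by
    calc |Y x| ^ j ≤ D ^ j := by gcongr
      _ ≤ D ^ k := pow_le_pow_right₀ hD hj
  constructor
  · rw [abs_mul, abs_pow]
    calc |Y x| ^ j * |g x| ≤ D ^ k * e := by gcongr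
      _ ≤ _ := by
        have : 0 ≤ D ^ k * e := by positivity
        nlinarith
  · have h : HasFDerivAt (fun y => Y y ^ j * g y) _ x := (hY.hasFDerivAt.pow j).mul hg.hasFDerivAt
    rw [h.fderiv]
    refine (norm_add_le _ _).trans ?_
    rw [← Nat.cast_smul_eq_nsmul ℝ, norm_smul, norm_smul, norm_smul, norm_smul, Real.norm_natCast,
      norm_pow, norm_pow, Real.norm_eq_abs, Real.norm_eq_abs]
    have h1 : |g x| * (j * |Y x| ^ (j - 1) * ‖fderiv ℝ Y x‖) ≤ e * (k * D ^ k) := by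
      rcases Nat.eq_zero_or_pos j with h0 | h0
      · subst h0
        simp only [Nat.cast_zero, zero_mul, mul_zero]; positivity
      · have h2 : |Y x| ^ (j - 1) * ‖fderiv ℝ Y x‖ ≤ D ^ k := by
          calc |Y x| ^ (j - 1) * ‖fderiv ℝ Y x‖ ≤ D ^ (j - 1) * D := by gcongr
            _ = D ^ j := by rw [← pow_succ]; congr 1; omega
            _ ≤ D ^ k := pow_le_pow_right₀ hD hj
        rw [mul_assoc]
        gcongr
    have h3 : |Y x| ^ j * ‖fderiv ℝ g x‖ ≤ D ^ k * e := by gcongr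
    nlinarith

/-- Multiplication by powers of bounded `C¹` functions preserves the regularity of `C¹` functions
with support in a compact set. -/
lemma exists_interpolationBound_pow_mul {δ q : ℝ} (hq : 0 < q) (ν : ℝ) {ε : ℝ} (hε2 : ε ≤ 1 / 2)
    (k : ℕ) {K : Set Plane} (hK : IsCompact K) :
    ∃ B : ℝ≥0, ∀ (Y g : Plane → ℝ) (D e : ℝ), ContDiff ℝ 1 Y → ContDiff ℝ 1 g → 1 ≤ D →
      (∀ x ∈ K, |Y x| ≤ D ∧ ‖fderiv ℝ Y x‖ ≤ D) → tsupport g ⊆ K → 0 ≤ e →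
      (∀ x, |g x| ≤ e ∧ ‖fderiv ℝ g x‖ ≤ e) → ∀ j ≤ k,
      InterpolationBound δ q ν ε (fun x => Y x ^ j * g x)
        (B * ENNReal.ofReal ((k + 1) * D ^ k * e)) := by
  obtain ⟨B, hB⟩ := exists_interpolationBound_of_compact (δ := δ) hq ν hε2 hK
  refine ⟨B, fun Y g D e hY hg hD hYD hgK he hge j hj => ?_⟩
  have hP : ContDiff ℝ 1 fun x => Y x ^ j * g x := (hY.pow j).mul hg
  have hs : tsupport (fun x => Y x ^ j * g x) ⊆ K := tsupport_mul_subset_right.trans hgK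
  have hb : 0 ≤ ((k : ℝ) + 1) * D ^ k * e := by positivity
  have hz : ∀ x ∉ K, (Y x ^ j * g x) = 0 := fun x hx => by
    have : g x = 0 := by
      by_contra h0
      exact hx (hgK (subset_tsupport _ h0))
    simp [this]
  have hz' : ∀ x ∉ K, fderiv ℝ (fun x => Y x ^ j * g x) x = 0 := fun x hx => by
    by_contra h0
    exact hx (hs (support_fderiv_subset ℝ h0))
  have key : ∀ x ∈ K, _ := fun x hx => norm_fderiv_pow_mul_le ((hY.differentiable (by simp)) x)
    ((hg.differentiable (by simp)) x) hD he (hYD x hx).1 (hYD x hx).2 (hge x).1 (hge x).2 hj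
  refine hB _ hP hs _ (fun x => ?_) fun x => ?_
  · by_cases hx : x ∈ K
    · exact (key x hx).1
    · rw [hz x hx, abs_zero]; exact hb
  · by_cases hx : x ∈ K
    · exact (key x hx).2
    · rw [hz' x hx, norm_zero]; exact hb

lemma TestFun.contDiff_one (φ : TestFun) : ContDiff ℝ 1 φ :=
  φ.contDiff.of_le (by exact_mod_cast le_top)

lemma abs_integral_dualInner_sub_le {Y φ ψ : Plane → ℝ} (hY : ContDiff ℝ 1 Y)
    (hφ : ContDiff ℝ 1 φ) (hψ : ContDiff ℝ 1 ψ) {K : Set Plane} (hK : IsCompact K)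
    (hφK : tsupport φ ⊆ K) (hψK : tsupport ψ ⊆ K) {D e : ℝ}
    (hD : ∀ x ∈ K, ‖fderiv ℝ Y x‖ ≤ D) (he : C1Close φ ψ e) :
    |(∫ x, dualInner (fderiv ℝ Y x) (fderiv ℝ φ x)) -
      ∫ x, dualInner (fderiv ℝ Y x) (fderiv ℝ ψ x)| ≤ D * e * (volume K).toReal := by
  have hDY : Continuous (fderiv ℝ Y) := hY.continuous_fderiv (by simp)
  have hi : ∀ {f : Plane → ℝ}, ContDiff ℝ 1 f → tsupport f ⊆ K →
      Integrable fun x => dualInner (fderiv ℝ Y x) (fderiv ℝ f x) := fun {f} hf hfK => by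
    refine (continuous_dualInner hDY (hf.continuous_fderiv (by simp)))
      |>.integrable_of_hasCompactSupport ?_
    have hfs : HasCompactSupport f := HasCompactSupport.of_support_subset_isCompact hK
      ((subset_tsupport _).trans hfK)
    refine (hfs.fderiv ℝ).mono fun x hx h0 => hx ?_
    have h0' : fderiv ℝ f x = 0 := h0
    change dualInner _ _ = 0
    rw [h0']; simp [dualInner]
  rw [← integral_sub (hi hφ hφK) (hi hψ hψK)]
  simp_rw [← dualInner_sub_right]
  refine abs_integral_le_of_compact hK (fun x hx => ?_) fun x hx => ?_
  · exact (abs_dualInner_le _ _).trans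
      (mul_le_mul (hD x hx) (he x).2 (norm_nonneg _) ((norm_nonneg _).trans (hD x hx)))
  · have h : ∀ {f : Plane → ℝ}, tsupport f ⊆ K → fderiv ℝ f x = 0 := fun {f} hfK => by
      by_contra h0
      exact hx (hfK (support_fderiv_subset ℝ h0))
    rw [h hφK, h hψK]; simp [dualInner]

lemma abs_integral_mul_sub_le {f φ ψ : Plane → ℝ} (hf : Continuous f)
    (hφ : Continuous φ) (hψ : Continuous ψ) {K : Set Plane} (hK : IsCompact K)
    (hφK : tsupport φ ⊆ K) (hψK : tsupport ψ ⊆ K) {D e : ℝ}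
    (hD : ∀ x ∈ K, |f x| ≤ D) (he : ∀ x, |φ x - ψ x| ≤ e) :
    |(∫ x, f x * φ x) - ∫ x, f x * ψ x| ≤ D * e * (volume K).toReal := by
  have hi : ∀ {g : Plane → ℝ}, Continuous g → tsupport g ⊆ K →
      Integrable fun x => f x * g x := fun {g} hg hgK =>
    (hf.mul hg).integrable_of_hasCompactSupport
      (HasCompactSupport.of_support_subset_isCompact hK ((subset_tsupport _).trans hgK)).mul_left
  rw [← integral_sub (hi hφ hφK) (hi hψ hψK)]
  simp_rw [← mul_sub]
  refine abs_integral_le_of_compact hK (fun x hx => ?_) fun x hx => ?_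
  · rw [abs_mul]
    exact mul_le_mul (hD x hx) (he x) (abs_nonneg _) ((abs_nonneg _).trans (hD x hx))
  · have h : ∀ {f : Plane → ℝ}, tsupport f ⊆ K → f x = 0 := fun {f} hfK => by
      by_contra h0
      exact hx (hfK (subset_tsupport _ h0))
    rw [h hφK, h hψK]; simp

/-- The distribution `1` acts on `C¹` functions by integration. -/
lemma HasC1Value.eq_integral {Z : Distr} {h : Plane → ℝ} {c : ℝ} (hZ : HasC1Value Z h c)
    (hZ1 : ∀ φ : TestFun, Z φ = ∫ x, φ x) (hh : ContDiff ℝ 1 h) (hs : HasCompactSupport h) :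
    c = ∫ x, h x := by
  obtain ⟨ψ, hψs, hψ, hψZ⟩ := hZ.exists_tendsto hh hs
  have hK : IsCompact (Metric.cthickening 1 (tsupport h)) := hs.isCompact.cthickening
  refine tendsto_nhds_unique hψZ ?_
  rw [Metric.tendsto_atTop]
  intro e he
  set V := (volume (Metric.cthickening 1 (tsupport h))).toReal with hV
  have hV0 : 0 ≤ V := ENNReal.toReal_nonneg
  obtain ⟨N, hN⟩ := eventually_atTop.1 (hψ (e / (2 * (V + 1))) (by positivity))
  refine ⟨N, fun n hn => ?_⟩
  have h1 := abs_integral_mul_sub_le (f := fun _ => (1 : ℝ)) (D := 1) continuous_const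
    (ψ n).continuous hh.continuous hK (hψs n) (Metric.self_subset_cthickening _)
    (fun x _ => by simp) (fun x => (hN n hn x).1)
  simp only [one_mul] at h1
  rw [Real.dist_eq, hZ1]
  refine h1.trans_lt ?_
  rw [← hV, div_mul_eq_mul_div, div_lt_iff₀ (by positivity)]
  nlinarith

lemma InterpolationBound.pairing_le {χ₀ χ₁ : Plane → ℝ} {δ p q μ ε : ℝ} {A : ℝ≥0}
    (hD : DualityBound χ₀ χ₁ δ p q μ ε A) {h : Plane → ℝ} {B : ℝ≥0} {b X : ℝ}
    (hh : InterpolationBound δ q (μ / p) ε h (B * ENNReal.ofReal b))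
    (hX : A * B * b ≤ X) (φ : TestFun) :
    ‖∫ x, φ x * h x‖ₑ ≤ besovTestNorm χ₀ χ₁ δ (-ε) μ p p φ * ENNReal.ofReal X := by
  refine (hD h _ hh φ).trans ?_
  calc (A : ℝ≥0∞) * besovTestNorm χ₀ χ₁ δ (-ε) μ p p φ * (B * ENNReal.ofReal b)
      = besovTestNorm χ₀ χ₁ δ (-ε) μ p p φ * (A * B * ENNReal.ofReal b) := by ring
    _ ≤ _ := by
      gcongr
      rw [← ENNReal.ofReal_coe_nnreal, ← ENNReal.ofReal_coe_nnreal,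
        ← ENNReal.ofReal_mul (by positivity), ← ENNReal.ofReal_mul (by positivity)]
      exact ENNReal.ofReal_le_ofReal hX

lemma IsSolution.exists_bound {δ : ℝ} {k : ℕ} {T : ℝ} {X₀ : Distr} {Z : ℕ → ℝ → Distr}
    {Y : ℝ → Plane → ℝ} (hsol : IsSolution δ k T X₀ Z Y) {s t : ℝ} (hs : 0 < s) (hst : s ≤ t)
    (ht : t ≤ T) {K : Set Plane} (hK : IsCompact K) :
    ∃ D : ℝ, 1 ≤ D ∧ ∀ τ ∈ Set.Icc s t, ∀ x ∈ K, |Y τ x| ≤ D ∧ ‖fderiv ℝ (Y τ) x‖ ≤ D := by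
  obtain ⟨a, M, hM⟩ := hsol.growth s hs (hst.trans ht)
  have hc : Continuous fun x => M * weight δ (-a) x := (continuous_weight δ (-a)).const_mul M
  obtain ⟨C, hC⟩ := hK.exists_bound_of_continuousOn hc.continuousOn
  refine ⟨max 1 C, le_max_left _ _, fun τ hτ x hx => ?_⟩
  have h1 := hM τ hτ.1 (hτ.2.trans ht) x
  have h2 := (le_abs_self _).trans (hC x hx)
  rw [weight, neg_neg] at h2
  have h3 := abs_nonneg (Y τ x)
  have h4 := norm_nonneg (fderiv ℝ (Y τ) x)
  constructor <;> refine le_max_of_le_right ?_ <;> linarith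

/-- A solution of the equation with noise bounded in the Besov norm is a regular flow. -/
theorem IsSolution.regularFlow {χ₀ χ₁ : Plane → ℝ} {δ p q μ ε : ℝ} {A : ℝ≥0}
    (hD : DualityBound χ₀ χ₁ δ p q μ ε A) (hq : 0 < q) (hε2 : ε ≤ 1 / 2) {δ' : ℝ} {k : ℕ}
    {T : ℝ} {X₀ : Distr} {Z : ℕ → ℝ → Distr} {Y : ℝ → Plane → ℝ}
    (hsol : IsSolution δ' k T X₀ Z Y) {N : ℕ → ℝ → TestFun → ℝ}
    (hN : ∀ ℓ ≤ k, ∀ t, 0 < t → t ≤ T → ∀ φ : TestFun,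
      HasC1Value (Z ℓ t) (fun x => Y t x ^ (k - ℓ) * φ x) (N ℓ t φ))
    (heq : ∀ φ : TestFun, ∀ s t, 0 < s → s ≤ t → t ≤ T →
      IntervalIntegrable (fun r => ∫ x, Y r x * (Δ (φ : Plane → ℝ) x - φ x)) volume s t ∧
      (∀ ℓ ≤ k, IntervalIntegrable (fun r => N ℓ r φ) volume s t) ∧
      (∫ x, Y t x * φ x) - ∫ x, Y s x * φ x =
        ∫ r in s..t, ((∫ x, Y r x * (Δ (φ : Plane → ℝ) x - φ x))
          - ∑ ℓ ∈ Finset.range (k + 1), N ℓ r φ))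
    {s t β : ℝ} (hs : 0 < s) (hst : s ≤ t) (ht : t ≤ T) (hβ0 : 0 ≤ β)
    (hβ : ∀ τ, 0 < τ → τ ≤ t → ∀ ℓ ≤ k,
      besovNorm χ₀ χ₁ δ (-ε) μ p p (Z ℓ τ) ≤ ENNReal.ofReal β) :
    RegularFlow s t Y (fun τ => flowFunctional k (Y τ) (fun ℓ => N ℓ τ)) := by
  have hC1 : ∀ τ ∈ Set.Icc s t, ContDiff ℝ 1 (Y τ) := fun τ hτ =>
    hsol.contDiff τ (hs.trans_le hτ.1) (hτ.2.trans ht)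
  refine ⟨hC1, fun K hK => hsol.exists_bound hs hst ht hK, fun φ a b hsa hab hbt => ?_,
    fun K hK => ?_⟩
  · obtain ⟨h1, h2, h3⟩ := heq φ a b (hs.trans_le hsa) hab (hbt.trans ht)
    have hcongr : ∀ τ ∈ Set.uIcc a b, ((∫ x, Y τ x * (Δ (φ : Plane → ℝ) x - φ x))
        - ∑ ℓ ∈ Finset.range (k + 1), N ℓ τ φ) = flowFunctional k (Y τ) (fun ℓ => N ℓ τ) φ := by
      intro τ hτ
      rw [Set.uIcc_of_le hab] at hτ
      rw [integral_mul_laplacian_sub (hC1 τ ⟨hsa.trans hτ.1, hτ.2.trans hbt⟩), flowFunctional]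
    refine ⟨?_, ?_⟩
    · have h4 : IntervalIntegrable (fun τ => (∫ x, Y τ x * (Δ (φ : Plane → ℝ) x - φ x))
          - ∑ ℓ ∈ Finset.range (k + 1), N ℓ τ φ) volume a b := by
        have h5 := IntervalIntegrable.sum (Finset.range (k + 1)) (f := fun ℓ r => N ℓ r φ)
          fun ℓ hℓ => h2 ℓ (by rw [Finset.mem_range] at hℓ; omega)
        refine (h1.sub h5).congr fun τ _ => ?_
        simp only [Finset.sum_apply]
      exact h4.congr fun τ hτ => hcongr τ (Set.uIoc_subset_uIcc hτ)
    · rw [h3]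
      exact intervalIntegral.integral_congr hcongr
  · obtain ⟨D, hD1, hDY⟩ := hsol.exists_bound hs hst ht hK
    obtain ⟨B, hB⟩ := exists_interpolationBound_pow_mul (δ := δ) hq (μ / p) hε2 k hK
    set V := (volume K).toReal with hV
    have hV0 : 0 ≤ V := ENNReal.toReal_nonneg
    refine ⟨D * V + D * V + (k + 1) * (β * ((A * B + 1) * ((k + 1) * D ^ k))), by positivity,
      fun τ hτ φ φ' hφ hφ' e he hcl => ?_⟩
    have hYτ := hC1 τ hτ
    have h1 := abs_integral_dualInner_sub_le hYτ φ.contDiff_one φ'.contDiff_one hK hφ hφ'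
      (fun x hx => (hDY τ hτ x hx).2) hcl
    have h2 := abs_integral_mul_sub_le hYτ.continuous φ.continuous φ'.continuous hK hφ hφ'
      (fun x hx => (hDY τ hτ x hx).1) (fun x => (hcl x).1)
    have h3 : ∀ ℓ ∈ Finset.range (k + 1), |N ℓ τ φ - N ℓ τ φ'| ≤
        β * ((A * B + 1) * ((k + 1) * D ^ k * e)) := by
      intro ℓ hℓ
      have hℓk : ℓ ≤ k := by rw [Finset.mem_range] at hℓ; omega
      have hτ0 : 0 < τ := hs.trans_le hτ.1
      have hc := fun f => hN ℓ hℓk τ hτ0 (hτ.2.trans ht) f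
      have hib := hB (Y τ) (fun x => φ x - φ' x) D e hYτ (φ.contDiff_one.sub φ'.contDiff_one) hD1
        (hDY τ hτ) ((tsupport_sub _ _).trans (Set.union_subset hφ hφ')) he.le (fun x => by
          refine ⟨(hcl x).1, ?_⟩
          have : fderiv ℝ (fun x => φ x - φ' x) x = fderiv ℝ φ x - fderiv ℝ φ' x :=
            fderiv_fun_sub ((φ.contDiff_one.differentiable (by simp)) x)
              ((φ'.contDiff_one.differentiable (by simp)) x)
          rw [this]; exact (hcl x).2) (k - ℓ) (by omega)
      refine abs_value_sub_le hD hq hε2 hβ0 (hβ τ hτ0 hτ.2 ℓ hℓk)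
        ((hYτ.pow _).mul φ.contDiff_one) φ.hasCompactSupport.mul_left
        ((hYτ.pow _).mul φ'.contDiff_one) φ'.hasCompactSupport.mul_left (hc φ) (hc φ')
        (by positivity) fun χ => ?_
      have h4 := InterpolationBound.pairing_le hD hib (X := (A * B + 1) * ((k + 1) * D ^ k * e))
        (by have : 0 ≤ ((k : ℝ) + 1) * D ^ k * e := by positivity
            nlinarith) χ
      simpa only [mul_sub] using h4
    have h5 : |∑ ℓ ∈ Finset.range (k + 1), N ℓ τ φ - ∑ ℓ ∈ Finset.range (k + 1), N ℓ τ φ'| ≤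
        (k + 1) * (β * ((A * B + 1) * ((k + 1) * D ^ k * e))) := by
      rw [← Finset.sum_sub_distrib]
      refine (Finset.abs_sum_le_sum_abs _ _).trans ((Finset.sum_le_card_nsmul _ _ _ h3).trans ?_)
      simp
    simp only [flowFunctional]
    rw [← hV] at h1 h2
    rw [abs_le] at h1 h2 h5 ⊢
    constructor <;> nlinarith

/-- The energy estimate for the tested equation, for test functions close to `Y ^ {2r - 1} ρ`. -/
theorem IsSolution.exists_flowFunctional_le {χ₀ χ₁ : Plane → ℝ} {δ p q μ ε : ℝ} {A : ℝ≥0}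
    (hD : DualityBound χ₀ χ₁ δ p q μ ε A) (hq0 : 0 < q) (hε : 0 ≤ ε) (hε2 : ε ≤ 1 / 2)
    (hδ : 0 < δ) (hδ1 : δ ≤ 1) {μ' : ℝ} (hμ' : 0 < μ')
    {r k M L : ℕ} (hr : 1 ≤ r) (hk : 3 ≤ k) (hMk : M + 1 = 2 * r + k) (hML : M = 2 * L)
    (hq : q = 4 * M / (4 * M - 1)) (hν : μ / p ≤ μ' / (4 * M))
    (hεk : ε * (4 * k + 2) ≤ 1) {δ' T : ℝ} {X₀ : Distr} {Z : ℕ → ℝ → Distr} {Y : ℝ → Plane → ℝ}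
    (hsol : IsSolution δ' k T X₀ Z Y) {N : ℕ → ℝ → TestFun → ℝ}
    (hN : ∀ ℓ ≤ k, ∀ t, 0 < t → t ≤ T → ∀ φ : TestFun,
      HasC1Value (Z ℓ t) (fun x => Y t x ^ (k - ℓ) * φ x) (N ℓ t φ))
    {s t β : ℝ} (hs : 0 < s) (hst : s ≤ t) (ht : t ≤ T) (hβ0 : 0 ≤ β)
    (hβ : ∀ τ, 0 < τ → τ ≤ t → ∀ ℓ ≤ k,
      besovNorm χ₀ χ₁ δ (-ε) μ p p (Z ℓ τ) ≤ ENNReal.ofReal β)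
    {C R : ℝ} (hR : 1 ≤ R) (hC0 : 0 ≤ C) (hC : ∀ x, ‖fderiv ℝ (cut R) x‖ ≤ C)
    {K : Set Plane} (hK : IsCompact K) (hKR : tsupport (locWeight δ μ' M R) ⊆ K) :
    ∃ C' : ℝ, 0 ≤ C' ∧ ∀ τ ∈ Set.Icc s t, ∀ φ : TestFun, tsupport φ ⊆ K → ∀ e : ℝ, 0 < e →
      C1Close φ (energyTest δ μ' r M R (Y τ)) e →
      flowFunctional k (Y τ) (fun ℓ => N ℓ τ) φ ≤
        -(∫ x, dualInner (fderiv ℝ (Y τ) x) (fderiv ℝ (energyTest δ μ' r M R (Y τ)) x)) -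
        (∫ x, Y τ x * energyTest δ μ' r M R (Y τ) x) -
        (∫ x, Y τ x ^ k * energyTest δ μ' r M R (Y τ) x) +
        β * (k * A * (M + μ' + M * C) * energy δ μ' r M R (Y τ) ^ (1 / q)) + C' * e := by
  obtain ⟨D, hD1, hDY⟩ := hsol.exists_bound hs hst ht hK
  obtain ⟨B, hB⟩ := exists_interpolationBound_pow_mul (δ := δ) hq0 (μ / p) hε2 k hK
  set V := (volume K).toReal with hV
  have hV0 : 0 ≤ V := ENNReal.toReal_nonneg
  refine ⟨D * V + D * V + D ^ k * V + k * (β * ((A * B + 1) * ((k + 1) * D ^ k))), by positivity,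
    fun τ hτ φ hφ e he hcl => ?_⟩
  have hτ0 : 0 < τ := hs.trans_le hτ.1
  have hYτ : ContDiff ℝ 1 (Y τ) := hsol.contDiff τ hτ0 (hτ.2.trans ht)
  set Ψ := energyTest δ μ' r M R (Y τ) with hΨ
  have hΨ1 : ContDiff ℝ 1 Ψ :=
    contDiff_energyTest δ μ' r M R (by exact_mod_cast (le_top : (1 : ℕ∞) ≤ ⊤)) hYτ
  have hΨK : tsupport Ψ ⊆ K := (tsupport_energyTest_subset _ _ _ _ _ _).trans hKR
  have hΨs : HasCompactSupport Ψ := hasCompactSupport_energyTest δ μ' r (by omega) hR _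
  have h1 := abs_integral_dualInner_sub_le hYτ φ.contDiff_one hΨ1 hK hφ hΨK
    (fun x hx => (hDY τ hτ x hx).2) hcl
  have h2 := abs_integral_mul_sub_le hYτ.continuous φ.continuous hΨ1.continuous hK hφ hΨK
    (fun x hx => (hDY τ hτ x hx).1) (fun x => (hcl x).1)
  have h3 := abs_integral_mul_sub_le (f := fun x => Y τ x ^ k) (hYτ.continuous.pow k) φ.continuous
    hΨ1.continuous hK hφ hΨK (D := D ^ k) (fun x hx => by
      rw [abs_pow]; exact pow_le_pow_left₀ (abs_nonneg _) (hDY τ hτ x hx).1 k)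
    (fun x => (hcl x).1)
  -- the term `Y ^ k` carries no noise, since `Z 0 = 1`
  have h0 : N 0 τ φ = ∫ x, Y τ x ^ k * φ x := by
    have := (hN 0 (Nat.zero_le k) τ hτ0 (hτ.2.trans ht) φ).eq_integral
      (hsol.noise_zero τ hτ0 (hτ.2.trans ht)) ((hYτ.pow _).mul φ.contDiff_one)
      φ.hasCompactSupport.mul_left
    simpa using this
  set E := energy δ μ' r M R (Y τ) ^ (1 / q) with hE
  have hE0 : 0 ≤ E := Real.rpow_nonneg (integral_nonneg fun x =>
    mul_nonneg (zero_le_one.trans (one_le_density _ _ _ _ _)) (weight_pos _ _ _).le) _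
  have h4 : ∀ ℓ ∈ Finset.range k, |N (ℓ + 1) τ φ| ≤
      β * (A * ((M + μ' + M * C) * E) + (A * B + 1) * ((k + 1) * D ^ k * e)) := by
    intro ℓ hℓ
    rw [Finset.mem_range] at hℓ
    have hc := hN (ℓ + 1) (by omega) τ hτ0 (hτ.2.trans ht) φ
    have hib := hB (Y τ) (fun x => φ x - Ψ x) D e hYτ (φ.contDiff_one.sub hΨ1) hD1
      (hDY τ hτ) ((tsupport_sub _ _).trans (Set.union_subset hφ hΨK)) he.le (fun x => by
        refine ⟨(hcl x).1, ?_⟩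
        have : fderiv ℝ (fun x => φ x - Ψ x) x = fderiv ℝ φ x - fderiv ℝ Ψ x :=
          fderiv_fun_sub ((φ.contDiff_one.differentiable (by simp)) x)
            ((hΨ1.differentiable (by simp)) x)
        rw [this]; exact (hcl x).2) (k - (ℓ + 1)) (by omega)
    have hib' := interpolationBound_pow (m := k - (ℓ + 1) + (2 * r - 1)) hδ hδ1 hμ' hr hk hMk hML
      hq hν hε hεk hR hC0 hC hYτ (by omega) (by omega)
    have hCb : 0 ≤ (M + μ' + M * C) * E := by positivity
    refine abs_value_le hD hq0 hε2 hβ0 (hβ τ hτ0 hτ.2 (ℓ + 1) (by omega))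
        ((hYτ.pow _).mul φ.contDiff_one) φ.hasCompactSupport.mul_left hc
        (by positivity) fun χ => ?_
    have h5 := InterpolationBound.pairing_le hD hib (X := (A * B + 1) * ((k + 1) * D ^ k * e))
        (by have : 0 ≤ ((k : ℝ) + 1) * D ^ k * e := by positivity
            nlinarith) χ
    have h6 := InterpolationBound.pairing_le hD (B := 1) (by simpa using hib')
      (X := A * ((M + μ' + M * C) * E)) (by simp [hE]) χ
    have hint : ∀ g : Plane → ℝ, Continuous g → Integrable fun x => χ x * g x :=
      fun g hg => (χ.continuous.mul hg).integrable_of_hasCompactSupport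
        χ.hasCompactSupport.mul_right
    have hc1 : Continuous fun x => Y τ x ^ (k - (ℓ + 1) + (2 * r - 1)) * locWeight δ μ' M R x :=
      (hYτ.continuous.pow _).mul (continuous_locWeight _ _ _ _)
    have hc2 : Continuous fun x => Y τ x ^ (k - (ℓ + 1)) * (φ x - Ψ x) :=
      (hYτ.continuous.pow _).mul (φ.continuous.sub hΨ1.continuous)
    have h7 : ∫ x, χ x * (Y τ x ^ (k - (ℓ + 1)) * φ x) =
        (∫ x, χ x * (Y τ x ^ (k - (ℓ + 1) + (2 * r - 1)) * locWeight δ μ' M R x)) +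
        ∫ x, χ x * (Y τ x ^ (k - (ℓ + 1)) * (φ x - Ψ x)) := by
      rw [← integral_add (hint _ hc1) (hint _ hc2)]
      refine integral_congr_ae (ae_of_all _ fun x => ?_)
      simp only [hΨ, energyTest, pow_add]
      ring
    rw [h7, ENNReal.ofReal_add (by positivity) (by positivity), mul_add]
    exact (enorm_add_le _ _).trans (add_le_add h6 h5)
  have h5 : |∑ ℓ ∈ Finset.range k, N (ℓ + 1) τ φ| ≤
      k * (β * (A * ((M + μ' + M * C) * E) + (A * B + 1) * ((k + 1) * D ^ k * e))) := by
    refine (Finset.abs_sum_le_sum_abs _ _).trans ((Finset.sum_le_card_nsmul _ _ _ h4).trans ?_)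
    simp
  rw [flowFunctional, Finset.sum_range_succ', h0]
  rw [← hV] at h1 h2 h3
  have h1' := (abs_le.1 h1).1
  have h2' := (abs_le.1 h2).1
  have h3' := (abs_le.1 h3).1
  have h5' := (abs_le.1 h5).1
  linarith

/-! ### Mollified energies -/

lemma integral_mollify_mul (n : ℕ) {f g : Plane → ℝ} (hf : Continuous f) (hfs : HasCompactSupport f)
    (hg : Continuous g) : ∫ x, mollify n f x * g x = ∫ x, f x * mollify n g x := by
  have h1 : ∀ x, mollify n f x * g x = ∫ z, mol n (x - z) * f z * g x := fun x => by
    rw [mollify_eq_swap, ← integral_mul_const]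
    simp only [smul_eq_mul]
  have h2 : ∀ z, f z * mollify n g z = ∫ x, mol n (x - z) * f z * g x := fun z => by
    rw [mollify_eq_swap, ← integral_const_mul]
    refine integral_congr_ae (ae_of_all _ fun x => ?_)
    simp only [smul_eq_mul]
    rw [mol_sub_comm]; ring
  simp_rw [h1, h2]
  refine integral_integral_swap_of_hasCompactSupport (f := fun x z => mol n (x - z) * f z * g x)
    ?_ ?_
  · have := continuous_mol n
    unfold Function.uncurry
    fun_prop
  · have hK := hfs.isCompact
    refine HasCompactSupport.of_support_subset_isCompact ((hK.cthickening (r := 1)).prod hK)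
      fun ⟨x, z⟩ hxz => ?_
    simp only [Function.mem_support, Function.uncurry_apply_pair] at hxz
    have hz : z ∈ tsupport f := subset_tsupport _ fun h0 => hxz (by rw [h0]; ring)
    have hm : mol n (x - z) ≠ 0 := fun h0 => hxz (by rw [h0]; ring)
    refine ⟨Metric.mem_cthickening_of_dist_le x z 1 _ hz ?_, hz⟩
    rw [dist_eq_norm]
    exact (norm_lt_of_mol_ne_zero hm).le.trans (one_div_succ_le_one n)

lemma exists_lipschitz_mol (n : ℕ) :
    ∃ B : ℝ, 0 ≤ B ∧ (∀ z, |mol n z| ≤ B) ∧ (∀ z, ‖fderiv ℝ (mol n) z‖ ≤ B) ∧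
      ∀ x y, |mol n x - mol n y| ≤ B * ‖x - y‖ := by
  have h1 : ContDiff ℝ 1 (mol n) := (contDiff_mol n).of_le (by exact_mod_cast le_top)
  obtain ⟨b₁, hb₁⟩ := (continuous_mol n).bounded_above_of_compact_support (hasCompactSupport_mol n)
  obtain ⟨b₂, hb₂⟩ := (h1.continuous_fderiv (by simp)).bounded_above_of_compact_support
    ((hasCompactSupport_mol n).fderiv ℝ)
  refine ⟨max b₁ b₂, ((norm_nonneg _).trans (hb₁ 0)).trans (le_max_left _ _),
    fun z => (hb₁ z).trans (le_max_left _ _), fun z => (hb₂ z).trans (le_max_right _ _),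
    fun x y => ?_⟩
  exact Convex.norm_image_sub_le_of_norm_fderiv_le (s := Set.univ)
    (fun z _ => (h1.differentiable (by simp)) z)
    (fun z _ => (hb₂ z).trans (le_max_right _ _)) convex_univ trivial trivial

/-- Mollification at a fixed scale is bounded from `C⁰` to `C¹`. -/
lemma exists_norm_fderiv_mollify_le (n : ℕ) {K : Set Plane} (hK : IsCompact K) :
    ∃ C : ℝ, 0 ≤ C ∧ ∀ g : Plane → ℝ, Continuous g → tsupport g ⊆ K → ∀ b : ℝ,
      (∀ x, |g x| ≤ b) → ∀ x, ‖fderiv ℝ (mollify n g) x‖ ≤ C * b := by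
  obtain ⟨B, hB0, -, -, hB⟩ := exists_lipschitz_mol n
  have hV0 : 0 ≤ (volume K).toReal := ENNReal.toReal_nonneg
  refine ⟨B * (volume K).toReal, by positivity, fun g hg hgK b hb x => ?_⟩
  have hb0 : 0 ≤ b := (abs_nonneg _).trans (hb 0)
  have hgs : HasCompactSupport g :=
    HasCompactSupport.of_support_subset_isCompact hK ((subset_tsupport _).trans hgK)
  have hmc := continuous_mol n
  have hlip : ∀ x y, ‖mollify n g x - mollify n g y‖ ≤ B * (volume K).toReal * b * ‖x - y‖ := by
    intro x y
    have hi : ∀ x, Integrable fun z => mol n (x - z) * g z := fun x =>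
      ((hmc.comp (continuous_const.sub continuous_id)).mul hg).integrable_of_hasCompactSupport
        hgs.mul_left
    rw [mollify_eq_swap, mollify_eq_swap]
    simp only [smul_eq_mul]
    rw [← integral_sub (hi x) (hi y)]
    refine (abs_integral_le_of_compact hK (b := B * ‖x - y‖ * b) (fun z _ => ?_)
      fun z hz => ?_).trans (le_of_eq (by ring))
    · rw [← sub_mul, abs_mul]
      have := hB (x - z) (y - z)
      rw [sub_sub_sub_cancel_right] at this
      exact mul_le_mul this (hb z) (abs_nonneg _) (by positivity)
    · have : g z = 0 := by
        by_contra h0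
        exact hz (hgK (subset_tsupport _ h0))
      simp [this]
  exact norm_fderiv_le_of_lip' ℝ (by positivity) (Eventually.of_forall fun y => hlip y x)

lemma abs_mollify_sub_le {f : Plane → ℝ} (hf : ContDiff ℝ 1 f) (n : ℕ) (x : Plane) {D : ℝ}
    (hD : ∀ y ∈ Metric.closedBall x 1, ‖fderiv ℝ f y‖ ≤ D) :
    |mollify n f x - f x| ≤ D * (1 / ((n : ℝ) + 1)) := by
  have hD0 : 0 ≤ D := (norm_nonneg _).trans (hD x (Metric.mem_closedBall_self zero_le_one))
  refine norm_mollify_sub_le hf.continuous n x (f x) fun z hz => ?_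
  have h1 : x - z ∈ Metric.closedBall x 1 := by
    rw [Metric.mem_closedBall, dist_eq_norm]
    simpa using hz.le.trans (one_div_succ_le_one n)
  have := (convex_closedBall x 1).norm_image_sub_le_of_norm_fderiv_le
    (fun y _ => (hf.differentiable (by simp)) y) hD
    (Metric.mem_closedBall_self zero_le_one) h1
  refine this.trans ?_
  gcongr
  simpa using hz.le

lemma closedBall_subset_cthickening {K : Set Plane} {x : Plane} (hx : x ∈ K) :
    Metric.closedBall x 1 ⊆ Metric.cthickening 1 K := fun _ hy =>
  Metric.mem_cthickening_of_dist_le _ x 1 _ hx hy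

lemma norm_mollify_le_of_thickening {F : Type*} [NormedAddCommGroup F] [NormedSpace ℝ F]
    [CompleteSpace F] {f : Plane → F} (hf : Continuous f) (n : ℕ) {K : Set Plane} {D : ℝ}
    (hD : ∀ y ∈ Metric.cthickening 1 K, ‖f y‖ ≤ D) {x : Plane} (hx : x ∈ K) :
    ‖mollify n f x‖ ≤ D := by
  refine norm_mollify_le hf n x fun z hz => hD _ (closedBall_subset_cthickening hx ?_)
  rw [Metric.mem_closedBall, dist_eq_norm]
  simpa using hz.le.trans (one_div_succ_le_one n)

/-- The mollifier centred at `x`, as a test function. -/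
noncomputable def molTest (n : ℕ) (x : Plane) : TestFun :=
  toTestFun (fun z => mol n (z - x)) ((contDiff_mol n).comp (contDiff_id.sub contDiff_const))
    ((hasCompactSupport_mol n).comp_homeomorph (Homeomorph.subRight x))

lemma integral_mul_molTest (n : ℕ) (f : Plane → ℝ) (x : Plane) :
    ∫ z, f z * molTest n x z = mollify n f x := by
  rw [mollify_eq_swap]
  refine integral_congr_ae (ae_of_all _ fun z => ?_)
  change f z * mol n (z - x) = mol n (x - z) • f z
  rw [mol_sub_comm, smul_eq_mul, mul_comm]

lemma tsupport_molTest_subset (n : ℕ) {K : Set Plane} {x : Plane} (hx : x ∈ K) :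
    tsupport (molTest n x) ⊆ Metric.cthickening 1 K := by
  refine closure_minimal (fun z hz => ?_) Metric.isClosed_cthickening
  refine Metric.mem_cthickening_of_dist_le _ x 1 _ hx ?_
  rw [dist_eq_norm]
  exact (norm_lt_of_mol_ne_zero hz).le.trans (one_div_succ_le_one n)

/-- At a fixed mollification scale, the flow is Lipschitz in time, locally uniformly in space. -/
lemma RegularFlow.exists_mollify_lipschitz {s t : ℝ} {Y : ℝ → Plane → ℝ} {G : ℝ → TestFun → ℝ}
    (hf : RegularFlow s t Y G) (n : ℕ) {K : Set Plane} (hK : IsCompact K) :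
    ∃ C : ℝ, 0 ≤ C ∧ ∀ a ∈ Set.Icc s t, ∀ b ∈ Set.Icc s t, ∀ x ∈ K,
      |mollify n (Y b) x - mollify n (Y a) x| ≤ C * |b - a| := by
  obtain ⟨B, hB0, hB1, hB2, -⟩ := exists_lipschitz_mol n
  obtain ⟨C, hC0, hC⟩ := hf.lipschitz _ (hK.cthickening (r := 1))
  have main : ∀ a ∈ Set.Icc s t, ∀ b ∈ Set.Icc s t, a ≤ b → ∀ x ∈ K,
      |mollify n (Y b) x - mollify n (Y a) x| ≤ C * (B + 1) * |b - a| := by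
    intro a ha b hb hab x hx
    obtain ⟨h1, h2⟩ := hf.equation (molTest n x) a b ha.1 hab hb.2
    obtain ⟨h3, h4⟩ := hf.equation 0 a b ha.1 hab hb.2
    have h5 : ∫ τ in a..b, G τ 0 = 0 := by rw [← h4]; simp
    rw [← integral_mul_molTest, ← integral_mul_molTest, h2, ← sub_zero (∫ τ in a..b, G τ _), ← h5,
      ← intervalIntegral.integral_sub h1 h3]
    refine intervalIntegral.norm_integral_le_of_norm_le_const (E := ℝ) fun τ hτ => ?_
    rw [Set.uIoc_of_le hab] at hτ
    refine hC τ ⟨ha.1.trans hτ.1.le, hτ.2.trans hb.2⟩ _ _ (tsupport_molTest_subset n hx) ?_ (B + 1)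
      (by positivity) fun z => ?_
    · have : tsupport ((0 : TestFun) : Plane → ℝ) = ∅ := by
        rw [tsupport_eq_empty_iff]; rfl
      rw [this]; exact Set.empty_subset _
    · have e0 : ((0 : TestFun) : Plane → ℝ) = 0 := rfl
      have e1 : fderiv ℝ (molTest n x) z = fderiv ℝ (mol n) (z - x) :=
        fderiv_comp_sub (f := mol n) x
      rw [e0, e1]
      simp only [Pi.zero_apply, sub_zero, fderiv_zero]
      refine ⟨?_, ?_⟩
      · have := hB1 (z - x)
        change |mol n (z - x)| ≤ B + 1
        linarith
      · have := hB2 (z - x)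
        linarith
  refine ⟨C * (B + 1), by positivity, fun a ha b hb x hx => ?_⟩
  rcases le_total a b with h | h
  · exact main a ha b hb h x hx
  · rw [abs_sub_comm, abs_sub_comm b]
    exact main b hb a ha h x hx

/-- The flow is continuous in time, locally uniformly in space. -/
lemma RegularFlow.uniform_continuity {s t : ℝ} {Y : ℝ → Plane → ℝ} {G : ℝ → TestFun → ℝ}
    (hf : RegularFlow s t Y G) {K : Set Plane} (hK : IsCompact K) {e : ℝ} (he : 0 < e) :
    ∃ d : ℝ, 0 < d ∧ ∀ a ∈ Set.Icc s t, ∀ b ∈ Set.Icc s t, |b - a| ≤ d →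
      ∀ x ∈ K, |Y b x - Y a x| ≤ e := by
  obtain ⟨D, hD1, hD⟩ := hf.bounded _ (hK.cthickening (r := 1))
  have h1 : Tendsto (fun n : ℕ => D * (1 / ((n : ℝ) + 1))) atTop (𝓝 (D * 0)) :=
    tendsto_one_div_add_atTop_nhds_zero_nat.const_mul D
  rw [mul_zero] at h1
  obtain ⟨n, hn⟩ := (h1.eventually_lt_const (by positivity : 0 < e / 3)).exists
  obtain ⟨C, hC0, hC⟩ := hf.exists_mollify_lipschitz n hK
  refine ⟨e / (3 * (C + 1)), by positivity, fun a ha b hb hab x hx => ?_⟩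
  have h2 := hC a ha b hb x hx
  have h3 : ∀ τ ∈ Set.Icc s t, |mollify n (Y τ) x - Y τ x| ≤ e / 3 := fun τ hτ =>
    (abs_mollify_sub_le (hf.contDiff τ hτ) n x fun y hy =>
      (hD τ hτ y (closedBall_subset_cthickening hx hy)).2).trans hn.le
  have h4 : C * |b - a| ≤ e / 3 := by
    calc C * |b - a| ≤ C * (e / (3 * (C + 1))) := by gcongr
      _ ≤ e / 3 := by
        rw [mul_div_assoc', div_le_div_iff₀ (by positivity) (by norm_num)]
        nlinarith
  have ea := abs_le.1 (h3 a ha)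
  have eb := abs_le.1 (h3 b hb)
  have eab := abs_le.1 (h2.trans h4)
  rw [abs_le]
  constructor <;> linarith

lemma abs_pow_sub_pow_le_of_le {a b D : ℝ} (hD : 1 ≤ D) (ha : |a| ≤ D) (hb : |b| ≤ D) (m : ℕ) :
    |a ^ m - b ^ m| ≤ m * D ^ m * |a - b| := by
  have key : ∀ {a b : ℝ}, |a| ≤ D → |b| ≤ |a| → |a ^ m - b ^ m| ≤ m * D ^ m * |a - b| := by
    intro a b ha h
    refine (abs_pow_sub_pow_le a b h m).trans ?_
    gcongr
    calc |a| ^ (m - 1) ≤ D ^ (m - 1) := by gcongr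
      _ ≤ D ^ m := pow_le_pow_right₀ hD (by omega)
  rcases le_total |b| |a| with h | h
  · exact key ha h
  · rw [abs_sub_comm, abs_sub_comm a]
    exact key hb h

lemma abs_mass_sub_le {δ μ : ℝ} {r M : ℕ} (hM : M ≠ 0) {R : ℝ} (hR : 1 ≤ R) {f g : Plane → ℝ}
    (hf : Continuous f) (hg : Continuous g) {D e : ℝ} (hD : 1 ≤ D)
    (hfD : ∀ x ∈ tsupport (locWeight δ μ M R), |f x| ≤ D)
    (hgD : ∀ x ∈ tsupport (locWeight δ μ M R), |g x| ≤ D)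
    (hfg : ∀ x ∈ tsupport (locWeight δ μ M R), |f x - g x| ≤ e) :
    |mass δ μ r M R f - mass δ μ r M R g| ≤
      2 * r * D ^ (2 * r) * (∫ x, locWeight δ μ M R x) * e := by
  have hi := fun {h : Plane → ℝ} (hh : Continuous h) =>
    integrable_mul_locWeight (hh.pow (2 * r)) δ μ hM hR
  have hρ : Integrable (locWeight δ μ M R) :=
    (continuous_locWeight δ μ M R).integrable_of_hasCompactSupport
      (hasCompactSupport_locWeight δ μ hM hR)
  have h1 : mass δ μ r M R f - mass δ μ r M R g =
      ∫ x, (f x ^ (2 * r) - g x ^ (2 * r)) * locWeight δ μ M R x := by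
    rw [mass, mass]
    simp_rw [sub_mul]
    exact (integral_sub (hi hf) (hi hg)).symm
  rw [h1, mul_right_comm, ← integral_const_mul, ← Real.norm_eq_abs]
  refine norm_integral_le_of_norm_le (hρ.const_mul _) (ae_of_all _ fun x => ?_)
  have h0 := locWeight_nonneg δ μ M R x
  rw [norm_mul, Real.norm_of_nonneg h0, Real.norm_eq_abs]
  by_cases hx : x ∈ tsupport (locWeight δ μ M R)
  · refine mul_le_mul_of_nonneg_right ?_ h0
    have h2 := abs_pow_sub_pow_le_of_le hD (hfD x hx) (hgD x hx) (2 * r)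
    push_cast at h2
    refine h2.trans ?_
    gcongr
    exact hfg x hx
  · have : locWeight δ μ M R x = 0 := by
      by_contra h0
      exact hx (subset_tsupport _ h0)
    rw [this]; simp

lemma RegularFlow.continuousOn_mass {s t : ℝ} {Y : ℝ → Plane → ℝ} {G : ℝ → TestFun → ℝ}
    (hf : RegularFlow s t Y G) (δ μ : ℝ) (r : ℕ) {M : ℕ} (hM : M ≠ 0) {R : ℝ} (hR : 1 ≤ R) :
    ContinuousOn (fun τ => mass δ μ r M R (Y τ)) (Set.Icc s t) := by
  have hK : IsCompact (tsupport (locWeight δ μ M R)) := hasCompactSupport_locWeight δ μ hM hR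
  obtain ⟨D, hD1, hD⟩ := hf.bounded _ hK
  have hI0 : 0 ≤ ∫ x, locWeight δ μ M R x := integral_nonneg fun x => locWeight_nonneg _ _ _ _ _
  set c : ℝ := 2 * r * D ^ (2 * r) * (∫ x, locWeight δ μ M R x) with hc
  have hc0 : 0 ≤ c := by positivity
  rw [Metric.continuousOn_iff]
  intro a ha e he
  obtain ⟨d, hd, h⟩ := hf.uniform_continuity hK (e := e / (c + 1)) (by positivity)
  refine ⟨d, hd, fun b hb hab => ?_⟩
  rw [Real.dist_eq] at hab ⊢
  refine (abs_mass_sub_le hM hR (hf.contDiff b hb).continuous (hf.contDiff a ha).continuous hD1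
    (fun x hx => (hD b hb x hx).1) (fun x hx => (hD a ha x hx).1)
    (h a ha b hb hab.le)).trans_lt ?_
  rw [← hc, mul_div_assoc', div_lt_iff₀ (by positivity)]
  nlinarith

lemma exists_bound_locWeight (δ μ : ℝ) {M : ℕ} (hM : M ≠ 0) {R : ℝ} (hR : 1 ≤ R) :
    ∃ B : ℝ, 0 ≤ B ∧ ∀ x, |locWeight δ μ M R x| ≤ B ∧ ‖fderiv ℝ (locWeight δ μ M R) x‖ ≤ B := by
  have h1 : ContDiff ℝ 1 (locWeight δ μ M R) :=
    (contDiff_locWeight δ μ M R).of_le (by exact_mod_cast le_top)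
  have hs := hasCompactSupport_locWeight δ μ hM hR
  obtain ⟨b₁, hb₁⟩ := h1.continuous.bounded_above_of_compact_support hs
  obtain ⟨b₂, hb₂⟩ := (h1.continuous_fderiv (by simp)).bounded_above_of_compact_support
    (hs.fderiv ℝ)
  exact ⟨max b₁ b₂, ((norm_nonneg _).trans (hb₁ 0)).trans (le_max_left _ _),
    fun x => ⟨(hb₁ x).trans (le_max_left _ _), (hb₂ x).trans (le_max_right _ _)⟩⟩

lemma energyTest_eq_zero {δ μ : ℝ} {r M : ℕ} {R : ℝ} {Y : Plane → ℝ} {x : Plane}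
    (hx : x ∉ tsupport (locWeight δ μ M R)) :
    energyTest δ μ r M R Y x = 0 ∧ fderiv ℝ (energyTest δ μ r M R Y) x = 0 := by
  have hs := tsupport_energyTest_subset δ μ r M R Y
  constructor
  · by_contra h0
    exact hx (hs (subset_tsupport _ h0))
  · by_contra h0
    exact hx (hs (support_fderiv_subset ℝ h0))

/-- `C¹` bounds of the energy test function. -/
lemma exists_energyTest_bound (δ μ : ℝ) (r : ℕ) {M : ℕ} (hM : M ≠ 0) {R : ℝ} (hR : 1 ≤ R) {D : ℝ}
    (hD : 1 ≤ D) :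
    ∃ C : ℝ, 0 ≤ C ∧ ∀ Y : Plane → ℝ, ContDiff ℝ 1 Y →
      (∀ x ∈ tsupport (locWeight δ μ M R), |Y x| ≤ D ∧ ‖fderiv ℝ Y x‖ ≤ D) →
      ∀ x, |energyTest δ μ r M R Y x| ≤ C ∧ ‖fderiv ℝ (energyTest δ μ r M R Y) x‖ ≤ C := by
  obtain ⟨B, hB0, hB⟩ := exists_bound_locWeight δ μ hM hR
  have hC0 : 0 ≤ (((2 * r - 1 : ℕ) : ℝ) + 1) * D ^ (2 * r - 1) * B := by positivity
  refine ⟨_, hC0, fun Y hY hYD x => ?_⟩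
  by_cases hx : x ∈ tsupport (locWeight δ μ M R)
  · exact norm_fderiv_pow_mul_le ((hY.differentiable (by simp)) x)
      (((contDiff_locWeight δ μ M R).differentiable (by simp)) x) hD hB0 (hYD x hx).1 (hYD x hx).2
      (hB x).1 (hB x).2 le_rfl
  · obtain ⟨h1, h2⟩ := energyTest_eq_zero (r := r) (Y := Y) hx
    rw [h1, h2, abs_zero, norm_zero]
    exact ⟨hC0, hC0⟩

/-- Stability of the energy test function. -/
lemma exists_energyTest_sub_le (δ μ : ℝ) (r : ℕ) {M : ℕ} (hM : M ≠ 0) {R : ℝ} (hR : 1 ≤ R) {D : ℝ}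
    (hD : 1 ≤ D) :
    ∃ C : ℝ, 0 ≤ C ∧ ∀ Y Y' : Plane → ℝ, ContDiff ℝ 1 Y → ContDiff ℝ 1 Y' →
      (∀ x ∈ tsupport (locWeight δ μ M R), |Y x| ≤ D ∧ ‖fderiv ℝ Y x‖ ≤ D) →
      (∀ x ∈ tsupport (locWeight δ μ M R), |Y' x| ≤ D ∧ ‖fderiv ℝ Y' x‖ ≤ D) → ∀ e : ℝ,
      ((∀ x ∈ tsupport (locWeight δ μ M R), |Y x - Y' x| ≤ e) →
        ∀ x, |energyTest δ μ r M R Y x - energyTest δ μ r M R Y' x| ≤ C * |e|) ∧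
      ((∀ x ∈ tsupport (locWeight δ μ M R), |Y x - Y' x| ≤ e ∧
        ‖fderiv ℝ Y x - fderiv ℝ Y' x‖ ≤ e) →
        C1Close (energyTest δ μ r M R Y) (energyTest δ μ r M R Y') (C * |e|)) := by
  obtain ⟨B, hB0, hB⟩ := exists_bound_locWeight δ μ hM hR
  set m : ℕ := 2 * r - 1 with hm
  set C : ℝ := B * (((m - 1 : ℕ) + 1) * m + m) * D ^ (m + 1) with hC
  have hC0 : 0 ≤ C := by positivity
  have hDm : D ^ m ≤ D ^ (m + 1) := pow_le_pow_right₀ hD (by omega)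
  refine ⟨C, hC0, fun Y Y' hY hY' hYD hYD' e => ?_⟩
  have h0 : (∀ x ∈ tsupport (locWeight δ μ M R), |Y x - Y' x| ≤ e) →
        ∀ x, |energyTest δ μ r M R Y x - energyTest δ μ r M R Y' x| ≤ C * |e| := by
    intro he x
    by_cases hx : x ∈ tsupport (locWeight δ μ M R)
    · rw [energyTest, energyTest, ← sub_mul, abs_mul]
      have h1 := abs_pow_sub_pow_le_of_le hD (hYD x hx).1 (hYD' x hx).1 m
      have h2 : |Y x - Y' x| ≤ |e| := (he x hx).trans (le_abs_self e)
      calc |Y x ^ (2 * r - 1) - Y' x ^ (2 * r - 1)| * |locWeight δ μ M R x|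
          ≤ (m * D ^ m * |Y x - Y' x|) * B := by gcongr; exact (hB x).1
        _ ≤ (m * D ^ (m + 1) * |e|) * B := by gcongr
        _ = B * m * D ^ (m + 1) * |e| := by ring
        _ ≤ C * |e| := by
          rw [hC]
          gcongr
          exact le_add_of_nonneg_left (by positivity)
    · rw [(energyTest_eq_zero (r := r) (Y := Y) hx).1, (energyTest_eq_zero (r := r) (Y := Y') hx).1,
        sub_self, abs_zero]
      positivity
  refine ⟨h0, fun he x => ⟨h0 (fun x hx => (he x hx).1) x, ?_⟩⟩
  by_cases hx : x ∈ tsupport (locWeight δ μ M R)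
  · have hd := (((contDiff_locWeight δ μ M R).differentiable (by simp)) x).hasFDerivAt
    have hE : ∀ {Y : Plane → ℝ}, ContDiff ℝ 1 Y → fderiv ℝ (energyTest δ μ r M R Y) x =
        Y x ^ m • fderiv ℝ (locWeight δ μ M R) x +
        locWeight δ μ M R x • ((m : ℝ) * Y x ^ (m - 1)) • fderiv ℝ Y x := by
      intro Y hY
      have h1 : HasFDerivAt (energyTest δ μ r M R Y) _ x :=
        ((((hY.differentiable (by simp)) x).hasFDerivAt).pow m).mul hd
      rw [h1.fderiv, ← Nat.cast_smul_eq_nsmul ℝ, smul_eq_mul]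
    rw [hE hY, hE hY']
    have hsplit : Y x ^ m • fderiv ℝ (locWeight δ μ M R) x +
        locWeight δ μ M R x • ((m : ℝ) * Y x ^ (m - 1)) • fderiv ℝ Y x -
        (Y' x ^ m • fderiv ℝ (locWeight δ μ M R) x +
        locWeight δ μ M R x • ((m : ℝ) * Y' x ^ (m - 1)) • fderiv ℝ Y' x) =
        (Y x ^ m - Y' x ^ m) • fderiv ℝ (locWeight δ μ M R) x +
        (locWeight δ μ M R x * m) • ((Y x ^ (m - 1) - Y' x ^ (m - 1)) • fderiv ℝ Y x +
          Y' x ^ (m - 1) • (fderiv ℝ Y x - fderiv ℝ Y' x)) := by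
      module
    rw [hsplit]
    have h1 := abs_pow_sub_pow_le_of_le hD (hYD x hx).1 (hYD' x hx).1 m
    have h2 := abs_pow_sub_pow_le_of_le hD (hYD x hx).1 (hYD' x hx).1 (m - 1)
    have hee : e ≤ |e| := le_abs_self e
    have h3 : |Y x - Y' x| ≤ |e| := (he x hx).1.trans hee
    have hm1 : D ^ (m - 1) ≤ D ^ m := pow_le_pow_right₀ hD (by omega)
    have e1 : ‖(Y x ^ m - Y' x ^ m) • fderiv ℝ (locWeight δ μ M R) x‖ ≤
        B * m * D ^ (m + 1) * |e| := by
      rw [norm_smul, Real.norm_eq_abs]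
      calc _ ≤ (m * D ^ m * |Y x - Y' x|) * B := by gcongr; exact (hB x).2
        _ ≤ (m * D ^ (m + 1) * |e|) * B := by gcongr
        _ = _ := by ring
    have e2 : ‖(Y x ^ (m - 1) - Y' x ^ (m - 1)) • fderiv ℝ Y x‖ ≤
        (m - 1 : ℕ) * D ^ (m + 1) * |e| := by
      rw [norm_smul, Real.norm_eq_abs]
      calc _ ≤ ((m - 1 : ℕ) * D ^ (m - 1) * |Y x - Y' x|) * D := by gcongr; exact (hYD x hx).2
        _ ≤ ((m - 1 : ℕ) * D ^ m * |e|) * D := by gcongr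
        _ = _ := by rw [pow_succ]; ring
    have e3 : ‖Y' x ^ (m - 1) • (fderiv ℝ Y x - fderiv ℝ Y' x)‖ ≤ D ^ (m + 1) * |e| := by
      rw [norm_smul, norm_pow, Real.norm_eq_abs]
      gcongr
      · calc |Y' x| ^ (m - 1) ≤ D ^ (m - 1) := by gcongr; exact (hYD' x hx).1
          _ ≤ _ := hm1.trans hDm
      · exact (he x hx).2.trans hee
    refine (norm_add_le _ _).trans ?_
    rw [norm_smul (locWeight δ μ M R x * m), norm_mul, Real.norm_natCast, Real.norm_eq_abs]
    calc _ ≤ B * m * D ^ (m + 1) * |e| + B * m *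
          ((m - 1 : ℕ) * D ^ (m + 1) * |e| + D ^ (m + 1) * |e|) := by
          gcongr
          · exact (hB x).1
          · exact (norm_add_le _ _).trans (add_le_add e2 e3)
      _ = C * |e| := by rw [hC]; ring
  · rw [(energyTest_eq_zero (r := r) (Y := Y) hx).2, (energyTest_eq_zero (r := r) (Y := Y') hx).2,
      sub_self, norm_zero]
    positivity

/-- The tangent inequality of the convex function `y ↦ y ^ {2r}`. -/
lemma pow_sub_pow_le_mul {r : ℕ} (hr : 1 ≤ r) (y z : ℝ) :
    y ^ (2 * r) - z ^ (2 * r) ≤ 2 * r * (y ^ (2 * r - 1) * (y - z)) := by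
  have hz : 0 ≤ z ^ (2 * r) := by rw [pow_mul]; positivity
  rcases eq_or_ne y 0 with h0 | h0
  · subst h0
    rw [zero_pow (by omega), zero_pow (by omega)]
    linarith
  have hy : y ^ (2 * r) = y ^ (2 * r - 1) * y := by rw [← pow_succ]; congr 1; omega
  have hy0 : 0 ≤ y ^ (2 * r) := by rw [pow_mul]; positivity
  set a := z / y - 1 with ha
  have hza : z = y * (1 + a) := by rw [ha]; field_simp; ring
  have hbern : 1 + ((2 * r : ℕ) : ℝ) * a ≤ (1 + a) ^ (2 * r) := by
    rcases le_total (-2) a with h | h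
    · exact one_add_mul_le_pow h _
    · have h1 : 0 ≤ (1 + a) ^ (2 * r) := by rw [pow_mul]; positivity
      have h2 : (1 : ℝ) ≤ ((2 * r : ℕ) : ℝ) := by exact_mod_cast (by omega : 1 ≤ 2 * r)
      nlinarith
  have h3 := mul_le_mul_of_nonneg_left hbern hy0
  rw [← mul_pow, ← hza] at h3
  push_cast at h3
  have h4 : 2 * (r : ℝ) * (y ^ (2 * r - 1) * (y - z)) = - (y ^ (2 * r) * (2 * r * a)) := by
    rw [hy, hza]; ring
  rw [h4]; linarith

/-! ### The energy inequality in time -/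

/-- Increments controlled by integrals of `g · b` over short intervals `[a, b]` add up: the
frozen argument `b` is replaced by a piecewise constant one. -/
lemma exists_piecewise_bound {F : ℝ → ℝ} {g : ℝ → ℝ → ℝ} {s η : ℝ} (hη : 0 < η) (n : ℕ) :
    ∀ t, s ≤ t → t - s ≤ n * η →
      (∀ a b, s ≤ a → a ≤ b → b ≤ t → IntervalIntegrable (fun τ => g τ b) volume a b ∧
        F b - F a ≤ ∫ τ in a..b, g τ b) →
      ∃ γ : ℝ → ℝ, IntervalIntegrable γ volume s t ∧ F t - F s ≤ ∫ τ in s..t, γ τ ∧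
        ∀ τ ∈ Set.Ioc s t, ∃ b, τ ≤ b ∧ b ≤ t ∧ b - τ ≤ η ∧ γ τ = g τ b := by
  induction n with
  | zero =>
    intro t hst htn h
    have : t = s := by
      simp only [Nat.cast_zero, zero_mul] at htn; linarith
    subst this
    exact ⟨0, by simp, by simp, fun τ hτ => absurd hτ (by simp)⟩
  | succ n ih =>
    intro t hst htn h
    set a := max s (t - η) with ha
    have hsa : s ≤ a := le_max_left _ _
    have hat : a ≤ t := max_le hst (by linarith)
    have han : a - s ≤ n * η := by
      push_cast at htn
      have : 0 ≤ (n : ℝ) * η := by positivity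
      rcases max_choice s (t - η) with h1 | h1 <;> rw [ha, h1] <;> linarith
    obtain ⟨γ, hγ1, hγ2, hγ3⟩ := ih a hsa han
      fun a' b' h1 h2 h3 => h a' b' h1 h2 (h3.trans hat)
    obtain ⟨hg1, hg2⟩ := h a t hsa hat le_rfl
    set γ' : ℝ → ℝ := fun τ => if τ ≤ a then γ τ else g τ t with hγ'
    have e1 : Set.EqOn γ γ' (Set.uIoc s a) := fun τ hτ => by
      rw [Set.uIoc_of_le hsa] at hτ
      rw [hγ']; simp [hτ.2]
    have e2 : Set.EqOn (fun τ => g τ t) γ' (Set.uIoc a t) := fun τ hτ => by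
      rw [Set.uIoc_of_le hat] at hτ
      rw [hγ']; simp [not_le.2 hτ.1]
    have i1 : IntervalIntegrable γ' volume s a := hγ1.congr e1
    have i2 : IntervalIntegrable γ' volume a t := hg1.congr e2
    refine ⟨γ', i1.trans i2, ?_, fun τ hτ => ?_⟩
    · rw [← intervalIntegral.integral_add_adjacent_intervals i1 i2,
        ← intervalIntegral.integral_congr_ae (ae_of_all _ fun τ hτ => e1 hτ),
        ← intervalIntegral.integral_congr_ae (ae_of_all _ fun τ hτ => e2 hτ)]
      linarith
    · by_cases hτa : τ ≤ a
      · obtain ⟨b, h1, h2, h3, h4⟩ := hγ3 τ ⟨hτ.1, hτa⟩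
        exact ⟨b, h1, h2.trans hat, h3, by rw [hγ']; simp [hτa, h4]⟩
      · refine ⟨t, hτ.2, le_rfl, ?_, by rw [hγ']; simp [hτa]⟩
        have : t - η ≤ a := le_max_right _ _
        linarith

/-- The mollification of a compactly supported continuous function, as a test function. -/
noncomputable def mollifyTest (n : ℕ) (f : Plane → ℝ) (hf : Continuous f)
    (hs : HasCompactSupport f) : TestFun :=
  toTestFun (mollify n f) (contDiff_mollify n hf) (hasCompactSupport_mollify n hs)

/-- The energy inequality for a regular flow. If `G τ φ` is bounded by `H τ`, up to a multiple of
the `C¹` distance of `φ` to the energy test function of `Y τ`, then `H` bounds the growth of the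
`L ^ {2r}` quantity. Since `Y` is not known to be differentiable in time, the inequality is obtained
for the mollification of `Y`, from the convexity of `y ↦ y ^ {2r}` on short time intervals. -/
theorem RegularFlow.mass_sub_le {s t : ℝ} {Y : ℝ → Plane → ℝ} {G : ℝ → TestFun → ℝ}
    (hf : RegularFlow s t Y G) (hst : s ≤ t) {δ μ : ℝ} {r M : ℕ} (hr : 1 ≤ r) (hM : M ≠ 0) {R : ℝ}
    (hR : 1 ≤ R) {H : ℝ → ℝ} (hH : ContinuousOn H (Set.Icc s t)) {C : ℝ} (hC : 0 ≤ C)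
    (hG : ∀ τ ∈ Set.Icc s t, ∀ φ : TestFun,
      tsupport φ ⊆ Metric.cthickening 1 (tsupport (locWeight δ μ M R)) → ∀ e : ℝ, 0 < e →
      C1Close φ (energyTest δ μ r M R (Y τ)) e → G τ φ ≤ H τ + C * e) :
    mass δ μ r M R (Y t) - mass δ μ r M R (Y s) ≤ 2 * r * ∫ τ in s..t, H τ := by
  set K₀ := tsupport (locWeight δ μ M R) with hK₀
  have hK₀c : IsCompact K₀ := hasCompactSupport_locWeight δ μ hM hR
  obtain ⟨D, hD1, hD⟩ := hf.bounded _ (hK₀c.cthickening (r := 1))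
  have hDK : ∀ τ ∈ Set.Icc s t, ∀ x ∈ K₀, |Y τ x| ≤ D ∧ ‖fderiv ℝ (Y τ) x‖ ≤ D :=
    fun τ hτ x hx => hD τ hτ x (Metric.self_subset_cthickening _ hx)
  have hYc : ∀ τ ∈ Set.Icc s t, Continuous (Y τ) := fun τ hτ => (hf.contDiff τ hτ).continuous
  have hm1 : ∀ n, ∀ τ ∈ Set.Icc s t, ContDiff ℝ 1 (mollify n (Y τ)) := fun n τ hτ =>
    (contDiff_mollify n (hYc τ hτ)).of_le (by exact_mod_cast le_top)
  have hmD : ∀ n, ∀ τ ∈ Set.Icc s t, ∀ x ∈ K₀,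
      |mollify n (Y τ) x| ≤ D ∧ ‖fderiv ℝ (mollify n (Y τ)) x‖ ≤ D := by
    intro n τ hτ x hx
    refine ⟨norm_mollify_le_of_thickening (hYc τ hτ) n (fun y hy => (hD τ hτ y hy).1) hx, ?_⟩
    rw [fderiv_mollify n (hf.contDiff τ hτ)]
    exact norm_mollify_le_of_thickening ((hf.contDiff τ hτ).continuous_fderiv (by simp)) n
      (fun y hy => (hD τ hτ y hy).2) hx
  obtain ⟨B, hB0, hB⟩ := exists_energyTest_bound δ μ r hM hR hD1
  obtain ⟨S, hS0, hS⟩ := exists_energyTest_sub_le δ μ r hM hR hD1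
  -- the energy test functions of the mollified flow
  set f : ℕ → ℝ → Plane → ℝ := fun n τ => energyTest δ μ r M R (mollify n (Y τ)) with hfdef
  have hfs : ∀ n τ, HasCompactSupport (f n τ) := fun n τ =>
    hasCompactSupport_energyTest δ μ r hM hR _
  have hf1 : ∀ n, ∀ τ ∈ Set.Icc s t, ContDiff ℝ 1 (f n τ) := fun n τ hτ =>
    contDiff_energyTest δ μ r M R (by exact_mod_cast (le_top : (1 : ℕ∞) ≤ ⊤)) (hm1 n τ hτ)
  have hfK : ∀ n τ, tsupport (mollify n (f n τ)) ⊆ Metric.cthickening 1 K₀ := fun n τ =>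
    (tsupport_mollify_subset n _).trans
      (Metric.cthickening_subset_of_subset 1 (tsupport_energyTest_subset _ _ _ _ _ _))
  have hfb : ∀ n, ∀ τ ∈ Set.Icc s t, ∀ x, |mollify n (f n τ) x| ≤ B ∧
      ‖fderiv ℝ (mollify n (f n τ)) x‖ ≤ B := by
    intro n τ hτ x
    have h1 := hB _ (hm1 n τ hτ) (hmD n τ hτ)
    refine ⟨norm_mollify_le (hf1 n τ hτ).continuous n x fun z _ => (h1 _).1, ?_⟩
    rw [fderiv_mollify n (hf1 n τ hτ)]
    exact norm_mollify_le ((hf1 n τ hτ).continuous_fderiv (by simp)) n x fun z _ => (h1 _).2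
  have hYb : ∀ τ ∈ Set.Icc s t, ∀ x, |energyTest δ μ r M R (Y τ) x| ≤ B ∧
      ‖fderiv ℝ (energyTest δ μ r M R (Y τ)) x‖ ≤ B := fun τ hτ =>
    hB _ (hf.contDiff τ hτ) (hDK τ hτ)
  -- test functions on the grid approximate the diagonal ones
  have hgrid : ∀ n, ∃ η : ℝ, 0 < η ∧ ∀ a ∈ Set.Icc s t, ∀ b ∈ Set.Icc s t, |b - a| ≤ η →
      C1Close (mollify n (f n b)) (mollify n (f n a)) (1 / ((n : ℝ) + 1)) := by
    intro n
    obtain ⟨C₁, hC₁0, hC₁⟩ := hf.exists_mollify_lipschitz n hK₀c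
    obtain ⟨C₂, hC₂0, hC₂⟩ := exists_norm_fderiv_mollify_le n hK₀c
    set A : ℝ := (C₂ + 1) * (S * C₁) with hA
    have hA0 : 0 ≤ A := by positivity
    refine ⟨1 / (((n : ℝ) + 1) * (A + 1)), by positivity, fun a ha b hb hab => ?_⟩
    have h1 : ∀ x, |f n b x - f n a x| ≤ S * |(C₁ * |b - a|)| :=
      (hS _ _ (hm1 n b hb) (hm1 n a ha) (hmD n b hb) (hmD n a ha) _).1 (hC₁ a ha b hb)
    have h2 : S * |(C₁ * |b - a|)| = S * C₁ * |b - a| := by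
      rw [abs_mul, abs_abs, abs_of_nonneg hC₁0]; ring
    rw [h2] at h1
    have hfc := (hf1 n b hb).continuous
    have hfc' := (hf1 n a ha).continuous
    have h3 : ∀ x, mollify n (f n b) x - mollify n (f n a) x =
        mollify n (fun y => f n b y - f n a y) x := fun x => (mollify_sub hfc hfc' n x).symm
    have h3' : (fun x => mollify n (f n b) x - mollify n (f n a) x) =
        mollify n (fun y => f n b y - f n a y) := funext h3
    have h4 : A * |b - a| ≤ 1 / ((n : ℝ) + 1) := by
      calc A * |b - a| ≤ A * (1 / (((n : ℝ) + 1) * (A + 1))) := by gcongr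
        _ = (A / (A + 1)) * (1 / ((n : ℝ) + 1)) := by field_simp
        _ ≤ 1 * (1 / ((n : ℝ) + 1)) := by
          gcongr
          rw [div_le_one (by positivity)]; linarith
        _ = _ := one_mul _
    have hSC : 0 ≤ S * C₁ * |b - a| := by positivity
    intro x
    constructor
    · rw [h3]
      refine (norm_mollify_le (hfc.sub hfc') n x fun z _ => h1 _).trans (le_trans ?_ h4)
      rw [hA]; nlinarith
    · have hd1 := ((contDiff_mollify n hfc).differentiable (by simp)) x
      have hd2 := ((contDiff_mollify n hfc').differentiable (by simp)) x
      rw [← fderiv_fun_sub hd1 hd2, h3']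
      refine (hC₂ _ (hfc.sub hfc') ((tsupport_sub _ _).trans (Set.union_subset
        (tsupport_energyTest_subset _ _ _ _ _ _) (tsupport_energyTest_subset _ _ _ _ _ _)))
        _ h1 x).trans (le_trans ?_ h4)
      rw [hA]; nlinarith
  -- the diagonal test functions converge
  have hdiag : ∀ τ ∈ Set.Icc s t, ∀ e : ℝ, 0 < e → ∀ᶠ n in atTop,
      C1Close (mollify n (f n τ)) (energyTest δ μ r M R (Y τ)) e := by
    intro τ hτ e he
    have hY := hf.contDiff τ hτ
    set g := energyTest δ μ r M R (Y τ) with hg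
    have hg1 : ContDiff ℝ 1 g :=
      contDiff_energyTest δ μ r M R (by exact_mod_cast (le_top : (1 : ℕ∞) ≤ ⊤)) hY
    have hgs : HasCompactSupport g := hasCompactSupport_energyTest δ μ r hM hR _
    have hDg : Continuous (fderiv ℝ g) := hg1.continuous_fderiv (by simp)
    have hDY : Continuous (fderiv ℝ (Y τ)) := hY.continuous_fderiv (by simp)
    set e' : ℝ := e / (2 * (S + 1)) with he'
    have he'0 : 0 < e' := by positivity
    have hSe : S * |e'| ≤ e / 2 := by
      rw [abs_of_pos he'0, he', mul_div_assoc', div_le_div_iff₀ (by positivity) (by norm_num)]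
      nlinarith
    filter_upwards [mollify_sub_le_of_compact hY.continuous hK₀c he'0,
      mollify_sub_le_of_compact hDY hK₀c he'0,
      mollify_sub_le_of_hasCompactSupport hg1.continuous hgs (half_pos he),
      mollify_sub_le_of_hasCompactSupport hDg (hgs.fderiv ℝ) (half_pos he)] with n h1 h2 h3 h4
    have h5 := (hS _ _ (hm1 n τ hτ) hY (hmD n τ hτ) (hDK τ hτ) e').2 fun x hx => by
      refine ⟨h1 x hx, ?_⟩
      rw [fderiv_mollify n hY]; exact h2 x hx
    have hfn := hf1 n τ hτ
    have hDfn : Continuous (fderiv ℝ (f n τ)) := hfn.continuous_fderiv (by simp)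
    intro x
    constructor
    · have h6 : |mollify n (f n τ) x - mollify n g x| ≤ e / 2 := by
        rw [← mollify_sub hfn.continuous hg1.continuous]
        exact norm_mollify_le (hfn.continuous.sub hg1.continuous) n x
          fun z _ => (h5 _).1.trans hSe
      have h7 : |mollify n g x - g x| ≤ e / 2 := h3 x
      have := abs_sub_le (mollify n (f n τ) x) (mollify n g x) (g x)
      linarith
    · have h6 : ‖mollify n (fderiv ℝ (f n τ)) x - mollify n (fderiv ℝ g) x‖ ≤ e / 2 := by
        rw [← mollify_sub hDfn hDg]
        exact norm_mollify_le (hDfn.sub hDg) n x fun z _ => (h5 _).2.trans hSe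
      rw [fderiv_mollify n hfn]
      have h7 := h4 x
      have := norm_sub_le_norm_sub_add_norm_sub (mollify n (fderiv ℝ (f n τ)) x)
        (mollify n (fderiv ℝ g) x) (fderiv ℝ g x)
      linarith
  -- the energy increments of the mollified flow
  set Φ : ℕ → ℝ → TestFun := fun n b => if hb : b ∈ Set.Icc s t then
    mollifyTest n (f n b) (hf1 n b hb).continuous (hfs n b) else 0 with hΦ
  have hΦe : ∀ n, ∀ b ∈ Set.Icc s t, (Φ n b : Plane → ℝ) = mollify n (f n b) := fun n b hb => by
    simp only [hΦ, dif_pos hb]; rfl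
  have hinc : ∀ n a b, s ≤ a → a ≤ b → b ≤ t →
      IntervalIntegrable (fun τ => 2 * r * G τ (Φ n b)) volume a b ∧
      mass δ μ r M R (mollify n (Y b)) - mass δ μ r M R (mollify n (Y a)) ≤
        ∫ τ in a..b, 2 * r * G τ (Φ n b) := by
    intro n a b hsa hab hbt
    have ha : a ∈ Set.Icc s t := ⟨hsa, hab.trans hbt⟩
    have hb : b ∈ Set.Icc s t := ⟨hsa.trans hab, hbt⟩
    obtain ⟨h1, h2⟩ := hf.equation (Φ n b) a b hsa hab hbt
    refine ⟨h1.const_mul _, ?_⟩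
    rw [intervalIntegral.integral_const_mul, ← h2, hΦe n b hb]
    have hfc := (hf1 n b hb).continuous
    have hmc : ∀ τ ∈ Set.Icc s t, Continuous (mollify n (Y τ)) := fun τ hτ => (hm1 n τ hτ).continuous
    have h3 : ∀ τ ∈ Set.Icc s t, ∫ x, Y τ x * mollify n (f n b) x =
        ∫ x, mollify n (Y τ) x * f n b x := fun τ hτ => by
      simp_rw [mul_comm (Y τ _), mul_comm (mollify n (Y τ) _)]
      exact integral_mollify_mul n hfc (hfs n b) (hYc τ hτ)
    have hi : ∀ τ ∈ Set.Icc s t, Integrable fun x => mollify n (Y τ) x * f n b x := fun τ hτ =>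
      ((hmc τ hτ).mul hfc).integrable_of_hasCompactSupport (hfs n b).mul_left
    have hi' : ∀ τ ∈ Set.Icc s t, Integrable fun x =>
        mollify n (Y τ) x ^ (2 * r) * locWeight δ μ M R x := fun τ hτ =>
      integrable_mul_locWeight ((hmc τ hτ).pow _) δ μ hM hR
    rw [h3 b hb, h3 a ha, ← integral_sub (hi b hb) (hi a ha), ← integral_const_mul, mass, mass,
      ← integral_sub (hi' b hb) (hi' a ha)]
    refine integral_mono ((hi' b hb).sub (hi' a ha)) (((hi b hb).sub (hi a ha)).const_mul _)
      fun x => ?_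
    have h4 := mul_le_mul_of_nonneg_right
      (pow_sub_pow_le_mul hr (mollify n (Y b) x) (mollify n (Y a) x))
      (locWeight_nonneg δ μ M R x)
    simp only [hfdef, energyTest]
    linarith
  -- the discretized inequality
  have hex : ∀ n : ℕ, ∃ γ : ℝ → ℝ, IntervalIntegrable γ volume s t ∧
      mass δ μ r M R (mollify n (Y t)) - mass δ μ r M R (mollify n (Y s)) ≤ ∫ τ in s..t, γ τ ∧
      ∀ τ ∈ Set.Ioc s t, ∃ b ∈ Set.Icc s t, γ τ = 2 * r * G τ (Φ n b) ∧
        C1Close (mollify n (f n b)) (mollify n (f n τ)) (1 / ((n : ℝ) + 1)) := by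
    intro n
    obtain ⟨η, hη, hη'⟩ := hgrid n
    obtain ⟨m, hm⟩ := exists_nat_ge ((t - s) / η)
    rw [div_le_iff₀ hη] at hm
    obtain ⟨γ, h1, h2, h3⟩ := exists_piecewise_bound
      (F := fun τ => mass δ μ r M R (mollify n (Y τ))) (g := fun τ b => 2 * r * G τ (Φ n b))
      hη m t hst hm (hinc n)
    refine ⟨γ, h1, h2, fun τ hτ => ?_⟩
    obtain ⟨b, hb1, hb2, hb3, hb4⟩ := h3 τ hτ
    have hb : b ∈ Set.Icc s t := ⟨hτ.1.le.trans hb1, hb2⟩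
    refine ⟨b, hb, hb4, hη' τ ⟨hτ.1.le, hτ.2⟩ b hb ?_⟩
    rw [abs_of_nonneg (by linarith)]; exact hb3
  choose γ hγi hγm hγ using hex
  -- bounds on the integrands
  have hup : ∀ n, ∀ τ ∈ Set.Ioc s t, ∀ e : ℝ, 0 < e →
      C1Close (mollify n (f n τ)) (energyTest δ μ r M R (Y τ)) e →
      γ n τ ≤ 2 * r * (H τ + C * (1 / ((n : ℝ) + 1) + e)) := by
    intro n τ hτ e he hcl
    obtain ⟨b, hb, hb1, hb2⟩ := hγ n τ hτ
    rw [hb1]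
    gcongr
    refine hG τ ⟨hτ.1.le, hτ.2⟩ _ (by rw [hΦe n b hb]; exact hfK n b) _ (by positivity) ?_
    rw [hΦe n b hb]
    intro x
    have h1 := hb2 x
    have h2 := hcl x
    refine ⟨(abs_sub_le _ (mollify n (f n τ) x) _).trans (add_le_add h1.1 h2.1), ?_⟩
    exact (norm_sub_le_norm_sub_add_norm_sub _ (fderiv ℝ (mollify n (f n τ)) x) _).trans
      (add_le_add h1.2 h2.2)
  have hupb : ∀ n, ∀ τ ∈ Set.Ioc s t, γ n τ ≤ 2 * r * (H τ + C * (1 + (2 * B + 1))) := by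
    intro n τ hτ
    have hτ' : τ ∈ Set.Icc s t := ⟨hτ.1.le, hτ.2⟩
    refine (hup n τ hτ (2 * B + 1) (by positivity) fun x => ?_).trans ?_
    · have h1 := hfb n τ hτ' x
      have h2 := hYb τ hτ' x
      refine ⟨(abs_sub _ _).trans ?_, (norm_sub_le _ _).trans ?_⟩
      · linarith [h1.1, h2.1]
      · linarith [h1.2, h2.2]
    · gcongr
      exact one_div_succ_le_one n
  have hHi : IntervalIntegrable H volume s t := by
    refine ContinuousOn.intervalIntegrable ?_
    rwa [Set.uIcc_of_le hst]
  -- passage to the limit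
  have hlim : Tendsto (fun n => ∫ τ in s..t, max (γ n τ) (2 * r * H τ)) atTop
      (𝓝 (∫ τ in s..t, 2 * r * H τ)) := by
    refine intervalIntegral.tendsto_integral_filter_of_dominated_convergence
      (fun τ => |2 * r * H τ| + 2 * r * (C * (1 + (2 * B + 1)))) (Eventually.of_forall fun n => ?_)
      (Eventually.of_forall fun n => ae_of_all _ fun τ hτ => ?_)
      (((hHi.const_mul _).abs).add intervalIntegrable_const)
      (ae_of_all _ fun τ hτ => ?_)
    · exact (hγi n).def'.aestronglyMeasurable.sup ((hHi.const_mul _).def'.aestronglyMeasurable)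
    · rw [Set.uIoc_of_le hst] at hτ
      have h1 := hupb n τ hτ
      have h2 : 0 ≤ 2 * r * (C * (1 + (2 * B + 1))) := by positivity
      rw [Real.norm_eq_abs, abs_le]
      constructor
      · have := neg_abs_le (2 * r * H τ)
        exact le_trans (by linarith) (le_max_right _ _)
      · have := le_abs_self (2 * r * H τ)
        refine max_le ?_ (by linarith)
        linarith
    · rw [Set.uIoc_of_le hst] at hτ
      have hτ' : τ ∈ Set.Icc s t := ⟨hτ.1.le, hτ.2⟩
      rw [Metric.tendsto_atTop]
      intro e he
      set e' : ℝ := e / (4 * (2 * r * C + 1)) with he'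
      have he'0 : 0 < e' := by positivity
      have h1 : ∀ᶠ n : ℕ in atTop, 1 / ((n : ℝ) + 1) < e' :=
        tendsto_one_div_add_atTop_nhds_zero_nat.eventually_lt_const he'0
      obtain ⟨N, hN⟩ := eventually_atTop.1 (h1.and (hdiag τ hτ' e' he'0))
      refine ⟨N, fun n hn => ?_⟩
      obtain ⟨h2, h3⟩ := hN n hn
      have h4 := hup n τ hτ e' he'0 h3
      have h5 : 2 * r * C * (1 / ((n : ℝ) + 1) + e') < e := by
        have h6 : 2 * r * C * (1 / ((n : ℝ) + 1) + e') ≤ 2 * r * C * (2 * e') := by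
          gcongr; linarith
        have h7 : 2 * r * C * (2 * e') < e := by
          rw [he', mul_div_assoc', mul_div_assoc', div_lt_iff₀ (by positivity)]
          have : 0 ≤ 2 * r * C := by positivity
          nlinarith
        linarith
      rw [Real.dist_eq, abs_of_nonneg (sub_nonneg.2 (le_max_right _ _)), sub_lt_iff_lt_add]
      refine max_lt ?_ (by linarith)
      linarith
  have hmass : ∀ τ ∈ Set.Icc s t, Tendsto (fun n => mass δ μ r M R (mollify n (Y τ))) atTop
      (𝓝 (mass δ μ r M R (Y τ))) := by
    intro τ hτ
    have hI0 : 0 ≤ ∫ x, locWeight δ μ M R x := integral_nonneg fun x => locWeight_nonneg _ _ _ _ _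
    have h1 : Tendsto (fun n : ℕ => 2 * r * D ^ (2 * r) * (∫ x, locWeight δ μ M R x) *
        (D * (1 / ((n : ℝ) + 1)))) atTop (𝓝 (2 * r * D ^ (2 * r) *
        (∫ x, locWeight δ μ M R x) * (D * 0))) :=
      (tendsto_one_div_add_atTop_nhds_zero_nat.const_mul D).const_mul _
    rw [mul_zero, mul_zero] at h1
    rw [tendsto_iff_norm_sub_tendsto_zero]
    refine squeeze_zero (fun n => norm_nonneg _) (fun n => ?_) h1
    exact abs_mass_sub_le hM hR (hm1 n τ hτ).continuous (hYc τ hτ) hD1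
      (fun x hx => (hmD n τ hτ x hx).1) (fun x hx => (hDK τ hτ x hx).1)
      fun x hx => abs_mollify_sub_le (hf.contDiff τ hτ) n x fun y hy =>
        (hD τ hτ y (closedBall_subset_cthickening hx hy)).2
  rw [← intervalIntegral.integral_const_mul]
  refine le_of_tendsto_of_tendsto' ((hmass t ⟨hst, le_rfl⟩).sub (hmass s ⟨le_rfl, hst⟩)) hlim
    fun n => (hγm n).trans ?_
  refine intervalIntegral.integral_mono_on hst (hγi n) ?_ fun τ hτ => le_max_left _ _
  exact intervalIntegrable_iff.2 ((hγi n).def'.sup (hHi.const_mul _).def')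

/-! ### Coming down from infinity -/

/-- A nonnegative function with `F' ≤ -c F ^ l + K` in integrated form, with `l > 1`, is bounded at
time `t` independently of its values at earlier times. -/
theorem le_of_integral_inequality {F : ℝ → ℝ} {s t c K l : ℝ} (hst : s < t)
    (hF : ContinuousOn F (Set.Icc s t)) (h0 : ∀ τ ∈ Set.Icc s t, 0 ≤ F τ) (hc : 0 < c) (hK : 0 ≤ K)
    (hl : 1 < l) (h : ∀ a b, s ≤ a → a ≤ b → b ≤ t →
      F b - F a ≤ ∫ τ in a..b, (-(c * F τ ^ l) + K)) :
    F t ≤ max ((2 * K / c) ^ (1 / l)) ((c / 2 * (l - 1) * (t - s)) ^ (-(1 / (l - 1)))) := by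
  set A : ℝ := (2 * K / c) ^ (1 / l) with hA
  have hA0 : 0 ≤ A := by positivity
  have hAl : c * A ^ l = 2 * K := by
    rw [hA, ← Real.rpow_mul (by positivity), one_div_mul_cancel (by linarith), Real.rpow_one]
    field_simp
  have ht : t ∈ Set.Icc s t := ⟨hst.le, le_rfl⟩
  by_contra hcon
  push Not at hcon
  obtain ⟨hFA, hFt⟩ := max_lt_iff.1 hcon
  have hFl : ContinuousOn (fun τ => F τ ^ l) (Set.Icc s t) :=
    hF.rpow_const fun _ _ => Or.inr (by linarith)
  -- the level `A` is never reached
  have habove : ∀ τ ∈ Set.Icc s t, A < F τ := by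
    by_contra hex
    push Not at hex
    set S : Set ℝ := Set.Icc s t ∩ F ⁻¹' Set.Iic A with hS
    have hSc : IsClosed S := hF.preimage_isClosed_of_isClosed isClosed_Icc isClosed_Iic
    have hSne : S.Nonempty := by
      obtain ⟨τ, hτ, hτA⟩ := hex
      exact ⟨τ, hτ, hτA⟩
    have hSb : BddAbove S := ⟨t, fun τ hτ => hτ.1.2⟩
    have hσ : sSup S ∈ S := hSc.csSup_mem hSne hSb
    set σ := sSup S with hσd
    have h1 := h σ t hσ.1.1 hσ.1.2 le_rfl
    have h2 : ∫ τ in σ..t, (-(c * F τ ^ l) + K) ≤ 0 := by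
      rw [intervalIntegral.integral_of_le hσ.1.2]
      refine setIntegral_nonpos measurableSet_Ioc fun τ hτ => ?_
      have hτA : A ≤ F τ := by
        by_contra hlt
        have : τ ∈ S := ⟨⟨hσ.1.1.trans hτ.1.le, hτ.2⟩, (not_le.1 hlt).le⟩
        exact absurd (le_csSup hSb this) (not_le.2 hτ.1)
      have : A ^ l ≤ F τ ^ l := Real.rpow_le_rpow hA0 hτA (by linarith)
      nlinarith
    have h3 : F σ ≤ A := hσ.2
    linarith
  have hFpos : ∀ τ ∈ Set.Icc s t, 0 < F τ := fun τ hτ => hA0.trans_lt (habove τ hτ)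
  -- a continuous extension, and the solution of the associated integral equation
  set g : ℝ → ℝ := Set.IccExtend hst.le (Set.domRestrict (Set.Icc s t) fun τ => F τ ^ l) with hg
  have hgc : Continuous g := hFl.domRestrict.Icc_extend'
  have hgF : ∀ τ ∈ Set.Icc s t, g τ = F τ ^ l := fun τ hτ => by
    rw [hg, Set.IccExtend_of_mem _ _ hτ]; rfl
  have hdec : ∀ a ∈ Set.Icc s t, F t + c / 2 * ∫ τ in a..t, g τ ≤ F a := by
    intro a ha
    have h1 := h a t ha.1 ha.2 le_rfl
    have h2 : ∫ τ in a..t, (-(c * F τ ^ l) + K) ≤ ∫ τ in a..t, -(c / 2) * g τ := by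
      have hsub : Set.Icc a t ⊆ Set.Icc s t := Set.Icc_subset_Icc_left ha.1
      refine intervalIntegral.integral_mono_on ha.2 ?_ ((hgc.const_mul _).intervalIntegrable _ _)
        fun τ hτ => ?_
      · refine ContinuousOn.intervalIntegrable ?_
        rw [Set.uIcc_of_le ha.2]
        exact (((hFl.mono hsub).const_mul c).neg).add continuousOn_const
      · have hτ' := hsub hτ
        rw [hgF τ hτ']
        have : A ^ l ≤ F τ ^ l := Real.rpow_le_rpow hA0 (habove τ hτ').le (by linarith)
        nlinarith
    rw [intervalIntegral.integral_const_mul] at h2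
    linarith
  set v : ℝ → ℝ := fun a => F t + c / 2 * ∫ τ in a..t, g τ with hv
  have hvt : v t = F t := by simp [hv]
  have hg0 : ∀ τ ∈ Set.Icc s t, 0 ≤ g τ := fun τ hτ => by
    rw [hgF τ hτ]; exact Real.rpow_nonneg (h0 τ hτ) _
  have hvpos : ∀ a ∈ Set.Icc s t, 0 < v a := fun a ha => by
    have h1 : 0 ≤ ∫ τ in a..t, g τ := intervalIntegral.integral_nonneg ha.2 fun τ hτ =>
      hg0 τ ⟨ha.1.trans hτ.1, hτ.2⟩
    have h2 := hFpos t ht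
    simp only [hv]
    positivity
  have hvd : ∀ a, HasDerivAt v (-(c / 2) * g a) a := fun a => by
    have h1 : HasDerivAt (fun a => ∫ τ in a..t, g τ) (-g a) a :=
      intervalIntegral.integral_hasDerivAt_left (hgc.intervalIntegrable _ _)
        (hgc.stronglyMeasurableAtFilter _ _) hgc.continuousAt
    have h2 : HasDerivAt v (c / 2 * -g a) a := (h1.const_mul (c / 2)).const_add (F t)
    exact h2.congr_deriv (by ring)
  have hwd : ∀ a ∈ Set.Icc s t, HasDerivAt (fun a => v a ^ (-(l - 1)))
      (-(c / 2) * g a * (-(l - 1)) * v a ^ (-(l - 1) - 1)) a := fun a ha =>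
    (hvd a).rpow_const (Or.inl (hvpos a ha).ne')
  have hmean := Convex.mul_sub_le_image_sub_of_le_deriv (convex_Icc s t)
    (f := fun a => v a ^ (-(l - 1))) (C := c / 2 * (l - 1))
    (fun a ha => (hwd a ha).continuousAt.continuousWithinAt)
    (fun a ha => (hwd a (interior_subset ha)).differentiableAt.differentiableWithinAt)
    (fun a ha => by
      have ha' := interior_subset ha
      rw [(hwd a ha').deriv, hgF a ha']
      have h1 : v a ^ l ≤ F a ^ l :=
        Real.rpow_le_rpow (hvpos a ha').le (hdec a ha') (by linarith)
      have h2 : v a ^ (-(l - 1) - 1) = (v a ^ l)⁻¹ := by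
        rw [← Real.rpow_neg (hvpos a ha').le]; congr 1; ring
      have h3 : 0 < v a ^ l := Real.rpow_pos_of_pos (hvpos a ha') _
      rw [h2]
      have h4 : 1 ≤ F a ^ l * (v a ^ l)⁻¹ := by
        rw [← div_eq_mul_inv, one_le_div h3]; exact h1
      have h5 : 0 < c / 2 * (l - 1) := mul_pos (by positivity) (by linarith)
      calc c / 2 * (l - 1) ≤ c / 2 * (l - 1) * (F a ^ l * (v a ^ l)⁻¹) :=
            le_mul_of_one_le_right h5.le h4
        _ = _ := by ring)
    s ⟨le_rfl, hst.le⟩ t ht hst.le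
  simp only [hvt] at hmean
  have hvs : 0 < v s ^ (-(l - 1)) := Real.rpow_pos_of_pos (hvpos s ⟨le_rfl, hst.le⟩) _
  have hFt0 := hFpos t ht
  have hX : 0 < c / 2 * (l - 1) * (t - s) :=
    mul_pos (mul_pos (by positivity) (by linarith)) (by linarith)
  have h1 : c / 2 * (l - 1) * (t - s) ≤ F t ^ (-(l - 1)) := by linarith
  have h2 := Real.rpow_le_rpow_of_nonpos hX h1
    (show -(1 / (l - 1)) ≤ 0 by
      have : 0 < 1 / (l - 1) := one_div_pos.2 (by linarith)
      linarith)
  rw [← Real.rpow_mul hFt0.le] at h2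
  have h3 : -(l - 1) * -(1 / (l - 1)) = 1 := by
    have : l - 1 ≠ 0 := by linarith
    field_simp
  rw [h3, Real.rpow_one] at h2
  linarith

lemma integral_weight_measure_lt_top {δ μ : ℝ} (hδ : 0 < δ) (hμ : 0 < μ) :
    (volume.withDensity fun x => ENNReal.ofReal (weight δ μ x)) Set.univ < ⊤ := by
  rw [withDensity_apply _ MeasurableSet.univ, Measure.restrict_univ]
  exact (integrable_weight hδ hμ).lintegral_lt_top

lemma weightedLpNorm_eq_eLpNorm {δ p μ : ℝ} (hp : 0 < p) (f : Plane → ℝ) (hf : Continuous f) :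
    weightedLpNorm δ p μ f = eLpNorm f (ENNReal.ofReal p)
      (volume.withDensity fun x => ENNReal.ofReal (weight δ μ x)) := by
  rw [eLpNorm_eq_lintegral_rpow_enorm_toReal (by simpa using hp) ENNReal.ofReal_ne_top,
    ENNReal.toReal_ofReal hp.le, weightedLpNorm,
    lintegral_withDensity_eq_lintegral_mul₀ (by
      exact (continuous_weight δ μ).measurable.ennreal_ofReal.aemeasurable)
      (by exact (hf.enorm.measurable.pow_const p).aemeasurable)]
  congr 1
  refine lintegral_congr fun x => ?_
  rw [Pi.mul_apply, mul_comm]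

/-- The weight has finite mass, so the weighted norms are ordered. -/
lemma exists_weightedLpNorm_le {δ μ p P : ℝ} (hδ : 0 < δ) (hμ : 0 < μ) (hp : 0 < p) (hpP : p ≤ P) :
    ∃ C : ℝ≥0, ∀ f : Plane → ℝ, Continuous f →
      weightedLpNorm δ p μ f ≤ C * weightedLpNorm δ P μ f := by
  set m := volume.withDensity fun x => ENNReal.ofReal (weight δ μ x) with hm
  have hfin : m Set.univ ^ (1 / (ENNReal.ofReal p).toReal - 1 / (ENNReal.ofReal P).toReal) ≠ ⊤ := by
    refine (ENNReal.rpow_lt_top_of_nonneg ?_ (integral_weight_measure_lt_top hδ hμ).ne).ne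
    rw [ENNReal.toReal_ofReal hp.le, ENNReal.toReal_ofReal (hp.le.trans hpP), sub_nonneg]
    exact one_div_le_one_div_of_le hp hpP
  refine ⟨(m Set.univ ^ (1 / (ENNReal.ofReal p).toReal -
    1 / (ENNReal.ofReal P).toReal)).toNNReal, fun f hf => ?_⟩
  · rw [weightedLpNorm_eq_eLpNorm hp f hf, weightedLpNorm_eq_eLpNorm (hp.trans_le hpP) f hf,
      ENNReal.coe_toNNReal hfin, mul_comm]
    exact eLpNorm_le_eLpNorm_mul_rpow_measure_univ (ENNReal.ofReal_le_ofReal hpP)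
      hf.aestronglyMeasurable

/-- Bounds on the localized `L ^ {2r}` quantities pass to the weighted norm. -/
lemma weightedLpNorm_le_of_mass_le {δ μ : ℝ} {r M : ℕ} (hr : 1 ≤ r) (hM : M ≠ 0) {Y : Plane → ℝ}
    (hY : Continuous Y) {b : ℝ} (h : ∀ R : ℝ, 1 ≤ R → mass δ μ r M R Y ≤ b) :
    weightedLpNorm δ (2 * r) μ Y ≤ ENNReal.ofReal (b ^ (1 / (2 * r : ℝ))) := by
  have hr0 : (0 : ℝ) < 2 * r := by
    have : (1 : ℝ) ≤ r := by exact_mod_cast hr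
    linarith
  have hb : 0 ≤ b := (mass_nonneg δ μ r M 1 Y).trans (h 1 le_rfl)
  have hYr : ∀ x, ‖Y x‖ₑ ^ (2 * r : ℝ) = ENNReal.ofReal (Y x ^ (2 * r)) := fun x => by
    rw [← ofReal_norm, ENNReal.ofReal_rpow_of_nonneg (norm_nonneg _) hr0.le]
    congr 1
    rw [show (2 * r : ℝ) = ((2 * r : ℕ) : ℝ) by push_cast; ring, Real.rpow_natCast,
      Real.norm_eq_abs, Even.pow_abs ⟨r, by ring⟩]
  have hpos : ∀ x, 0 ≤ Y x ^ (2 * r) := fun x => by rw [pow_mul]; positivity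
  have hmass : ∀ n : ℕ, ∫⁻ x, ENNReal.ofReal (Y x ^ (2 * r) * locWeight δ μ M (n + 1) x) ≤
      ENNReal.ofReal b := fun n => by
    have hR : (1 : ℝ) ≤ n + 1 := by linarith [show (0 : ℝ) ≤ n from n.cast_nonneg]
    have hi : Integrable fun x => Y x ^ (2 * r) * locWeight δ μ M (n + 1) x :=
      integrable_mul_locWeight (hY.pow _) δ μ hM hR
    rw [← ofReal_integral_eq_lintegral_ofReal hi
      (ae_of_all _ fun x => mul_nonneg (hpos x) (locWeight_nonneg _ _ _ _ _))]
    exact ENNReal.ofReal_le_ofReal (h _ hR)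
  have key : ∫⁻ x, ‖Y x‖ₑ ^ (2 * r : ℝ) * ENNReal.ofReal (weight δ μ x) ≤ ENNReal.ofReal b := by
    calc ∫⁻ x, ‖Y x‖ₑ ^ (2 * r : ℝ) * ENNReal.ofReal (weight δ μ x)
        = ∫⁻ x, liminf (fun n : ℕ =>
            ENNReal.ofReal (Y x ^ (2 * r) * locWeight δ μ M (n + 1) x)) atTop := by
          refine lintegral_congr fun x => ?_
          have : Tendsto (fun n : ℕ => ENNReal.ofReal (Y x ^ (2 * r) * locWeight δ μ M (n + 1) x))
              atTop (𝓝 (ENNReal.ofReal (Y x ^ (2 * r) * weight δ μ x))) := by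
            refine tendsto_const_nhds.congr' ?_
            filter_upwards [eventually_ge_atTop ⌈‖x‖⌉₊] with n hn
            have hx : ‖x‖ ≤ n := (Nat.le_ceil _).trans (by exact_mod_cast hn)
            rw [locWeight, cut_eq_one (by linarith [norm_nonneg x]) (by linarith), one_pow, mul_one]
          rw [this.liminf_eq, hYr, ENNReal.ofReal_mul (hpos x)]
      _ ≤ liminf (fun n : ℕ =>
            ∫⁻ x, ENNReal.ofReal (Y x ^ (2 * r) * locWeight δ μ M (n + 1) x)) atTop := by
          refine lintegral_liminf_le fun n => ?_
          exact (((hY.pow _).mul (continuous_locWeight _ _ _ _)).measurable).ennreal_ofReal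
      _ ≤ ENNReal.ofReal b := by
          refine liminf_le_of_frequently_le' (Frequently.of_forall hmass)
  rw [weightedLpNorm, ← ENNReal.ofReal_rpow_of_nonneg hb (by positivity)]
  exact ENNReal.rpow_le_rpow key (by positivity)

/-- The bound on the `L ^ {2r}` norm, in terms of a bound `β` on the noise. -/
theorem exists_apriori_bound {χ₀ χ₁ : Plane → ℝ} {δ p q μ₀ ε : ℝ} {A : ℝ≥0}
    (hD : DualityBound χ₀ χ₁ δ p q μ₀ ε A) (hpq : p.HolderConjugate q) (hε : 0 ≤ ε)
    (hε2 : ε ≤ 1 / 2) (hδ : 0 < δ) (hδ1 : δ ≤ 1) {μ : ℝ} (hμ : 0 < μ)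
    {r k M L : ℕ} (hr : 1 ≤ r) (hk : 3 ≤ k) (hMk : M + 1 = 2 * r + k) (hML : M = 2 * L)
    (hq : q = 4 * M / (4 * M - 1)) (hν : μ₀ / p ≤ μ / (4 * M)) (hεk : ε * (4 * k + 2) ≤ 1) :
    ∃ C : ℝ, 0 ≤ C ∧ ∀ T : ℝ, ∀ (X₀ : Distr) (Z : ℕ → ℝ → Distr) (Y : ℝ → Plane → ℝ),
      IsSolution δ k T X₀ Z Y → ∀ t β : ℝ, 0 < t → t ≤ T → 0 ≤ β →
      (∀ τ, 0 < τ → τ ≤ t → ∀ ℓ ≤ k,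
        besovNorm χ₀ χ₁ δ (-ε) μ₀ p p (Z ℓ τ) ≤ ENNReal.ofReal β) →
      weightedLpNorm δ (2 * r) μ (Y t) ≤ ENNReal.ofReal
        (C * max (t ^ (-(1 / ((k : ℝ) - 1)))) ((1 + β ^ p) ^ (1 / (M : ℝ)))) := by
  obtain ⟨C₀, hC₀, hcut⟩ := exists_norm_fderiv_cut_le
  obtain ⟨c, K, hc, hK, hE⟩ := exists_energy_estimate hδ hδ1 hμ hr hk hMk hML hpq hC₀
    (a := k * A * (M + μ + M * C₀)) (by positivity)
  have hM0 : M ≠ 0 := by omega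
  have hr0 : (0 : ℝ) < r := by exact_mod_cast hr
  have hMr : (0 : ℝ) < M := by exact_mod_cast Nat.pos_of_ne_zero hM0
  have hk1 : (0 : ℝ) < k - 1 := by
    have : (3 : ℝ) ≤ k := by exact_mod_cast hk
    linarith
  set l : ℝ := (M : ℝ) / (2 * r) with hl
  have hMk' : (M : ℝ) = 2 * r + (k - 1) := by
    have : (M : ℝ) + 1 = 2 * r + k := by exact_mod_cast hMk
    linarith
  have hl1 : l - 1 = (k - 1) / (2 * r) := by
    rw [hl, hMk']; field_simp; ring
  have hl0 : 1 < l := by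
    have : 0 < l - 1 := by rw [hl1]; positivity
    linarith
  set c₁ : ℝ := 2 * r * c / 2 * (l - 1) / 2 with hc₁
  have hc₁0 : 0 < c₁ := by
    have : 0 < l - 1 := by linarith
    positivity
  refine ⟨(2 * K / c) ^ (1 / (M : ℝ)) + c₁ ^ (-(1 / ((k : ℝ) - 1))), by positivity,
    fun T X₀ Z Y hsol t β ht htT hβ hZ => ?_⟩
  obtain ⟨N, hN, heq⟩ := hsol.equation
  have hp := hpq.pos
  have hs : 0 < t / 2 := half_pos ht
  have hst : t / 2 < t := half_lt_self ht
  have hflow := hsol.regularFlow hD hpq.symm.pos hε2 hN heq hs hst.le htT hβ hZ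
  set b : ℝ := max ((2 * (2 * r * (K * (1 + β ^ p))) / (2 * r * c)) ^ (1 / l))
    ((2 * r * c / 2 * (l - 1) * (t - t / 2)) ^ (-(1 / (l - 1)))) with hb
  have hβp : 0 ≤ β ^ p := Real.rpow_nonneg hβ p
  have hmass : ∀ R : ℝ, 1 ≤ R → mass δ μ r M R (Y t) ≤ b := by
    intro R hR
    have hcont := hflow.continuousOn_mass δ μ r hM0 hR
    refine le_of_integral_inequality hst hcont (fun τ _ => mass_nonneg _ _ _ _ _ _)
      (by positivity) (by positivity) hl0 fun a d ha had hd => ?_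
    have had' : Set.Icc a d ⊆ Set.Icc (t / 2) t := Set.Icc_subset_Icc ha hd
    have hZ' : ∀ τ, 0 < τ → τ ≤ d → ∀ ℓ ≤ k,
        besovNorm χ₀ χ₁ δ (-ε) μ₀ p p (Z ℓ τ) ≤ ENNReal.ofReal β :=
      fun τ h1 h2 => hZ τ h1 (h2.trans hd)
    have hflow' := hsol.regularFlow hD hpq.symm.pos hε2 hN heq (hs.trans_le ha) had
      (hd.trans htT) hβ hZ'
    obtain ⟨C', hC'0, hC'⟩ := hsol.exists_flowFunctional_le hD hpq.symm.pos hε hε2 hδ hδ1 hμ hr hk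
      hMk hML hq hν hεk hN (hs.trans_le ha) had (hd.trans htT) hβ hZ' hR hC₀ (hcut R hR)
      ((hasCompactSupport_locWeight δ μ hM0 hR).isCompact.cthickening (r := 1))
      (Metric.self_subset_cthickening _)
    have hH : ContinuousOn (fun τ => -(c * mass δ μ r M R (Y τ) ^ l) + K * (1 + β ^ p))
        (Set.Icc a d) :=
      ((((hcont.mono had').rpow_const fun _ _ => Or.inr (by linarith)).const_mul c).neg).add
        continuousOn_const
    have h1 := hflow'.mass_sub_le had hr hM0 hR hH hC'0 fun τ hτ φ hφ e he hcl =>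
      (hC' τ hτ φ hφ e he hcl).trans (by
        have := hE R hR (hcut R hR) (Y τ) (hflow'.contDiff τ hτ) β hβ
        linarith)
    refine h1.trans (le_of_eq ?_)
    rw [← intervalIntegral.integral_const_mul]
    refine intervalIntegral.integral_congr fun τ _ => ?_
    ring
  refine (weightedLpNorm_le_of_mass_le hr hM0 (hsol.contDiff t ht htT).continuous hmass).trans
    (ENNReal.ofReal_le_ofReal ?_)
  set m := max (t ^ (-(1 / ((k : ℝ) - 1)))) ((1 + β ^ p) ^ (1 / (M : ℝ))) with hm
  have hm1 : t ^ (-(1 / ((k : ℝ) - 1))) ≤ m := le_max_left _ _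
  have hm2 : (1 + β ^ p) ^ (1 / (M : ℝ)) ≤ m := le_max_right _ _
  have hm0 : 0 ≤ m := (Real.rpow_nonneg ht.le _).trans hm1
  have hK0 : 0 ≤ (2 * K / c) ^ (1 / (M : ℝ)) := by positivity
  have hc0 : 0 ≤ c₁ ^ (-(1 / ((k : ℝ) - 1))) := by positivity
  have hβ1 : 0 ≤ 1 + β ^ p := by positivity
  rcases max_choice ((2 * (2 * r * (K * (1 + β ^ p))) / (2 * r * c)) ^ (1 / l))
    ((2 * r * c / 2 * (l - 1) * (t - t / 2)) ^ (-(1 / (l - 1)))) with h | h <;> rw [hb, h]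
  · have e1 : 2 * (2 * r * (K * (1 + β ^ p))) / (2 * r * c) = 2 * K / c * (1 + β ^ p) := by
      field_simp
    have e2 : 1 / l * (1 / (2 * r)) = 1 / (M : ℝ) := by rw [hl]; field_simp
    rw [e1, ← Real.rpow_mul (by positivity), e2, Real.mul_rpow (by positivity) hβ1]
    calc _ ≤ (2 * K / c) ^ (1 / (M : ℝ)) * m := by gcongr
      _ ≤ _ := by
        rw [add_mul]
        exact le_add_of_nonneg_right (by positivity)
  · have e1 : 2 * r * c / 2 * (l - 1) * (t - t / 2) = c₁ * t := by rw [hc₁]; ring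
    have e2 : -(1 / (l - 1)) * (1 / (2 * r)) = -(1 / ((k : ℝ) - 1)) := by
      rw [hl1]; field_simp
    rw [e1, ← Real.rpow_mul (by positivity), e2, Real.mul_rpow hc₁0.le ht.le]
    calc _ ≤ c₁ ^ (-(1 / ((k : ℝ) - 1))) * m := by gcongr
      _ ≤ _ := by
        rw [add_mul]
        exact le_add_of_nonneg_left (by positivity)

/-- A noise bounded below absorbs constants and lower powers. -/
lemma exists_one_add_rpow_le {c p e M : ℝ} (hc : 0 < c) (hp : 0 < p) (hM : 0 < M)
    (he : p / M ≤ e) :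
    ∃ C : ℝ, 0 ≤ C ∧ ∀ β : ℝ, c ≤ β → (1 + β ^ p) ^ (1 / M) ≤ C * β ^ e := by
  refine ⟨(c ^ (-p) + 1) ^ (1 / M) * c ^ (p / M - e), by positivity, fun β hβ => ?_⟩
  have hβ0 : 0 < β := hc.trans_le hβ
  have h1 : 1 + β ^ p ≤ (c ^ (-p) + 1) * β ^ p := by
    have : 1 ≤ c ^ (-p) * β ^ p := by
      rw [Real.rpow_neg hc.le, ← div_eq_inv_mul, one_le_div (by positivity)]
      exact Real.rpow_le_rpow hc.le hβ hp.le
    linarith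
  have h2 : β ^ (p / M) ≤ c ^ (p / M - e) * β ^ e := by
    have h3 : β ^ (p / M) = β ^ (p / M - e) * β ^ e := by
      rw [← Real.rpow_add hβ0]; congr 1; ring
    rw [h3]
    refine mul_le_mul_of_nonneg_right ?_ (by positivity)
    exact Real.rpow_le_rpow_of_nonpos hc hβ (by linarith)
  calc (1 + β ^ p) ^ (1 / M) ≤ ((c ^ (-p) + 1) * β ^ p) ^ (1 / M) := by gcongr
    _ = (c ^ (-p) + 1) ^ (1 / M) * β ^ (p / M) := by
      rw [Real.mul_rpow (by positivity) (by positivity), ← Real.rpow_mul hβ0.le]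
      congr 2; ring
    _ ≤ (c ^ (-p) + 1) ^ (1 / M) * (c ^ (p / M - e) * β ^ e) := by gcongr
    _ = _ := by ring

end ComingDown

theorem proposition3p1
    (θ₀ δ : ℝ) (hθ₀ : 1 ≤ θ₀) (hδ : 0 < δ) (hδθ : δ < 1 / θ₀)
    (χ₀ χ₁ : ComingDown.Plane → ℝ) (hχ : ComingDown.IsLittlewoodPaleyPair θ₀ χ₀ χ₁)
    (k : ℕ) (hk : Odd k) (hk3 : 3 ≤ k)
    (p μ : ℝ) (hp : 1 ≤ p) (hμ : 0 < μ)
    (ε₁ P₁ : ℝ) (hε₁ : 0 < ε₁) :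
    ∃ (lam ε p₀ μ₀ : ℝ) (C : ℝ≥0),
      1 < lam ∧ 0 < ε ∧ ε < ε₁ ∧ 1 ≤ p₀ ∧ P₁ ≤ p₀ ∧ 0 < μ₀ ∧ μ₀ < μ ∧
      ∀ T : ℝ, 0 < T → ∀ (X₀ : ComingDown.Distr) (Z : ℕ → ℝ → ComingDown.Distr)
        (Y : ℝ → ComingDown.Plane → ℝ), ComingDown.IsSolution δ k T X₀ Z Y →
        ∀ t : ℝ, 0 < t → t ≤ T →
          ComingDown.weightedLpNorm δ p μ (Y t) ≤
            (C : ℝ≥0∞) * max (ENNReal.ofReal (t ^ (-(1 / ((lam - 1) * p)))))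
              (⨆ t' ∈ Set.Ioc (0 : ℝ) t, ∑ ℓ ∈ Finset.range (k + 1),
                ComingDown.besovNorm χ₀ χ₁ δ (-ε) μ₀ p₀ p₀ (Z ℓ t') ^ (p₀ / (lam * p))) := by
  obtain ⟨κ, hκ⟩ := hk
  -- the energy estimate is run in `L ^ {2r}` with `r` beyond `p` and `P₁`
  set r : ℕ := ⌈p⌉₊ + ⌈P₁⌉₊ with hr
  set M : ℕ := 2 * (r + κ) with hM
  have hpr : p ≤ r := by
    rw [hr]; push_cast
    have := Nat.le_ceil p
    have h0 : (0 : ℝ) ≤ (⌈P₁⌉₊ : ℝ) := Nat.cast_nonneg _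
    linarith
  have hPr : P₁ ≤ r := by
    rw [hr]; push_cast
    have := Nat.le_ceil P₁
    have h0 : (0 : ℝ) ≤ (⌈p⌉₊ : ℝ) := Nat.cast_nonneg _
    linarith
  have hr1' : (1 : ℝ) ≤ r := hp.trans hpr
  have hr1 : 1 ≤ r := by exact_mod_cast hr1'
  have hk3' : (3 : ℝ) ≤ k := by exact_mod_cast hk3
  have hMk : M + 1 = 2 * r + k := by omega
  have hMk' : (M : ℝ) = 2 * r + k - 1 := by
    have : (M : ℝ) + 1 = 2 * r + k := by exact_mod_cast hMk
    linarith
  have hM1 : (1 : ℝ) < 4 * M := by linarith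
  have hM0 : (0 : ℝ) < M := by linarith
  have hδ1 : δ ≤ 1 := hδθ.le.trans (by rw [div_le_one (by linarith)]; exact hθ₀)
  set p₀ : ℝ := 4 * M with hp₀
  set ε : ℝ := min (ε₁ / 2) (1 / (4 * k + 2)) with hε
  have hε0 : 0 < ε := lt_min (half_pos hε₁) (by positivity)
  have hεk : ε * (4 * k + 2) ≤ 1 := by
    rw [← le_div_iff₀ (by positivity)]; exact min_le_right _ _
  have hε2 : ε ≤ 1 / 2 := by nlinarith
  have hpq : p₀.HolderConjugate (p₀ / (p₀ - 1)) := Real.HolderConjugate.conjExponent hM1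
  obtain ⟨A, hA⟩ := ComingDown.exists_duality_bound hθ₀ hχ hδ hδ1 hδθ (half_pos hμ).le hpq hε0
  have hD : ComingDown.DualityBound χ₀ χ₁ δ p₀ (p₀ / (p₀ - 1)) (μ / 2) ε A := hA
  obtain ⟨c, hc, hZ1⟩ := ComingDown.exists_le_besovNorm_one hD hpq.symm.pos hε2
  obtain ⟨C₁, hC₁, hbound⟩ := ComingDown.exists_apriori_bound hD hpq hε0.le hε2 hδ hδ1 hμ hr1 hk3
    hMk hM rfl (by rw [hp₀]; gcongr; linarith) hεk
  obtain ⟨C₂, hC₂⟩ := ComingDown.exists_weightedLpNorm_le hδ hμ (by linarith : 0 < p)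
    (by linarith : p ≤ 2 * r)
  -- chosen so that the exponent `1 / ((lam - 1) p)` of the claim is `1 / (k - 1)`
  set lam : ℝ := 1 + (k - 1) / p with hlam
  have hlp : lam * p = p + (k - 1) := by
    rw [hlam]; field_simp
  have hlp0 : 0 < lam * p := by rw [hlp]; linarith
  have hlp1 : (lam - 1) * p = k - 1 := by
    rw [hlam]; field_simp; ring
  set e : ℝ := p₀ / (lam * p) with he
  have he0 : 0 < e := by positivity
  have hee : p₀ / M ≤ e := by
    rw [he]
    refine div_le_div_of_nonneg_left (by positivity) hlp0 ?_
    rw [hlp, hMk']; linarith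
  obtain ⟨C₃, hC₃, hpow⟩ := ComingDown.exists_one_add_rpow_le hc hpq.pos hM0 hee
  refine ⟨lam, ε, p₀, μ / 2, C₂ * (C₁ * max 1 C₃).toNNReal + 1, ?_, hε0, ?_, hM1.le, ?_,
    half_pos hμ, half_lt_self hμ, ?_⟩
  · rw [hlam]
    have : 0 < (k - 1) / p := div_pos (by linarith) (by linarith)
    linarith
  · exact (min_le_left _ _).trans_lt (half_lt_self hε₁)
  · rw [hp₀]; linarith
  intro T hT X₀ Z Y hsol t ht htT
  rw [hlp1]
  set S : ℝ≥0∞ := ⨆ t' ∈ Set.Ioc (0 : ℝ) t, ∑ ℓ ∈ Finset.range (k + 1),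
    ComingDown.besovNorm χ₀ χ₁ δ (-ε) (μ / 2) p₀ p₀ (Z ℓ t') ^ e with hS
  rcases eq_or_ne S ⊤ with hStop | hStop
  -- an unbounded noise makes the right-hand side infinite
  · rw [hStop, max_eq_right le_top, ENNReal.mul_top (by simp)]
    exact le_top
  set β : ℝ := (S ^ (1 / e)).toReal with hβ
  have hSe : S ^ (1 / e) ≠ ⊤ := ENNReal.rpow_ne_top_of_nonneg (by positivity) hStop
  have hZβ : ∀ τ, 0 < τ → τ ≤ t → ∀ ℓ ≤ k,
      ComingDown.besovNorm χ₀ χ₁ δ (-ε) (μ / 2) p₀ p₀ (Z ℓ τ) ≤ ENNReal.ofReal β := by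
    intro τ hτ hτt ℓ hℓ
    rw [hβ, ENNReal.ofReal_toReal hSe, one_div, ENNReal.le_rpow_inv_iff he0]
    have h1 : ∑ ℓ ∈ Finset.range (k + 1),
        ComingDown.besovNorm χ₀ χ₁ δ (-ε) (μ / 2) p₀ p₀ (Z ℓ τ) ^ e ≤ S :=
      le_iSup₂_of_le τ ⟨hτ, hτt⟩ le_rfl
    refine le_trans ?_ h1
    exact Finset.single_le_sum
      (f := fun ℓ => ComingDown.besovNorm χ₀ χ₁ δ (-ε) (μ / 2) p₀ p₀ (Z ℓ τ) ^ e)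
      (fun _ _ => zero_le) (Finset.mem_range.2 (by omega))
  have hβ0 : 0 ≤ β := ENNReal.toReal_nonneg
  -- the constant noise `Z 0 = 1` bounds `β` from below
  have hcβ : c ≤ β := by
    have := (hZ1 (Z 0 t) (hsol.noise_zero t ht htT)).trans (hZβ t ht le_rfl 0 (Nat.zero_le k))
    exact (ENNReal.ofReal_le_ofReal_iff hβ0).1 this
  have hβe : ENNReal.ofReal (β ^ e) = S := by
    rw [← ENNReal.ofReal_rpow_of_nonneg hβ0 he0.le, hβ, ENNReal.ofReal_toReal hSe,
      ← ENNReal.rpow_mul, one_div_mul_cancel he0.ne', ENNReal.rpow_one]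
  have hmain := hbound T X₀ Z Y hsol t β ht htT hβ0 hZβ
  have hmax : max (t ^ (-(1 / ((k : ℝ) - 1)))) ((1 + β ^ p₀) ^ (1 / (M : ℝ))) ≤
      max 1 C₃ * max (t ^ (-(1 / ((k : ℝ) - 1)))) (β ^ e) := by
    have h0 : 0 ≤ t ^ (-(1 / ((k : ℝ) - 1))) := Real.rpow_nonneg ht.le _
    have h1 : 0 ≤ β ^ e := Real.rpow_nonneg hβ0 _
    have h2 : 0 ≤ max 1 C₃ := zero_le_one.trans (le_max_left _ _)
    refine max_le ?_ ((hpow β hcβ).trans ?_)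
    · calc _ ≤ max 1 C₃ * t ^ (-(1 / ((k : ℝ) - 1))) :=
            le_mul_of_one_le_left h0 (le_max_left _ _)
        _ ≤ _ := mul_le_mul_of_nonneg_left (le_max_left _ _) h2
    · calc C₃ * β ^ e ≤ max 1 C₃ * β ^ e := mul_le_mul_of_nonneg_right (le_max_right _ _) h1
        _ ≤ _ := mul_le_mul_of_nonneg_left (le_max_right _ _) h2
  have hC13 : 0 ≤ C₁ * max 1 C₃ := mul_nonneg hC₁ (zero_le_one.trans (le_max_left _ _))
  calc ComingDown.weightedLpNorm δ p μ (Y t)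
      ≤ C₂ * ComingDown.weightedLpNorm δ (2 * r) μ (Y t) :=
        hC₂ _ (hsol.contDiff t ht htT).continuous
    _ ≤ C₂ * ENNReal.ofReal (C₁ * max 1 C₃ * max (t ^ (-(1 / ((k : ℝ) - 1)))) (β ^ e)) := by
        gcongr
        refine hmain.trans (ENNReal.ofReal_le_ofReal ?_)
        rw [mul_assoc]
        exact mul_le_mul_of_nonneg_left hmax hC₁
    _ = (C₂ * (C₁ * max 1 C₃).toNNReal : ℝ≥0) *
        max (ENNReal.ofReal (t ^ (-(1 / ((k : ℝ) - 1))))) S := by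
        rw [ENNReal.ofReal_mul hC13, ENNReal.ofReal_max, hβe, ENNReal.coe_mul, mul_assoc]
        rfl
    _ ≤ _ := by
        gcongr
        exact le_self_add
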